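/- **Setting.** Let $U_q(\mathfrak g)$ be the quantized enveloping algebra of type $A_1^{(1)}$ over $\mathbb{Q}(q)$, with generators $E_i,F_i,K_i^{\pm1}$ $(i=1,2)$ and Cartan matrix $\begin{pmatrix}2&-2\\-2&2\end{pmatrix}$. Let $T_1,T_2$ be Lusztig's automorphisms $T'_{i,-1}$ of $U_q(\mathfrak g)$: for $j\neq i$, $$T_i(E_i)=-K_i^{-1}F_i,\quad T_i(F_i)=-E_iK_i,\quad T_i(K_i)=K_i^{-1},\quad T_i(K_j)=K_jK_i^{2},$$ $$T_i(E_j)=\sum_{r+s=2}(-1)^rq^{-r}E_i^{(r)}E_jE_i^{(s)},\qquad T_i(F_j)=\sum_{r+s=2}(-1)^rq^{r}F_i^{(s)}F_jF_i^{(r)}.$$ Put $v_0=E_1$, $v_1=T_1(E_2)$, $v_2=T_1T_2(E_1)$, $v_3=T_1T_2T_1(E_2)$. Let $U_q^+(w)$, $w=s_1s_2s_1s_2$, be the subalgebra generated by $v_0,\dots,v_3$, and let $u_i=(1-q^{-2})^{-2i}v_i$. For $\mathbf a=(a_3,a_2,a_1,a_0)\in\mathbb N^4$ let $$E[\mathbf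 a]=q^{\sum_i\binom{a_i}{2}}u_3^{a_3}u_2^{a_2}u_1^{a_1}u_0^{a_0},\qquad N(\mathbf a)=(a_3+a_2+a_1+a_0)^2-7a_3-5a_2-3a_1-a_0 .$$ Let $S(\mathbf a)$ be the set of all $\mathbf b\in\mathbb N^4$ with $\mathbf b\ne\mathbf a$ and $\mathbf b-\mathbf a\in\mathbb N(-1,2,-1,0)+\mathbb N(0,-1,2,-1)$. Let $\sigma$ be the ring anti-automorphism of $U_q^+(w)$ with $\sigma(q)=q^{-1}$ and $\sigma(u_i)=q^{2i}u_i$. The dual canonical basis element $B[\mathbf a]$ is the unique element of $U_q^+(w)$ with $$B[\mathbf a]-E[\mathbf a]\in\bigoplus_{\mathbf b\in S(\mathbf a)}q\mathbb Z[q]\,E[\mathbf b]\qquad\text{and}\qquad \sigma(B[\mathbf a])=q^{-N(\mathbf a)}B[\mathbf a].$$ Put $p_1=u_3u_1-q^2u_2^2$ and $p_0=u_2u_0-q^2u_1^2$. Write $[m]=\frac{q^m-q^{-m}}{q-q^{-1}}$ and ${m\brack k}=\frac{[m][m-1]\cdots[m-k+1]}{[k][k-1]\cdots[1]}$ for $m\in\mathbb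 Z$, $k\in\mathbb N$, and $$f(n,k,l)=n(n-2)+k(n+2)+l(n+1)-2kl,\qquad g(n,k,l)=n(n-3)+k(n+1)+l(n+1)-2kl .$$ The cluster algebra $\mathcal A(\mathcal C_M)$ lives in the field $\mathbb Q(U_0,U_1,U_2,U_3)$. Its initial seed has the mutable variables $U_0,U_1$, the frozen variables $P_0=U_2U_0-U_1^2$ and $P_1=U_3U_1-U_2^2$, and the quiver with double arrows $U_1\Rightarrow U_0$, $P_0\Rightarrow U_1$, $P_1\Rightarrow P_0$ and single arrows $U_0\to P_0$, $U_1\to P_1$. Its cluster variables (here including the frozen ones) are the variables of all seeds obtained from it by iterated mutation at the mutable vertices. Let $\mathcal A_{\mathbb Z}$ be the $\mathbb Z[q,q^{-1}]$-subalgebra of $U_q^+(w)$ generated by $u_0,\dots,u_3$ (which is the $\mathbb Z[q,q^{-1}]$-span of the monomials $u_3^{a_3}u_2^{a_2}u_1^{a_1}u_0^{a_0}$), and let $\mathcal A_1=\mathbb Q\otimes_{\mathbb Z[q,q^{-1}]}\mathcal A_{\mathbb Z}$, where $q$ acts on $\mathbb Q$ as $1$. **Theorem.** 1. For every $n\ge0$,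 $$u_2^nB[n+1,0,0,n]u_1^{n+1}=\sum_{k,l}q^{f(n,k,l)}{n-k\brack l}{n+1-l\brack k}\,p_1^{n+1-k}u_2^{2k}u_1^{2l}p_0^{n-l},$$ where the sum runs over all $(k,l)\in\mathbb N^2$ with $k+l\le n$ or $(k,l)=(n+1,0)$. 2. For every $n\ge0$, $$u_2^nB[n,0,0,n]u_1^{n}=\sum_{k,l}q^{g(n,k,l)}{n-k\brack l}{n-l\brack k}\,p_1^{n-k}u_2^{2k}u_1^{2l}p_0^{n-l},$$ where the sum runs over all $(k,l)\in\mathbb N^2$ with $k+l\le n$. 3. There is an isomorphism of $\mathbb Q$-algebras $\mathcal A_1\cong\mathbb Q[U_0,U_1,U_2,U_3]$ that sends $1\otimes u_i$ to $U_i$ for $i=0,1,2,3$. Under this isomorphism every cluster variable of $\mathcal A(\mathcal C_M)$ is equal to $1\otimes B[\mathbf a]$ for some $\mathbf a\in\mathbb N^4$ with $B[\mathbf a]\in\mathcal A_{\mathbb Z}$. -/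

import Mathlib

open scoped BigOperators TensorProduct LaurentPolynomial

noncomputable section

namespace KroneckerQuantum

/-! ### Scalars and quantum integers -/

/-- The base field `ℚ(q)`. -/
abbrev K : Type := RatFunc ℚ

/-- The deformation parameter `q`. -/
def q : K := RatFunc.X

theorem q_ne_zero : q ≠ 0 := RatFunc.X_ne_zero

/-- The quantum integer `[m] = (q^m - q^{-m}) / (q - q^{-1})`. -/
def qInt (m : ℤ) : K := (q ^ m - q ^ (-m)) / (q - q⁻¹)

/-- The quantum factorial `[k]!`. -/
def qFact (k : ℕ) : K := ∏ i ∈ Finset.range k, qInt ((i : ℤ) + 1)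

/-- The quantum binomial coefficient `[m] [m-1] ⋯ [m-k+1] / ([k] [k-1] ⋯ [1])`,
for an arbitrary integer `m` and a natural number `k`. -/
def qBinom (m : ℤ) (k : ℕ) : K := (∏ i ∈ Finset.range k, qInt (m - (i : ℤ))) / qFact k

/-! ### The quantized enveloping algebra `U_q(𝔤)` of type `A_1^{(1)}`

The two vertices, called `1` and `2` in the literature, are `0` and `1` in `Fin 2`. -/

/-- The generators `E_i`, `F_i`, `K_i`, `K_i^{-1}`. -/
inductive Gen : Type
  | E (i : Fin 2)
  | F (i : Fin 2)
  | K (i : Fin 2)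
  | Kinv (i : Fin 2)

/-- The free algebra on the generators. -/
abbrev Free : Type := FreeAlgebra K Gen

def gE (i : Fin 2) : Free := FreeAlgebra.ι K (Gen.E i)
def gF (i : Fin 2) : Free := FreeAlgebra.ι K (Gen.F i)
def gK (i : Fin 2) : Free := FreeAlgebra.ι K (Gen.K i)
def gKinv (i : Fin 2) : Free := FreeAlgebra.ι K (Gen.Kinv i)

/-- The Cartan matrix with diagonal entries `2` and off-diagonal entries `-2`. -/
def cartan (i j : Fin 2) : ℤ := if i = j then 2 else -2

/-- The left hand side of the quantized Serre relation. -/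
def serre (x y : Free) : Free :=
  x ^ 3 * y - qInt 3 • (x ^ 2 * y * x) + qInt 3 • (x * y * x ^ 2) - y * x ^ 3

/-- The defining relations of `U_q(𝔤)`. -/
inductive Rel : Free → Free → Prop
  | KK (i j : Fin 2) : Rel (gK i * gK j) (gK j * gK i)
  | K_Kinv (i : Fin 2) : Rel (gK i * gKinv i) 1
  | Kinv_K (i : Fin 2) : Rel (gKinv i * gK i) 1
  | KE (i j : Fin 2) : Rel (gK i * gE j * gKinv i) (q ^ cartan i j • gE j)
  | KF (i j : Fin 2) : Rel (gK i * gF j * gKinv i) (q ^ (-cartan i j) • gF j)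
  | EF_same (i : Fin 2) :
      Rel (gE i * gF i - gF i * gE i) ((q - q⁻¹)⁻¹ • (gK i - gKinv i))
  | EF_ne (i j : Fin 2) (h : i ≠ j) : Rel (gE i * gF j - gF j * gE i) 0
  | serreE (i j : Fin 2) (h : i ≠ j) : Rel (serre (gE i) (gE j)) 0
  | serreF (i j : Fin 2) (h : i ≠ j) : Rel (serre (gF i) (gF j)) 0

/-- The quantized enveloping algebra `U_q(𝔤)` of type `A_1^{(1)}`. -/
def UqG : Type := RingQuot Rel

instance : Ring UqG := inferInstanceAs (Ring (RingQuot Rel))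
instance : Algebra K UqG := inferInstanceAs (Algebra K (RingQuot Rel))

/-- The quotient map from the free algebra to `U_q(𝔤)`. -/
def toUqG : Free →ₐ[K] UqG := RingQuot.mkAlgHom K Rel

/-! ### Lusztig's automorphisms and the elements `v_0, v_1, v_2, v_3` -/

/-- The divided power `x^{(k)} = x^k / [k]!`. -/
def divPow (x : Free) (k : ℕ) : Free := (qFact k)⁻¹ • x ^ k

/-- Lusztig's `T_i = T'_{i,-1}` on generators.  The formula `T_i(K_j) = K_j K_i^{-a_{ij}}` is
spelled out: it reads `T_i(K_i) = K_i^{-1}` and `T_i(K_j) = K_j K_i^2` for `j ≠ i`. -/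
def braidGen (i : Fin 2) : Gen → Free
  | Gen.E j =>
      if j = i then -(gKinv i * gF i)
      else ∑ r ∈ Finset.range 3,
        ((-1) ^ r * q ^ (-(r : ℤ))) • (divPow (gE i) r * gE j * divPow (gE i) (2 - r))
  | Gen.F j =>
      if j = i then -(gE i * gK i)
      else ∑ r ∈ Finset.range 3,
        ((-1) ^ r * q ^ r) • (divPow (gF i) (2 - r) * gF j * divPow (gF i) r)
  | Gen.K j => if j = i then gKinv i else gK j * gK i ^ 2
  | Gen.Kinv j => if j = i then gK i else gKinv j * gKinv i ^ 2

/-- `T_i` as an endomorphism of the free algebra.  It lifts Lusztig's automorphism `T_i` of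
`U_q(𝔤)`, so the image in `U_q(𝔤)` of a composition of the `braid i` applied to a word is the
corresponding composition of Lusztig's automorphisms applied to the image of that word. -/
def braid (i : Fin 2) : Free →ₐ[K] Free := FreeAlgebra.lift K (braidGen i)

/-- `v_0 = E_1`, `v_1 = T_1(E_2)`, `v_2 = T_1 T_2 (E_1)`, `v_3 = T_1 T_2 T_1 (E_2)`. -/
def v : Fin 4 → UqG :=
  ![toUqG (gE 0),
    toUqG (braid 0 (gE 1)),
    toUqG (braid 0 (braid 1 (gE 0))),
    toUqG (braid 0 (braid 1 (braid 0 (gE 1))))]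

/-- The subalgebra `U_q^+(w)` of `U_q(𝔤)` for `w = s_1 s_2 s_1 s_2`, generated by the root vectors
`v_0, v_1, v_2, v_3`. -/
def UqPlus : Subalgebra K UqG := Algebra.adjoin K (Set.range v)

/-- `U_q^+(w)` as a type. -/
abbrev Uw : Type := UqPlus

/-- `v_i` as an element of `U_q^+(w)`. -/
def vw (i : Fin 4) : Uw := ⟨v i, Algebra.subset_adjoin ⟨i, rfl⟩⟩

/-! ### The dual PBW basis and the dual canonical basis -/

/-- The rescaled generators `u_i = (1 - q^{-2})^{-2i} v_i`. -/
def u (i : Fin 4) : Uw := (((1 - q ^ (-2 : ℤ)) ^ (2 * (i : ℕ)))⁻¹ : K) • vw i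

/-- Exponent vectors; the value at `i` is the exponent `a_i` of `u_i`. -/
abbrev Expo : Type := Fin 4 → ℕ

/-- The monomial `u_3^{a_3} u_2^{a_2} u_1^{a_1} u_0^{a_0}`. -/
def uMon (a : Expo) : Uw := u 3 ^ a 3 * u 2 ^ a 2 * u 1 ^ a 1 * u 0 ^ a 0

/-- The dual PBW basis element `E[a] = q^{b(a)} u_3^{a_3} u_2^{a_2} u_1^{a_1} u_0^{a_0}`, where
`b(a)` is the sum of the binomial coefficients `a_i` over `2`. -/
def dualPBW (a : Expo) : Uw := (q ^ (∑ i, (a i).choose 2)) • uMon a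

/-- The norm `N(a) = (a_3+a_2+a_1+a_0)^2 - 7 a_3 - 5 a_2 - 3 a_1 - a_0`. -/
def normN (a : Expo) : ℤ :=
  ((a 3 : ℤ) + a 2 + a 1 + a 0) ^ 2 - 7 * a 3 - 5 * a 2 - 3 * a 1 - a 0

/-- The partial order on exponents: `b - a` (written in the order `(3,2,1,0)`) is a combination
with natural coefficients of `(-1,2,-1,0)` and `(0,-1,2,-1)`. -/
def Below (a b : Expo) : Prop :=
  ∃ s r : ℕ, (b 3 : ℤ) = a 3 - s ∧ (b 2 : ℤ) = a 2 + 2 * s - r ∧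
    (b 1 : ℤ) = a 1 - s + 2 * r ∧ (b 0 : ℤ) = a 0 - r

/-- `σ` is the ring anti-automorphism of `U_q^+(w)` with `σ(q) = q^{-1}` and
`σ(u_i) = q^{2i} u_i`. -/
def IsSigma (σ : Uw ≃+* Uwᵐᵒᵖ) : Prop :=
  σ (algebraMap K Uw q) = MulOpposite.op (algebraMap K Uw q⁻¹) ∧
    ∀ i : Fin 4, σ (u i) = MulOpposite.op (q ^ (2 * (i : ℕ)) • u i)

/-- The two conditions that characterize the dual canonical basis element with index `a`:
`x - E[a]` is a combination with coefficients in `q ℤ[q]` of the `E[b]` with `b` strictly above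
`a`, and `σ(x) = q^{-N(a)} x`. -/
def IsDualCanonical (a : Expo) (x : Uw) : Prop :=
  (∃ c : Expo →₀ Polynomial ℤ, (∀ b ∈ c.support, Below a b ∧ b ≠ a) ∧
      x - dualPBW a = c.sum fun b p => (q * Polynomial.aeval q p) • dualPBW b) ∧
    ∃ σ : Uw ≃+* Uwᵐᵒᵖ, IsSigma σ ∧ σ x = MulOpposite.op (q ^ (-normN a) • x)

open Classical in
/-- The dual canonical basis element with index `a`: the unique element that satisfies
`IsDualCanonical a` (and `0` if there were no unique such element). -/
def dualCanonical (a : Expo) : Uw :=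
  if h : ∃! x : Uw, IsDualCanonical a x then h.choose else 0

/-- `B[a_3, a_2, a_1, a_0]`. -/
def B (a₃ a₂ a₁ a₀ : ℕ) : Uw := dualCanonical ![a₀, a₁, a₂, a₃]

/-- `p_1 = u_3 u_1 - q^2 u_2^2`. -/
def p₁ : Uw := u 3 * u 1 - q ^ 2 • u 2 ^ 2

/-- `p_0 = u_2 u_0 - q^2 u_1^2`. -/
def p₀ : Uw := u 2 * u 0 - q ^ 2 • u 1 ^ 2

/-- The exponent `f(n,k,l)`. -/
def f (n k l : ℤ) : ℤ := n * (n - 2) + k * (n + 2) + l * (n + 1) - 2 * k * l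

/-- The exponent `g(n,k,l)`. -/
def g (n k l : ℤ) : ℤ := n * (n - 3) + k * (n + 1) + l * (n + 1) - 2 * k * l

/-- The pairs `(k,l)` of natural numbers with `k + l ≤ n`. -/
def pairs (n : ℕ) : Finset (ℕ × ℕ) :=
  (Finset.range (n + 1) ×ˢ Finset.range (n + 1)).filter fun p => p.1 + p.2 ≤ n

/-- The pairs `(k,l)` of natural numbers with `k + l ≤ n` or `(k,l) = (n+1,0)`. -/
def pairs' (n : ℕ) : Finset (ℕ × ℕ) := insert (n + 1, 0) (pairs n)

/-! ### The integral form and the specialization `q = 1` -/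

/-- The embedding of `ℤ[q,q^{-1}]` into `ℚ(q)`. -/
def laurentToK : ℤ[T;T⁻¹] →+* K :=
  LaurentPolynomial.eval₂ (Int.castRingHom K) (Units.mk0 q q_ne_zero)

/-- `U_q^+(w)` as an algebra over `ℤ[q,q^{-1}]`. -/
instance : Algebra ℤ[T;T⁻¹] Uw := Algebra.compHom Uw laurentToK

/-- The integral form `A_ℤ` of `U_q^+(w)`: the `ℤ[q,q^{-1}]`-subalgebra generated by the `u_i`.
By the straightening relations, which have coefficients in `ℤ[q,q^{-1}]`, this is the
`ℤ[q,q^{-1}]`-span of the ordered monomials `uMon a`. -/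
def AZ : Subalgebra ℤ[T;T⁻¹] Uw := Algebra.adjoin ℤ[T;T⁻¹] (Set.range u)

/-- `u_i` as an element of the integral form. -/
def uZ (i : Fin 4) : AZ := ⟨u i, Algebra.subset_adjoin ⟨i, rfl⟩⟩

/-- The field `ℚ`, regarded below as a `ℤ[q,q^{-1}]`-algebra through `q ↦ 1`. -/
def Qone : Type := ℚ

instance : Field Qone := inferInstanceAs (Field ℚ)
instance : Algebra ℚ Qone := inferInstanceAs (Algebra ℚ ℚ)
instance : Algebra ℤ[T;T⁻¹] Qone :=
  (LaurentPolynomial.eval₂ (Int.castRingHom Qone) 1).toAlgebra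

/-- The classical limit `A_1 = ℚ ⊗ A_ℤ` over `ℤ[q,q^{-1}]`, where `q` acts on `ℚ` as `1`. -/
abbrev A₁ : Type := Qone ⊗[ℤ[T;T⁻¹]] AZ

/-! ### Seeds, mutation, and the cluster variables of `A(C_M)` -/

/-- A seed: cluster variables `x` (mutable and frozen) and the matrix `b` of its quiver, where
`b i j` is the number of arrows `i → j` minus the number of arrows `j → i`. -/
structure Seed (ι F : Type) where
  x : ι → F
  b : ι → ι → ℤ

/-- Mutation of a seed in direction `k`. -/
def Seed.mutate {ι F : Type} [Fintype ι] [DecidableEq ι] [Field F] (s : Seed ι F) (k : ι) :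
    Seed ι F where
  x i := if i = k then
      (∏ j, s.x j ^ (s.b j k).toNat + ∏ j, s.x j ^ (-s.b j k).toNat) / s.x k
    else s.x i
  b i j := if i = k ∨ j = k then -s.b i j
    else s.b i j + max (s.b i k) 0 * max (s.b k j) 0 - max (-s.b i k) 0 * max (-s.b k j) 0

/-- The polynomial ring `ℚ[U_0,U_1,U_2,U_3]`. -/
abbrev Pol : Type := MvPolynomial (Fin 4) ℚ

/-- The field of rational functions in `U_0, U_1, U_2, U_3`. -/
abbrev Frac : Type := FractionRing Pol

/-- The variable `U_i`. -/
def U (i : Fin 4) : Frac := algebraMap Pol Frac (MvPolynomial.X i)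

/-- The initial seed `(U_0, U_1, P_0, P_1)` of `A(C_M)` with `P_0 = U_2 U_0 - U_1^2` and
`P_1 = U_3 U_1 - U_2^2`.  The arrows of the quiver, in this order of its vertices, are
`U_1 ⇒ U_0`, `P_0 ⇒ U_1`, `P_1 ⇒ P_0` (double) and `U_0 → P_0`, `U_1 → P_1` (simple). -/
def initialSeed : Seed (Fin 4) Frac where
  x := ![U 0, U 1, U 2 * U 0 - U 1 ^ 2, U 3 * U 1 - U 2 ^ 2]
  b := ![![0, -2, 1, 0], ![2, 0, -2, 1], ![-1, 2, 0, -2], ![0, -1, 2, 0]]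

/-- The seeds obtained from the initial one by mutations at the two mutable vertices `0`, `1`
(the vertices `2`, `3` are frozen). -/
inductive Reachable : Seed (Fin 4) Frac → Prop
  | init : Reachable initialSeed
  | mutate (s : Seed (Fin 4) Frac) (k : Fin 4) (hk : k = 0 ∨ k = 1) (h : Reachable s) :
      Reachable (s.mutate k)

/-- The cluster variables of `A(C_M)`, including the frozen ones. -/
def IsClusterVariable (y : Frac) : Prop :=
  ∃ s : Seed (Fin 4) Frac, Reachable s ∧ ∃ i : Fin 4, y = s.x i

end KroneckerQuantum

end

set_option linter.unusedSimpArgs false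
set_option linter.unusedSectionVars false
open scoped BigOperators TensorProduct LaurentPolynomial
noncomputable section
namespace KroneckerQuantum

/-! The elements `B[n+1,0,0,n]` and `B[n,0,0,n]` are not computed from their definition. Explicit
elements `dcX n` and `dcS n` are built inside the integral form by an alternating recursion
(`dcState`) and then shown to satisfy the two characterizing conditions. The recursion multiplies by
`u 3` on the left or by `u 0` on the right and subtracts a correction that contains `p₁` or `p₀`, so
triangularity with respect to the dual PBW basis is a matter of counting powers of `q`
(`dc_leading`). After multiplication by powers of `u 2` on the left and of `u 1` on the right,
everything becomes a polynomial in `p₁, u 2, u 1, p₀`, which commute up to powers of `q`. There the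
recursion turns into the `q`-Pascal rule, which gives both expansions (`dc_expansion`). Their
coefficients are powers of `q` times bar-invariant quantum binomials, and the monomials are
eigenvectors of `σ`, so the behaviour under `σ` is again a comparison of exponents
(`sig_eq_of_expansion`), because `u 1` and `u 2` are not zero divisors. Uniqueness is Lusztig's
triangularity argument (`IsDualCanonical.unique`).

All of this rests on a PBW theorem for `Uw`. For the straightening relations, the braid operator
composed with the exchange of the two vertices preserves solutions of the defining relations
(`QRep.shift`). It gives an endomorphism `shiftHom` that sends `v i` to `v (i+1)` and fixes the
imaginary root vector `delta`. The commutator with `delta` also moves `v i` to a multiple of `v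
(i+1)`, so all six relations follow from the one between `v 1` and `v 0`, which is a Serre relation.
For the independence of the ordered monomials, a tensor product of two evaluation modules is used in
which `u 1`, `u 2` and the two quasi-commuting elements act injectively (`exists_leads`). Monomials
in these four elements are separated by their commutation scalars, and ordered monomials reduce to
them (`Straight.mon_leading`). Relations together with independence amount to a presentation
(`Straight.exists_lift`), from which `σ`, the reversal `rev` and the specialization `q = 1` are
obtained.

At `q = 1` the integral form becomes a polynomial ring and `dcX n` becomes `clX n`, which satisfies
a linear recursion of order two with constant coefficients. Its determinant identity is the exchange
relation (`clX_exchange`). Together with the reversed elements this gives a sequence `clY` indexed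
by `ℤ`, and the mutable variables of every reachable seed are two consecutive terms of it
(`Reachable.isSeedAt`). -/

theorem mul_mul_of_mul {A : Type*} [Semigroup A] {x y z : A} (h : x * y = z) (t : A) :
    x * (y * t) = z * t := by rw [← mul_assoc, h]

/-! ### Solutions of the defining relations in an arbitrary algebra. -/

/-- The parameter avoids the roots of unity of small order. -/
structure Generic {k : Type*} [Field k] (q : k) : Prop where
  ne_zero : q ≠ 0
  sub_ne : q ^ 2 - 1 ≠ 0
  add_ne : q ^ 2 + 1 ≠ 0
  three_ne : q ^ 4 + q ^ 2 + 1 ≠ 0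
  four_ne : q ^ 4 + 1 ≠ 0

section
variable {k A : Type*} [Field k] [Ring A] [Algebra k A] {q : k}

/-- The twisted commutator `P ↦ P a - c a P`, with `c` the scalar by which `a` passes the weight of
`P`, is a `q`-derivation `b ↦ w ↦ (q + q⁻¹) v ↦ 0`. Four applications carry the relation in `b, b,
w` to one in `w, v, v`. The accumulated scalar is a product of polynomials in `q` that `Generic`
keeps away from zero. -/
theorem serre_shift (hq : Generic q) {a b w v : A}
    (hba : b * a = w + (q ^ 2)⁻¹ • (a * b)) (hwa : w * a = a * w + (q + q⁻¹) • v)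
    (hva : v * a = q ^ 2 • (a * v))
    (h0 : b * (b * w) - (1 + q ^ 2) • (b * (w * b)) + q ^ 2 • (w * (b * b)) = 0) :
    w * (v * v) - (1 + q ^ 2) • (v * (w * v)) + q ^ 2 • (v * (v * w)) = 0 := by
  have hq0 := hq.ne_zero
  have r1 := mul_mul_of_mul hba
  have r2 := mul_mul_of_mul hwa
  have r3 := mul_mul_of_mul hva
  have key : ∀ (P Q : A) (c : k), P = 0 → P * a - c • (a * P) = Q → Q = 0 := by
    rintro P Q c rfl h; simpa using h.symm
  have h1 := key _ ((1 * (q ^ 1)⁻¹ + 1 * q ^ 1) • (b * (b * v)) + (-1 * q ^ 2) • (b * (w * w)) + (1 * (q ^ 2)⁻¹ + 1 * q ^ 2) • (w * (b * w)) + (-1 * (q ^ 3)⁻¹ + -2 * (q ^ 1)⁻¹ + -1 * q ^ 1) • (b * (v * b)) + (-1 * (q ^ 2)⁻¹) • (w * (w * b)) + (1 * (q ^ 3)⁻¹ + 1 * (q ^ 1)⁻¹) • (v * (b * b))) ((q ^ 4)⁻¹) h0 (by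
      simp only [mul_assoc, mul_add, add_mul, mul_sub, sub_mul, smul_mul_assoc, mul_smul_comm,
        smul_add, smul_sub, smul_smul, hba, hwa, hva, r1, r2, r3]
      match_scalars <;> field_simp <;> ring)
  have h2 := key _ ((1 * (q ^ 3)⁻¹ + 2 * (q ^ 1)⁻¹ + 2 * q ^ 1 + 1 * q ^ 3) • (w * (b * v)) + (-1 * (q ^ 3)⁻¹ + -2 * (q ^ 1)⁻¹ + -2 * q ^ 1 + -1 * q ^ 3) • (b * (v * w)) + (1 * (q ^ 5)⁻¹ + 2 * (q ^ 3)⁻¹ + 2 * (q ^ 1)⁻¹ + 1 * q ^ 1) • (v * (b * w)) + (-1 * (q ^ 5)⁻¹ + -2 * (q ^ 3)⁻¹ + -2 * (q ^ 1)⁻¹ + -1 * q ^ 1) • (w * (v * b))) ((q ^ 2)⁻¹) h1 (by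
      simp only [mul_assoc, mul_add, add_mul, mul_sub, sub_mul, smul_mul_assoc, mul_smul_comm,
        smul_add, smul_sub, smul_smul, hba, hwa, hva, r1, r2, r3]
      match_scalars <;> field_simp <;> ring)
  have h3 := key _ ((1 * (q ^ 1)⁻¹ + 2 * q ^ 1 + 2 * q ^ 3 + 1 * q ^ 5) • (w * (w * v)) + (1 * (q ^ 6)⁻¹ + 4 * (q ^ 4)⁻¹ + 7 * (q ^ 2)⁻¹ + 7 * q ^ 0 + 4 * q ^ 2 + 1 * q ^ 4) • (v * (b * v)) + (-1 * (q ^ 4)⁻¹ + -3 * (q ^ 2)⁻¹ + -4 * q ^ 0 + -3 * q ^ 2 + -1 * q ^ 4) • (b * (v * v)) + (-1 * (q ^ 5)⁻¹ + -2 * (q ^ 3)⁻¹ + -3 * (q ^ 1)⁻¹ + -3 * q ^ 1 + -2 * q ^ 3 + -1 * q ^ 5) • (w * (v * w)) + (1 * (q ^ 5)⁻¹ + 2 * (q ^ 3)⁻¹ + 2 * (q ^ 1)⁻¹ + 1 * q ^ 1) • (v * (w * w)) + (-1 * (q ^ 6)⁻¹ + -3 * (q ^ 4)⁻¹ + -4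 * (q ^ 2)⁻¹ + -3 * q ^ 0 + -1 * q ^ 2) • (v * (v * b))) (1) h2 (by
      simp only [mul_assoc, mul_add, add_mul, mul_sub, sub_mul, smul_mul_assoc, mul_smul_comm,
        smul_add, smul_sub, smul_smul, hba, hwa, hva, r1, r2, r3]
      match_scalars <;> field_simp <;> ring)
  have h4 := key _ ((-1 * (q ^ 6)⁻¹ + -3 * (q ^ 4)⁻¹ + -5 * (q ^ 2)⁻¹ + -6 * q ^ 0 + -5 * q ^ 2 + -3 * q ^ 4 + -1 * q ^ 6) • (w * (v * v)) + (1 * (q ^ 6)⁻¹ + 4 * (q ^ 4)⁻¹ + 8 * (q ^ 2)⁻¹ + 11 * q ^ 0 + 11 * q ^ 2 + 8 * q ^ 4 + 4 * q ^ 6 + 1 * q ^ 8) • (v * (w * v)) + (-1 * (q ^ 4)⁻¹ + -3 * (q ^ 2)⁻¹ + -5 * q ^ 0 + -6 * q ^ 2 + -5 * q ^ 4 + -3 * q ^ 6 + -1 * q ^ 8) • (v * (v * w))) ((q ^ 2)) h3 (by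
      simp only [mul_assoc, mul_add, add_mul, mul_sub, sub_mul, smul_mul_assoc, mul_smul_comm,
        smul_add, smul_sub, smul_smul, hba, hwa, hva, r1, r2, r3]
      match_scalars <;> field_simp <;> ring)
  have hc : (q ^ 2 + 1) ^ 2 * (q ^ 4 + q ^ 2 + 1) * (q ^ 4 + 1) ≠ 0 :=
    mul_ne_zero (mul_ne_zero (pow_ne_zero 2 hq.add_ne) hq.three_ne) hq.four_ne
  have hc' : -((q ^ 2 + 1) ^ 2 * (q ^ 4 + q ^ 2 + 1) * (q ^ 4 + 1)) * (q ^ 6)⁻¹ ≠ 0 :=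
    mul_ne_zero (neg_ne_zero.mpr hc) (inv_ne_zero (pow_ne_zero 6 hq0))
  refine (smul_eq_zero.mp (Eq.trans ?_ h4)).resolve_left hc'
  match_scalars <;> field_simp <;> ring

/-- The left hand side of the quantized Serre relation in an arbitrary algebra. -/
def qSerre (q : k) (x y : A) : A :=
  x ^ 3 * y - (q ^ 2 + 1 + (q ^ 2)⁻¹) • (x ^ 2 * y * x)
    + (q ^ 2 + 1 + (q ^ 2)⁻¹) • (x * y * x ^ 2) - y * x ^ 3

/-- Elements of an algebra that satisfy the defining relations of `U_q(𝔤)`. -/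
structure QRep (q : k) (a b F G x xi y yi : A) : Prop where
  xxi : x * xi = 1
  xix : xi * x = 1
  yyi : y * yi = 1
  yiy : yi * y = 1
  yx : y * x = x * y
  xa : x * a = q ^ 2 • (a * x)
  xb : x * b = (q ^ 2)⁻¹ • (b * x)
  ya : y * a = (q ^ 2)⁻¹ • (a * y)
  yb : y * b = q ^ 2 • (b * y)
  xF : x * F = (q ^ 2)⁻¹ • (F * x)
  xG : x * G = q ^ 2 • (G * x)
  yF : y * F = q ^ 2 • (F * y)
  yG : y * G = (q ^ 2)⁻¹ • (G * y)
  aF : a * F - F * a = (q - q⁻¹)⁻¹ • (x - xi)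
  bG : b * G - G * b = (q - q⁻¹)⁻¹ • (y - yi)
  aG : a * G = G * a
  bF : b * F = F * b
  sab : qSerre q a b = 0
  sba : qSerre q b a = 0
  sFG : qSerre q F G = 0
  sGF : qSerre q G F = 0

theorem inv_comm_rule {c : k} (hc : c ≠ 0) {x xi a : A} (h1 : x * xi = 1) (h2 : xi * x = 1)
    (h : x * a = c • (a * x)) : xi * a = c⁻¹ • (a * xi) := by
  have : xi * (x * a) * xi = c • (xi * a) := by
    rw [h, mul_smul_comm, smul_mul_assoc, mul_assoc, mul_assoc, h1, mul_one]
  rw [← mul_assoc, h2, one_mul] at this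
  rw [this, smul_smul, inv_mul_cancel₀ hc, one_smul]

theorem inv_comm_rule' {c : k} (hc : c ≠ 0) {x xi a : A} (h1 : x * xi = 1) (h2 : xi * x = 1)
    (h : x * a = c⁻¹ • (a * x)) : xi * a = c • (a * xi) := by
  simpa using inv_comm_rule (inv_ne_zero hc) h1 h2 h

theorem inv_commute {x xi a : A} (h1 : x * xi = 1) (h2 : xi * x = 1)
    (h : x * a = a * x) : xi * a = a * xi := by
  calc xi * a = xi * (a * x) * xi := by rw [mul_assoc, mul_assoc, h1, mul_one]
    _ = a * xi := by rw [← h, ← mul_assoc, h2, one_mul]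

namespace QRep
variable {a b F G x xi y yi : A}

theorem qSerre_op (hq : q ≠ 0) (x y : A) :
    qSerre q⁻¹ (MulOpposite.op x) (MulOpposite.op y) = -MulOpposite.op (qSerre q x y) := by
  apply MulOpposite.unop_injective
  simp only [qSerre, MulOpposite.unop_sub, MulOpposite.unop_add, MulOpposite.unop_mul,
    MulOpposite.unop_smul, MulOpposite.unop_pow, MulOpposite.unop_op, MulOpposite.unop_neg,
    mul_assoc]
  match_scalars <;> field_simp <;> ring

-- Reversing products, inverting `q` and exchanging raising with lowering elements is a symmetry of
-- the relations. It makes every statement about lowering elements a consequence of one about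
-- raising elements.
open MulOpposite in
theorem opp (hq : q ≠ 0) (h : QRep q a b F G x xi y yi) :
    QRep q⁻¹ (op F) (op G) (op a) (op b) (op xi) (op x) (op yi) (op y) where
  xxi := by rw [← op_mul, h.xxi, op_one]
  xix := by rw [← op_mul, h.xix, op_one]
  yyi := by rw [← op_mul, h.yyi, op_one]
  yiy := by rw [← op_mul, h.yiy, op_one]
  yx := by
    rw [← op_mul, ← op_mul]
    have h1 := inv_commute h.yyi h.yiy h.yx
    have h2 := inv_commute h.xxi h.xix h1.symm
    rw [h2]
  xa := by
    rw [← op_mul, ← op_mul, inv_comm_rule' (pow_ne_zero 2 hq) h.xxi h.xix h.xF, op_smul, smul_smul]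
    field_simp; simp
  xb := by
    rw [← op_mul, ← op_mul, inv_comm_rule (pow_ne_zero 2 hq) h.xxi h.xix h.xG, op_smul, smul_smul]
    field_simp; simp
  ya := by
    rw [← op_mul, ← op_mul, inv_comm_rule (pow_ne_zero 2 hq) h.yyi h.yiy h.yF, op_smul, smul_smul]
    field_simp; simp
  yb := by
    rw [← op_mul, ← op_mul, inv_comm_rule' (pow_ne_zero 2 hq) h.yyi h.yiy h.yG, op_smul, smul_smul]
    field_simp; simp
  xF := by
    rw [← op_mul, ← op_mul, inv_comm_rule (pow_ne_zero 2 hq) h.xxi h.xix h.xa, op_smul, smul_smul]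
    field_simp; simp
  xG := by
    rw [← op_mul, ← op_mul, inv_comm_rule' (pow_ne_zero 2 hq) h.xxi h.xix h.xb, op_smul, smul_smul]
    field_simp; simp
  yF := by
    rw [← op_mul, ← op_mul, inv_comm_rule' (pow_ne_zero 2 hq) h.yyi h.yiy h.ya, op_smul, smul_smul]
    field_simp; simp
  yG := by
    rw [← op_mul, ← op_mul, inv_comm_rule (pow_ne_zero 2 hq) h.yyi h.yiy h.yb, op_smul, smul_smul]
    field_simp; simp
  aF := by
    rw [← op_mul, ← op_mul, ← op_sub, h.aF, ← op_sub, op_smul, inv_inv, ← neg_sub q q⁻¹, inv_neg,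
      neg_smul, ← smul_neg, ← op_neg, neg_sub]
  bG := by
    rw [← op_mul, ← op_mul, ← op_sub, h.bG, ← op_sub, op_smul, inv_inv, ← neg_sub q q⁻¹, inv_neg,
      neg_smul, ← smul_neg, ← op_neg, neg_sub]
  aG := by rw [← op_mul, ← op_mul, h.bF]
  bF := by rw [← op_mul, ← op_mul, h.aG]
  sab := by rw [qSerre_op hq, h.sFG]; simp
  sba := by rw [qSerre_op hq, h.sGF]; simp
  sFG := by rw [qSerre_op hq, h.sab]; simp
  sGF := by rw [qSerre_op hq, h.sba]; simp

end QRep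
end
end KroneckerQuantum

/-! ### Root vectors and the braid operator on solutions of the relations. -/

namespace KroneckerQuantum
section
variable {k A : Type*} [Field k] [Ring A] [Algebra k A] {q : k}

/-- The root vector of weight `δ`. -/
def deltaVec (q : k) (a b : A) : A := b * a - (q ^ 2)⁻¹ • (a * b)

/-- The image of `b` under the braid operator attached to `a`. -/
def nextVec (q : k) (a b : A) : A := (q + q⁻¹)⁻¹ • (deltaVec q a b * a - a * deltaVec q a b)

/-- The image of `G` under the braid operator attached to `F`. -/
def nextVecF (q : k) (F G : A) : A :=
  (q + q⁻¹)⁻¹ • (F * (F * G - q ^ 2 • (G * F)) - (F * G - q ^ 2 • (G * F)) * F)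

theorem nextVec_op (F G : A) :
    nextVec q⁻¹ (MulOpposite.op F) (MulOpposite.op G) = MulOpposite.op (nextVecF q F G) := by
  apply MulOpposite.unop_injective
  simp [nextVec, nextVecF, deltaVec, add_comm]

namespace Generic
variable (hq : Generic q)
include hq
theorem sub_inv_ne : q - q⁻¹ ≠ 0 := by
  have := hq.ne_zero; have := hq.sub_ne
  rw [show q - q⁻¹ = (q ^ 2 - 1) * q⁻¹ by field_simp]; positivity
theorem add_inv_ne : q + q⁻¹ ≠ 0 := by
  have := hq.ne_zero; have := hq.add_ne
  rw [show q + q⁻¹ = (q ^ 2 + 1) * q⁻¹ by field_simp]; positivity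
theorem inv : Generic q⁻¹ where
  ne_zero := inv_ne_zero hq.ne_zero
  sub_ne := by
    have h0 := hq.ne_zero
    rw [show q⁻¹ ^ 2 - 1 = -(q ^ 2 - 1) * (q ^ 2)⁻¹ by field_simp; ring]
    exact mul_ne_zero (neg_ne_zero.mpr hq.sub_ne) (by positivity)
  add_ne := by
    have h0 := hq.ne_zero
    rw [show q⁻¹ ^ 2 + 1 = (q ^ 2 + 1) * (q ^ 2)⁻¹ by field_simp; ring]
    exact mul_ne_zero hq.add_ne (by positivity)
  three_ne := by
    have h0 := hq.ne_zero
    rw [show q⁻¹ ^ 4 + q⁻¹ ^ 2 + 1 = (q ^ 4 + q ^ 2 + 1) * (q ^ 4)⁻¹ by field_simp; ring]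
    exact mul_ne_zero hq.three_ne (by positivity)
  four_ne := by
    have h0 := hq.ne_zero
    rw [show q⁻¹ ^ 4 + 1 = (q ^ 4 + 1) * (q ^ 4)⁻¹ by field_simp; ring]
    exact mul_ne_zero hq.four_ne (by positivity)
end Generic

namespace QRep
variable {a b F G x xi y yi : A}

section rules
variable (hq : Generic q) (h : QRep q a b F G x xi y yi)
include hq h

theorem ba : b * a = deltaVec q a b + (q ^ 2)⁻¹ • (a * b) := by simp [deltaVec]

theorem wa : deltaVec q a b * a = a * deltaVec q a b + (q + q⁻¹) • nextVec q a b := by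
  rw [nextVec, smul_smul, mul_inv_cancel₀ hq.add_inv_ne]; simp

/-- A multiple of the Serre relation: `nextVec` is an iterated commutator with `a`, and one more
twisted commutator with `a` is the cubic Serre expression. -/
theorem va : nextVec q a b * a = q ^ 2 • (a * nextVec q a b) := by
  have h0 := hq.ne_zero
  have h1 := hq.add_inv_ne
  have h2 := hq.add_ne
  have := congrArg (fun t => -(q + q⁻¹)⁻¹ • t) h.sab
  rw [← sub_eq_zero]
  refine Eq.trans ?_ (this.trans (smul_zero _))
  simp only [nextVec, deltaVec, qSerre, mul_sub, sub_mul, smul_sub, smul_add, smul_mul_assoc,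
    mul_smul_comm, smul_smul, mul_assoc, pow_succ, pow_zero, one_mul]
  match_scalars <;> field_simp <;> ring

theorem bw : b * (b * deltaVec q a b) - (1 + q ^ 2) • (b * (deltaVec q a b * b))
    + q ^ 2 • (deltaVec q a b * (b * b)) = 0 := by
  have h0 := hq.ne_zero
  refine Eq.trans ?_ h.sba
  simp only [deltaVec, qSerre, mul_sub, sub_mul, smul_sub, smul_add, smul_mul_assoc,
    mul_smul_comm, smul_smul, mul_assoc, pow_succ, pow_zero, one_mul]
  match_scalars <;> field_simp <;> ring

theorem wvv : deltaVec q a b * (nextVec q a b * nextVec q a b)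
    - (1 + q ^ 2) • (nextVec q a b * (deltaVec q a b * nextVec q a b))
    + q ^ 2 • (nextVec q a b * (nextVec q a b * deltaVec q a b)) = 0 :=
  serre_shift hq (h.ba hq) (h.wa hq) (h.va hq) (h.bw hq)

theorem Fa : F * a = a * F - (q - q⁻¹)⁻¹ • (x - xi) := by rw [← h.aF]; simp
theorem Gb : G * b = b * G - (q - q⁻¹)⁻¹ • (y - yi) := by rw [← h.bG]; simp

theorem xia : xi * a = (q ^ 2)⁻¹ • (a * xi) :=
  inv_comm_rule (pow_ne_zero 2 hq.ne_zero) h.xxi h.xix h.xa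
theorem xib : xi * b = q ^ 2 • (b * xi) :=
  inv_comm_rule' (pow_ne_zero 2 hq.ne_zero) h.xxi h.xix h.xb
theorem xiF : xi * F = q ^ 2 • (F * xi) :=
  inv_comm_rule' (pow_ne_zero 2 hq.ne_zero) h.xxi h.xix h.xF
theorem xiG : xi * G = (q ^ 2)⁻¹ • (G * xi) :=
  inv_comm_rule (pow_ne_zero 2 hq.ne_zero) h.xxi h.xix h.xG
theorem yia : yi * a = q ^ 2 • (a * yi) :=
  inv_comm_rule' (pow_ne_zero 2 hq.ne_zero) h.yyi h.yiy h.ya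
theorem yib : yi * b = (q ^ 2)⁻¹ • (b * yi) :=
  inv_comm_rule (pow_ne_zero 2 hq.ne_zero) h.yyi h.yiy h.yb
theorem yiF : yi * F = (q ^ 2)⁻¹ • (F * yi) :=
  inv_comm_rule (pow_ne_zero 2 hq.ne_zero) h.yyi h.yiy h.yF
theorem xiy : xi * y = y * xi := inv_commute h.xxi h.xix h.yx.symm
theorem yix : yi * x = x * yi := inv_commute h.yyi h.yiy h.yx
theorem yixi : yi * xi = xi * yi := inv_commute h.yyi h.yiy (h.xiy hq).symm

theorem xw : x * deltaVec q a b = deltaVec q a b * x := by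
  have h0 := hq.ne_zero
  simp only [deltaVec, mul_sub, sub_mul, mul_smul_comm, smul_mul_assoc, mul_assoc, h.xa, h.xb,
    mul_mul_of_mul h.xa, mul_mul_of_mul h.xb, smul_smul]
  match_scalars <;> field_simp
theorem yw : y * deltaVec q a b = deltaVec q a b * y := by
  have h0 := hq.ne_zero
  simp only [deltaVec, mul_sub, sub_mul, mul_smul_comm, smul_mul_assoc, mul_assoc, h.ya, h.yb,
    mul_mul_of_mul h.ya, mul_mul_of_mul h.yb, smul_smul]
  match_scalars <;> field_simp
theorem xiw : xi * deltaVec q a b = deltaVec q a b * xi := inv_commute h.xxi h.xix (h.xw hq)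

theorem xv : x * nextVec q a b = q ^ 2 • (nextVec q a b * x) := by
  have h0 := hq.ne_zero
  simp only [nextVec, mul_sub, sub_mul, mul_smul_comm, smul_mul_assoc, mul_assoc, h.xa, h.xw hq,
    mul_mul_of_mul h.xa, mul_mul_of_mul (h.xw hq), smul_smul, smul_sub]
  match_scalars <;> field_simp
theorem yv : y * nextVec q a b = (q ^ 2)⁻¹ • (nextVec q a b * y) := by
  have h0 := hq.ne_zero
  simp only [nextVec, mul_sub, sub_mul, mul_smul_comm, smul_mul_assoc, mul_assoc, h.ya, h.yw hq,
    mul_mul_of_mul h.ya, mul_mul_of_mul (h.yw hq), smul_smul, smul_sub]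
  match_scalars <;> field_simp
theorem xiv : xi * nextVec q a b = (q ^ 2)⁻¹ • (nextVec q a b * xi) :=
  inv_comm_rule (pow_ne_zero 2 hq.ne_zero) h.xxi h.xix (h.xv hq)

theorem Fw : F * deltaVec q a b = deltaVec q a b * F - ((q ^ 2)⁻¹ * (q + q⁻¹)) • (b * x) := by
  have h0 := hq.ne_zero
  have h1 := hq.sub_inv_ne
  have h2 := hq.sub_ne
  simp only [deltaVec, mul_sub, sub_mul, mul_smul_comm, smul_mul_assoc, mul_assoc, h.Fa hq,
    mul_mul_of_mul (h.Fa hq), ← h.bF, mul_mul_of_mul h.bF.symm, smul_smul, smul_sub, h.xb,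
    h.xib hq, mul_mul_of_mul h.xb, mul_mul_of_mul (h.xib hq)]
  match_scalars <;> field_simp <;> ring

theorem Fv : F * nextVec q a b = nextVec q a b * F - deltaVec q a b * x := by
  have h0 := hq.ne_zero
  have h1 := hq.sub_inv_ne
  have h2 := hq.sub_ne
  have h3 := hq.add_inv_ne
  have h4 := hq.add_ne
  have e : ∀ t : A, t * deltaVec q a b = t * (b * a) - (q ^ 2)⁻¹ • (t * (a * b)) := by
    intro t; simp [deltaVec, mul_sub]
  simp only [nextVec, mul_sub, sub_mul, mul_smul_comm, smul_mul_assoc, mul_assoc, h.Fa hq,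
    mul_mul_of_mul (h.Fa hq), h.Fw hq, mul_mul_of_mul (h.Fw hq), smul_smul, smul_sub, h.xa,
    h.xia hq, h.xw hq, h.xiw hq]
  have hw : deltaVec q a b * x = b * (a * x) - (q ^ 2)⁻¹ • (a * (b * x)) := by
    simp [deltaVec, sub_mul, mul_assoc]
  rw [hw]
  match_scalars <;> field_simp <;> ring

end rules
end QRep
end
end KroneckerQuantum

namespace KroneckerQuantum
section
variable {k A : Type*} [Field k] [Ring A] [Algebra k A] {q : k}
namespace QRep
variable {a b F G x xi y yi : A}

section rules
variable (hq : Generic q) (h : QRep q a b F G x xi y yi)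
include hq h

theorem Xv : -(xi * F) * nextVec q a b
    = (q ^ 2)⁻¹ • (nextVec q a b * -(xi * F)) + deltaVec q a b := by
  simp only [neg_mul, mul_neg, mul_assoc, h.Fv hq, mul_sub, mul_mul_of_mul (h.xiv hq),
    mul_mul_of_mul (h.xiw hq), h.xix, smul_mul_assoc, mul_one, smul_neg]
  abel

theorem Xw : -(xi * F) * deltaVec q a b = deltaVec q a b * -(xi * F) + (q + q⁻¹) • b := by
  have h0 := hq.ne_zero
  simp only [neg_mul, mul_neg, mul_assoc, h.Fw hq, mul_sub, mul_mul_of_mul (h.xib hq),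
    mul_mul_of_mul (h.xiw hq), h.xix, smul_mul_assoc, mul_one, smul_neg, mul_smul_comm, smul_smul]
  match_scalars <;> field_simp

theorem Xb : -(xi * F) * b = q ^ 2 • (b * -(xi * F)) := by
  simp only [neg_mul, mul_neg, mul_assoc, ← h.bF, mul_mul_of_mul (h.xib hq), smul_mul_assoc,
    smul_neg]

/-- Moving `X` to the right past each `v` cancels all terms that contain `X` and leaves the
quadratic relation `wvv`, up to sign. -/
theorem serre_vX : qSerre q (nextVec q a b) (-(xi * F)) = 0 := by
  have h0 := hq.ne_zero
  generalize hX : -(xi * F) = X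
  generalize hv : nextVec q a b = v
  generalize hw : deltaVec q a b = w
  have h1 : X * v = (q ^ 2)⁻¹ • (v * X) + w := by subst hX hv hw; exact h.Xv hq
  have h2 : w * (v * v) - (1 + q ^ 2) • (v * (w * v)) + q ^ 2 • (v * (v * w)) = 0 := by
    subst hv hw; exact h.wvv hq
  have h3 := mul_mul_of_mul h1
  refine Eq.trans ?_ ((congrArg (fun t => (-1 : k) • t) h2).trans (smul_zero _))
  simp only [qSerre, mul_sub, sub_mul, smul_sub, smul_add, smul_mul_assoc, mul_add, add_mul,
    mul_smul_comm, smul_smul, mul_assoc, pow_succ, pow_zero, one_mul, h1, h3]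
  match_scalars <;> field_simp <;> ring

/-- Twisted commutation with `X` acts as `v ↦ w ↦ (q + q⁻¹) b ↦ 0`, and the Serre expression is its
third iterate. -/
theorem serre_Xv : qSerre q (-(xi * F)) (nextVec q a b) = 0 := by
  have h0 := hq.ne_zero
  generalize hX : -(xi * F) = X
  generalize hv : nextVec q a b = v
  generalize hw : deltaVec q a b = w
  have h1 : X * v = (q ^ 2)⁻¹ • (v * X) + w := by subst hX hv hw; exact h.Xv hq
  have h2 : X * w = w * X + (q + q⁻¹) • b := by subst hX hw; exact h.Xw hq
  have h3 : X * b = q ^ 2 • (b * X) := by subst hX; exact h.Xb hq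
  have r1 := mul_mul_of_mul h1
  have r2 := mul_mul_of_mul h2
  have r3 := mul_mul_of_mul h3
  simp only [qSerre, mul_sub, sub_mul, smul_sub, smul_add, smul_mul_assoc, mul_add, add_mul,
    mul_smul_comm, smul_smul, mul_assoc, pow_succ, pow_zero, one_mul, h1, h2, h3, r1, r2, r3]
  match_scalars <;> field_simp <;> ring

theorem vY : nextVec q a b * -(a * x) = -(a * x) * nextVec q a b := by
  have h0 := hq.ne_zero
  simp only [neg_mul, mul_neg, mul_assoc, h.xv hq, mul_mul_of_mul (h.va hq), smul_mul_assoc,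
    mul_smul_comm]

theorem XY : -(xi * F) * -(a * x) - -(a * x) * -(xi * F) = (q - q⁻¹)⁻¹ • (xi - x) := by
  have h0 := hq.ne_zero
  simp only [neg_mul_neg, mul_assoc, mul_mul_of_mul h.xxi, mul_mul_of_mul (h.Fa hq), one_mul,
    mul_mul_of_mul (h.xiF hq), mul_mul_of_mul (h.xia hq), mul_sub, sub_mul, smul_mul_assoc,
    mul_smul_comm, h.xix, mul_one, smul_smul, mul_mul_of_mul h.xix]
  match_scalars <;> field_simp <;> ring

theorem bPsi : b * nextVecF q F G = nextVecF q F G * b + (q ^ 4 - q ^ 2) • (F * (F * y)) := by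
  have h0 := hq.ne_zero
  have h1 := hq.sub_inv_ne
  have h2 := hq.sub_ne
  have h3 := hq.add_inv_ne
  have h4 := hq.add_ne
  simp only [nextVecF, mul_sub, sub_mul, smul_mul_assoc,
    mul_smul_comm, mul_assoc, ← h.bF, mul_mul_of_mul h.bF.symm, h.Gb hq, mul_mul_of_mul (h.Gb hq),
    h.yF, mul_mul_of_mul h.yF, h.yiF hq, mul_mul_of_mul (h.yiF hq), smul_sub, smul_smul]
  match_scalars <;> field_simp <;> ring

/-- This is `Fv` for the opposite solution at `q⁻¹`. -/
theorem aPsi : a * nextVecF q F G = nextVecF q F G * a + xi * (F * G - q ^ 2 • (G * F)) := by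
  have := congrArg MulOpposite.unop ((h.opp hq.ne_zero).Fv hq.inv)
  rw [nextVec_op] at this
  have h2 : nextVecF q F G * a = a * nextVecF q F G - xi * (F * G - q ^ 2 • (G * F)) := by
    simpa [deltaVec] using this
  rw [h2, sub_add_cancel]

theorem wPsi : deltaVec q a b * nextVecF q F G - nextVecF q F G * deltaVec q a b
    = -((q ^ 2)⁻¹ * (q + q⁻¹)) • (xi * (F * (y * (x * x)))) := by
  have h0 := hq.ne_zero
  have h1 := hq.sub_inv_ne
  have h2 := hq.sub_ne
  have ha := h.aPsi hq
  have hb := h.bPsi hq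
  generalize nextVecF q F G = P at *
  simp only [deltaVec, mul_sub, sub_mul, smul_mul_assoc, mul_smul_comm, mul_assoc, ha, hb,
    mul_mul_of_mul ha, mul_mul_of_mul hb, mul_add, add_mul, smul_add, smul_sub, smul_smul]
  simp only [← h.bF, ← h.aG, mul_mul_of_mul h.bF.symm, mul_mul_of_mul h.aG.symm, h.Gb hq,
    mul_mul_of_mul (h.Gb hq), h.Fa hq, mul_mul_of_mul (h.Fa hq), mul_mul_of_mul (h.xib hq),
    mul_mul_of_mul (h.xia hq), mul_sub, sub_mul, mul_smul_comm, smul_mul_assoc, smul_smul, h.yF,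
    h.yiF hq, mul_mul_of_mul h.yF, mul_mul_of_mul (h.yiF hq), h.ya, mul_mul_of_mul h.ya, smul_sub,
    h.xF, h.xiF hq, mul_mul_of_mul h.xF, mul_mul_of_mul (h.xiF hq), mul_assoc,
    mul_mul_of_mul h.yx, h.yx, h.xiy hq, mul_mul_of_mul (h.xiy hq), h.xix,
    mul_mul_of_mul h.xix, h.xG, h.xiG hq, mul_mul_of_mul h.xG, mul_mul_of_mul (h.xiG hq),
    h.xxi, mul_mul_of_mul h.xxi, one_mul, mul_one]
  match_scalars <;> field_simp <;> ring

theorem Gw : G * deltaVec q a b = deltaVec q a b * G + (q + q⁻¹) • (a * yi) := by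
  have h0 := hq.ne_zero
  have h1 := hq.sub_inv_ne
  have h2 := hq.sub_ne
  simp only [deltaVec, mul_sub, sub_mul, mul_smul_comm, smul_mul_assoc, mul_assoc, h.Gb hq,
    mul_mul_of_mul (h.Gb hq), ← h.aG, mul_mul_of_mul h.aG.symm, smul_smul, smul_sub, h.ya,
    h.yia hq, mul_mul_of_mul h.ya, mul_mul_of_mul (h.yia hq)]
  match_scalars <;> field_simp <;> ring

/-- Since `nextVec` is a multiple of the commutator of `deltaVec` with `a`, its bracket with
`nextVecF` follows from the brackets in `aPsi` and `wPsi`. After all factors are brought to a fixed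
order only the toral part survives. -/
theorem vPsi : nextVec q a b * nextVecF q F G - nextVecF q F G * nextVec q a b
    = (q - q⁻¹)⁻¹ • (y * x ^ 2 - yi * xi ^ 2) := by
  have h0 := hq.ne_zero
  have h1 := hq.sub_inv_ne
  have h2 := hq.sub_ne
  have h3 := hq.add_inv_ne
  have h4 := hq.add_ne
  have ha := h.aPsi hq
  have hw := sub_eq_iff_eq_add.mp (h.wPsi hq)
  have hwx := h.xiw hq
  have hF := h.Fw hq
  have hG := h.Gw hq
  generalize nextVecF q F G = P at *
  generalize hW : deltaVec q a b = w at *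
  simp only [nextVec, hW, mul_sub, sub_mul, smul_mul_assoc, mul_smul_comm, mul_assoc, ha, hw,
    mul_mul_of_mul ha, mul_mul_of_mul hw, mul_add, add_mul, smul_add, smul_sub, smul_smul, hF, hG,
    mul_mul_of_mul hF, mul_mul_of_mul hG, mul_mul_of_mul hwx]
  simp only [← h.bF, ← h.aG, mul_mul_of_mul h.bF.symm, mul_mul_of_mul h.aG.symm, h.Gb hq,
    mul_mul_of_mul (h.Gb hq), h.Fa hq, mul_mul_of_mul (h.Fa hq), mul_mul_of_mul (h.xib hq),
    mul_mul_of_mul (h.xia hq), mul_sub, sub_mul, mul_smul_comm, smul_mul_assoc, smul_smul, h.yF,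
    h.yiF hq, mul_mul_of_mul h.yF, mul_mul_of_mul (h.yiF hq), h.ya, mul_mul_of_mul h.ya, smul_sub,
    h.xF, h.xiF hq, mul_mul_of_mul h.xF, mul_mul_of_mul (h.xiF hq), mul_assoc,
    h.xa, h.xia hq, mul_mul_of_mul h.xa,
    h.xb, h.xib hq, mul_mul_of_mul h.xb,
    h.yia hq, mul_mul_of_mul (h.yia hq),
    mul_mul_of_mul h.yx, h.yx, h.xiy hq, mul_mul_of_mul (h.xiy hq), h.xix,
    mul_mul_of_mul h.xix, h.xG, h.xiG hq, mul_mul_of_mul h.xG, mul_mul_of_mul (h.xiG hq),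
    h.xxi, mul_mul_of_mul h.xxi, one_mul, mul_one, h.yix hq, h.yixi hq, mul_mul_of_mul (h.yix hq),
    mul_mul_of_mul (h.yixi hq), pow_two]
  match_scalars <;> field_simp <;> ring

end rules
end QRep
end
end KroneckerQuantum

namespace KroneckerQuantum
section
variable {k A : Type*} [Field k] [Ring A] [Algebra k A] {q : k}
namespace QRep
variable {a b F G x xi y yi : A}

section rules
variable (hq : Generic q) (h : QRep q a b F G x xi y yi)
include hq h

theorem yX : y * -(xi * F) = q ^ 2 • (-(xi * F) * y) := by
  simp only [mul_neg, neg_mul, ← mul_assoc, ← h.xiy hq]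
  simp only [mul_assoc, h.yF, mul_smul_comm, smul_neg]

theorem xX : x * -(xi * F) = (q ^ 2)⁻¹ • (-(xi * F) * x) := by
  have h0 := hq.ne_zero
  simp only [mul_neg, neg_mul, mul_assoc, mul_mul_of_mul h.xxi, one_mul, h.xF]
  rw [show F * x = q ^ 2 • (x * F) by rw [h.xF, smul_smul]; field_simp; simp]
  simp only [mul_smul_comm, mul_mul_of_mul h.xix, one_mul, smul_neg, smul_smul]
  field_simp; simp

theorem xPsi : x * nextVecF q F G = (q ^ 2)⁻¹ • (nextVecF q F G * x) := by
  have h0 := hq.ne_zero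
  have := congrArg MulOpposite.unop ((h.opp h0).xiv hq.inv)
  rw [nextVec_op] at this
  simp only [MulOpposite.unop_mul, MulOpposite.unop_op, MulOpposite.unop_smul] at this
  rw [this, smul_smul]; field_simp; simp

theorem yPsi : y * nextVecF q F G = q ^ 2 • (nextVecF q F G * y) := by
  have h0 := hq.ne_zero
  have h1 := inv_comm_rule (inv_ne_zero (pow_ne_zero 2 (inv_ne_zero h0)))
    (h.opp h0).yyi (h.opp h0).yiy ((h.opp h0).yv hq.inv)
  have := congrArg MulOpposite.unop h1
  rw [nextVec_op] at this
  simp only [MulOpposite.unop_mul, MulOpposite.unop_op, MulOpposite.unop_smul] at this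
  rw [this, smul_smul]; field_simp; simp

/-- The automorphism obtained from the braid operator of the first vertex and the exchange of the
two vertices, on the level of relations. -/
theorem shift : QRep q (nextVec q a b) (-(xi * F)) (nextVecF q F G) (-(a * x))
    (y * x ^ 2) (yi * xi ^ 2) xi x where
  xxi := by
    simp only [pow_two, mul_assoc, mul_mul_of_mul (h.yix hq).symm, mul_mul_of_mul h.xxi,
      mul_mul_of_mul h.yyi, one_mul, h.xxi]
  xix := by
    simp only [pow_two, mul_assoc]
    simp only [← mul_assoc, h.xiy hq, h.yixi hq]
    simp only [mul_assoc, mul_mul_of_mul (h.xiy hq), mul_mul_of_mul h.yiy, mul_mul_of_mul h.xix,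
      one_mul, h.xix]
  yyi := h.xix
  yiy := h.xxi
  yx := by
    simp only [pow_two, mul_mul_of_mul (h.xiy hq), mul_assoc, h.xix, h.xxi, mul_mul_of_mul h.xix,
      one_mul, mul_one]
  xa := by
    have h0 := hq.ne_zero
    simp only [pow_two, mul_assoc, h.xv hq, h.yv hq, mul_mul_of_mul (h.xv hq),
      mul_mul_of_mul (h.yv hq), mul_smul_comm, smul_mul_assoc, smul_smul]
    field_simp
  xb := by
    have h0 := hq.ne_zero
    have h1 := h.xX hq
    have h2 := h.yX hq
    generalize -(xi * F) = X at *
    simp only [pow_two, mul_assoc, h1, h2, mul_mul_of_mul h1, mul_mul_of_mul h2,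
      mul_smul_comm, smul_mul_assoc, smul_smul]
    field_simp
  ya := h.xiv hq
  yb := by
    have := congrArg (fun t => -(xi * t)) (h.xiF hq)
    simpa only [mul_neg, neg_mul, mul_assoc, mul_smul_comm, smul_neg] using this
  xF := by
    have h0 := hq.ne_zero
    have h1 := h.xPsi hq
    have h2 := h.yPsi hq
    simp only [pow_two, mul_assoc, h1, h2, mul_mul_of_mul h1, mul_mul_of_mul h2,
      mul_smul_comm, smul_mul_assoc, smul_smul]
    field_simp
  xG := by
    have h0 := hq.ne_zero
    simp only [pow_two, mul_assoc, mul_neg, neg_mul, mul_mul_of_mul h.xa, mul_mul_of_mul h.ya,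
      mul_mul_of_mul h.yx, mul_smul_comm, smul_mul_assoc, smul_smul, smul_neg]
    field_simp
  yF := inv_comm_rule' (pow_ne_zero 2 hq.ne_zero) h.xxi h.xix (h.xPsi hq)
  yG := by
    simp only [mul_neg, neg_mul, mul_assoc, mul_mul_of_mul (h.xia hq), smul_mul_assoc, smul_neg,
      h.xix, h.xxi]
  aF := h.vPsi hq
  bG := h.XY hq
  aG := h.vY hq
  -- This relation and the two Serre relations among lowering elements are those of the raising
  -- elements for the opposite solution at `q⁻¹`.
  bF := by
    have := congrArg MulOpposite.unop ((h.opp hq.ne_zero).vY hq.inv)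
    rw [nextVec_op] at this
    simpa using this
  sab := h.serre_vX hq
  sba := h.serre_Xv hq
  sFG := by
    have := (h.opp hq.ne_zero).serre_vX hq.inv
    rw [nextVec_op, ← MulOpposite.op_mul, ← MulOpposite.op_neg, qSerre_op hq.ne_zero] at this
    simpa using this
  sGF := by
    have := (h.opp hq.ne_zero).serre_Xv hq.inv
    rw [nextVec_op, ← MulOpposite.op_mul, ← MulOpposite.op_neg, qSerre_op hq.ne_zero] at this
    simpa using this

end rules
end QRep
end

/-! ### Genericity of `q`, and homomorphisms out of `U_q(𝔤)`. -/

theorem q_pow_ne_one {n : ℕ} (hn : n ≠ 0) : q ^ n ≠ 1 := by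
  intro h
  have h2 : (Polynomial.X ^ n : Polynomial ℚ) = 1 := by
    apply RatFunc.algebraMap_injective ℚ
    simpa [q] using h
  have := congrArg Polynomial.natDegree h2
  simp at this
  exact hn this

theorem generic_q : Generic q where
  ne_zero := q_ne_zero
  sub_ne := sub_ne_zero.mpr (q_pow_ne_one two_ne_zero)
  add_ne h := q_pow_ne_one (n := 4) (by norm_num) (by linear_combination (q ^ 2 - 1) * h)
  three_ne h := q_pow_ne_one (n := 6) (by norm_num) (by linear_combination (q ^ 2 - 1) * h)
  four_ne h := q_pow_ne_one (n := 8) (by norm_num) (by linear_combination (q ^ 4 - 1) * h)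

theorem qInt_two : qInt 2 = q + q⁻¹ := by
  have h0 := q_ne_zero
  have h1 := generic_q.sub_inv_ne
  rw [qInt, div_eq_iff h1]
  simp [zpow_ofNat]; field_simp; ring

theorem qInt_three : qInt 3 = q ^ 2 + 1 + (q ^ 2)⁻¹ := by
  have h0 := q_ne_zero
  have h1 := generic_q.sub_inv_ne
  rw [qInt, div_eq_iff h1]
  simp [zpow_ofNat]; field_simp; ring

theorem qInt_one : qInt 1 = 1 := by
  have h1 := generic_q.sub_inv_ne
  simp [qInt, div_self h1]

theorem toUqG_rel {x y : Free} (h : Rel x y) : toUqG x = toUqG y := RingQuot.mkAlgHom_rel K h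

theorem qRep_uqG : QRep q (toUqG (gE 0)) (toUqG (gE 1)) (toUqG (gF 0)) (toUqG (gF 1))
    (toUqG (gK 0)) (toUqG (gKinv 0)) (toUqG (gK 1)) (toUqG (gKinv 1)) := by
  have kk : ∀ i j, toUqG (gK i) * toUqG (gK j) = toUqG (gK j) * toUqG (gK i) := fun i j => by
    simpa using toUqG_rel (Rel.KK i j)
  have k1 : ∀ i, toUqG (gK i) * toUqG (gKinv i) = 1 := fun i => by
    simpa using toUqG_rel (Rel.K_Kinv i)
  have k2 : ∀ i, toUqG (gKinv i) * toUqG (gK i) = 1 := fun i => by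
    simpa using toUqG_rel (Rel.Kinv_K i)
  have conj : ∀ (i) (x : UqG) (c : K), toUqG (gK i) * x * toUqG (gKinv i) = c • x →
      toUqG (gK i) * x = c • (x * toUqG (gK i)) := fun i x c h => by
    rw [← smul_mul_assoc, ← h, mul_assoc, k2, mul_one]
  have ke : ∀ i j, toUqG (gK i) * toUqG (gE j)
      = q ^ cartan i j • (toUqG (gE j) * toUqG (gK i)) := fun i j =>
    conj _ _ _ (by simpa using toUqG_rel (Rel.KE i j))
  have kf : ∀ i j, toUqG (gK i) * toUqG (gF j)
      = q ^ (-cartan i j) • (toUqG (gF j) * toUqG (gK i)) := fun i j =>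
    conj _ _ _ (by simpa only [map_mul, map_smul] using toUqG_rel (Rel.KF i j))
  have ef : ∀ i, toUqG (gE i) * toUqG (gF i) - toUqG (gF i) * toUqG (gE i)
      = (q - q⁻¹)⁻¹ • (toUqG (gK i) - toUqG (gKinv i)) := fun i => by
    simpa only [map_mul, map_sub, map_smul] using toUqG_rel (Rel.EF_same i)
  have efn : ∀ i j, i ≠ j → toUqG (gE i) * toUqG (gF j) = toUqG (gF j) * toUqG (gE i) :=
    fun i j h => by
      simpa only [map_mul, map_sub, map_zero, sub_eq_zero] using toUqG_rel (Rel.EF_ne i j h)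
  have se : ∀ x y, toUqG (serre x y) = qSerre q (toUqG x) (toUqG y) := fun x y => by
    simp only [serre, qSerre, map_sub, map_add, map_mul, map_smul, map_pow, qInt_three]
  have sE : ∀ i j, i ≠ j → qSerre q (toUqG (gE i)) (toUqG (gE j)) = 0 := fun i j h => by
    rw [← se]; simpa using toUqG_rel (Rel.serreE i j h)
  have sF : ∀ i j, i ≠ j → qSerre q (toUqG (gF i)) (toUqG (gF j)) = 0 := fun i j h => by
    rw [← se]; simpa using toUqG_rel (Rel.serreF i j h)
  exact {
    xxi := k1 0
    xix := k2 0
    yyi := k1 1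
    yiy := k2 1
    yx := kk 1 0
    xa := ke 0 0
    xb := by rw [ke 0 1]; rfl
    ya := by rw [ke 1 0]; rfl
    yb := ke 1 1
    xF := kf 0 0
    xG := by rw [kf 0 1]; rfl
    yF := by rw [kf 1 0]; rfl
    yG := kf 1 1
    aF := ef 0
    bG := ef 1
    aG := efn 0 1 (by decide)
    bF := efn 1 0 (by decide)
    sab := sE 0 1 (by decide)
    sba := sE 1 0 (by decide)
    sFG := sF 0 1 (by decide)
    sGF := sF 1 0 (by decide) }

section lift
variable {A : Type*} [Ring A] [Algebra K A] {a b F G x xi y yi : A}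

/-- The values on the generators of the homomorphism attached to a solution of the relations. -/
def genVal (a b F G x xi y yi : A) : Gen → A
  | Gen.E i => ![a, b] i
  | Gen.F i => ![F, G] i
  | Gen.K i => ![x, y] i
  | Gen.Kinv i => ![xi, yi] i

theorem lift_rel (h : QRep q a b F G x xi y yi) ⦃s t : Free⦄ (r : Rel s t) :
    FreeAlgebra.lift K (genVal a b F G x xi y yi) s
      = FreeAlgebra.lift K (genVal a b F G x xi y yi) t := by
  have conj : ∀ {x xi e : A} (c : K), x * xi = 1 → x * e = c • (e * x) → x * e * xi = c • e :=
    fun c h1 h => by rw [h, smul_mul_assoc, mul_assoc, h1, mul_one]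
  have e2 : q ^ (-2 : ℤ) = (q ^ 2)⁻¹ := rfl
  have e3 : q ^ (2 : ℤ) = q ^ 2 := rfl
  have se : ∀ s t, FreeAlgebra.lift K (genVal a b F G x xi y yi) (serre s t)
      = qSerre q (FreeAlgebra.lift K (genVal a b F G x xi y yi) s)
        (FreeAlgebra.lift K (genVal a b F G x xi y yi) t) := fun x y => by
    simp only [serre, qSerre, map_sub, map_add, map_mul, map_smul, map_pow, qInt_three]
  have hE : ∀ i, FreeAlgebra.lift K (genVal a b F G x xi y yi) (gE i) = ![a, b] i := fun i => by
    simp [gE, genVal]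
  have hF : ∀ i, FreeAlgebra.lift K (genVal a b F G x xi y yi) (gF i) = ![F, G] i := fun i => by
    simp [gF, genVal]
  have hK : ∀ i, FreeAlgebra.lift K (genVal a b F G x xi y yi) (gK i) = ![x, y] i := fun i => by
    simp [gK, genVal]
  have hKi : ∀ i, FreeAlgebra.lift K (genVal a b F G x xi y yi) (gKinv i) = ![xi, yi] i :=
    fun i => by simp [gKinv, genVal]
  cases r with
  | KK i j => fin_cases i <;> fin_cases j <;> simp [hK, h.yx]
  | K_Kinv i => fin_cases i <;> simp [hK, hKi, h.xxi, h.yyi]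
  | Kinv_K i => fin_cases i <;> simp [hK, hKi, h.xix, h.yiy]
  | KE i j =>
    fin_cases i <;> fin_cases j <;> simp [hK, hKi, hE, cartan, e2, e3]
    exacts [conj _ h.xxi h.xa, conj _ h.xxi h.xb, conj _ h.yyi h.ya, conj _ h.yyi h.yb]
  | KF i j =>
    fin_cases i <;> fin_cases j <;> simp [hK, hKi, hF, cartan, e2, e3]
    exacts [conj _ h.xxi h.xF, conj _ h.xxi h.xG, conj _ h.yyi h.yF, conj _ h.yyi h.yG]
  | EF_same i => fin_cases i <;> simp [hK, hKi, hF, hE, h.aF, h.bG]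
  | EF_ne i j hij =>
    fin_cases i <;> fin_cases j <;> simp [hF, hE, h.aG, h.bF] <;> exact absurd rfl hij
  | serreE i j hij =>
    rw [se]
    fin_cases i <;> fin_cases j <;> simp [hE, h.sab, h.sba] <;> exact absurd rfl hij
  | serreF i j hij =>
    rw [se]
    fin_cases i <;> fin_cases j <;> simp [hF, h.sFG, h.sGF] <;> exact absurd rfl hij

/-- The homomorphism from `U_q(𝔤)` attached to a solution of its defining relations. -/
def QRep.lift (h : QRep q a b F G x xi y yi) : UqG →ₐ[K] A :=
  RingQuot.liftAlgHom K ⟨FreeAlgebra.lift K (genVal a b F G x xi y yi), lift_rel h⟩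

theorem QRep.lift_toUqG (h : QRep q a b F G x xi y yi) (z : Free) :
    h.lift (toUqG z) = FreeAlgebra.lift K (genVal a b F G x xi y yi) z :=
  RingQuot.liftAlgHom_mkAlgHom_apply K _ _ z

end lift
-- The root vectors in `U_q(𝔤)` and their straightening relations.
section
variable {k A : Type*} [Field k] [Ring A] [Algebra k A] {q : k}

theorem nextVec_eq (hq : Generic q) (a b : A) : nextVec q a b
    = b * ((q + q⁻¹)⁻¹ • a ^ 2) + -(q⁻¹ • (a * b * a)) + (q ^ 2)⁻¹ • ((q + q⁻¹)⁻¹ • (a ^ 2) * b) := by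
  have h0 := hq.ne_zero
  have h1 := hq.add_inv_ne
  have h2 := hq.add_ne
  simp only [nextVec, deltaVec, mul_sub, sub_mul, smul_sub, mul_smul_comm, smul_mul_assoc,
    mul_assoc, smul_smul, pow_two]
  match_scalars <;> field_simp <;> ring

theorem nextVecF_eq (hq : Generic q) (a b : A) : nextVecF q a b
    = (q + q⁻¹)⁻¹ • a ^ 2 * b + -(q • (a * b * a)) + q ^ 2 • (b * (q + q⁻¹)⁻¹ • (a ^ 2)) := by
  have h0 := hq.ne_zero
  have h1 := hq.add_inv_ne
  have h2 := hq.add_ne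
  simp only [nextVecF, mul_sub, sub_mul, smul_sub, mul_smul_comm, smul_mul_assoc,
    mul_assoc, smul_smul, pow_two]
  match_scalars <;> field_simp <;> ring

/-- Commutation with `d` is a derivation that sends `v₀` and `v₁` to `(q + q⁻¹) v₁` and `(q + q⁻¹)
v₂`. The claim is its value on the `q`-commutation of `v₁` and `v₀`; applying it once more gives
`derive_next`. -/
theorem derive_adjacent (hq : Generic q) {d v₀ v₁ v₂ : A}
    (r0 : d * v₀ = v₀ * d + (q + q⁻¹) • v₁) (r1 : d * v₁ = v₁ * d + (q + q⁻¹) • v₂)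
    (h : v₁ * v₀ = q ^ 2 • (v₀ * v₁)) :
    v₂ * v₀ = q ^ 2 • (v₀ * v₂) + (q ^ 2 - 1) • (v₁ * v₁) := by
  have h := congrArg (fun t => (q + q⁻¹)⁻¹ • (d * t - t * d)) h
  have h0 := hq.ne_zero
  have h2 := hq.add_ne
  simp only [mul_smul_comm, smul_mul_assoc, mul_mul_of_mul r0, mul_mul_of_mul r1, add_mul, mul_add,
    mul_assoc, r0, r1] at h
  rw [← sub_eq_zero] at h ⊢
  refine Eq.trans ?_ h
  match_scalars <;> field_simp <;> ring

theorem derive_next (hq : Generic q) {d v₀ v₁ v₂ v₃ : A}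
    (r0 : d * v₀ = v₀ * d + (q + q⁻¹) • v₁) (r1 : d * v₁ = v₁ * d + (q + q⁻¹) • v₂)
    (r2 : d * v₂ = v₂ * d + (q + q⁻¹) • v₃) (h21 : v₂ * v₁ = q ^ 2 • (v₁ * v₂))
    (h : v₂ * v₀ = q ^ 2 • (v₀ * v₂) + (q ^ 2 - 1) • (v₁ * v₁)) :
    v₃ * v₀ = q ^ 2 • (v₀ * v₃) + (q ^ 2 - (q ^ 2)⁻¹) • (v₂ * v₁) := by
  have h := congrArg (fun t => (q + q⁻¹)⁻¹ • (d * t - t * d)) h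
  have h0 := hq.ne_zero
  have h2 := hq.add_ne
  simp only [mul_smul_comm, smul_mul_assoc, mul_mul_of_mul r0, mul_mul_of_mul r1,
    mul_mul_of_mul r2, add_mul, mul_add, mul_assoc, r0, r1, r2, h21] at h
  rw [h21]
  rw [← sub_eq_zero] at h ⊢
  refine Eq.trans ?_ h
  match_scalars <;> field_simp <;> ring
end

/-- The exchange of the two vertices on generators. -/
def swapGen : Gen → Free
  | Gen.E i => gE (Equiv.swap 0 1 i)
  | Gen.F i => gF (Equiv.swap 0 1 i)
  | Gen.K i => gK (Equiv.swap 0 1 i)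
  | Gen.Kinv i => gKinv (Equiv.swap 0 1 i)

/-- The exchange of the two vertices on the free algebra. -/
def swapFree : Free →ₐ[K] Free := FreeAlgebra.lift K swapGen

/-- The symmetry of the diagram. It allows each composition that defines a root vector to be
rewritten with `braid 0` and the exchange only, hence with powers of a single endomorphism. -/
theorem braid_one : braid 1 = (swapFree.comp (braid 0)).comp swapFree := by
  apply FreeAlgebra.hom_ext
  funext g
  rcases g with i | i | i | i <;> fin_cases i <;>
    simp [braid, swapFree, braidGen, swapGen, gE, gF, gK, gKinv, divPow]

/-- The endomorphism of `U_q(𝔤)` that sends the root vector `v_i` to `v_{i+1}`. -/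
def shiftHom : UqG →ₐ[K] UqG := (qRep_uqG.shift generic_q).lift

theorem qFact_zero : qFact 0 = 1 := by simp [qFact]
theorem qFact_one : qFact 1 = 1 := by simp [qFact, qInt_one]
theorem qFact_two : qFact 2 = q + q⁻¹ := by
  simp [qFact, Finset.prod_range_succ, qInt_one, ← qInt_two, one_add_one_eq_two]

/-- Links the formulas on the free algebra to the tuple chosen in `QRep.shift`; through it the
operator descends to the quotient. -/
theorem toUqG_braid_swap (z : Free) : toUqG (braid 0 (swapFree z)) = shiftHom (toUqG z) := by
  have : (toUqG.comp (braid 0)).comp swapFree = shiftHom.comp toUqG := by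
    apply FreeAlgebra.hom_ext
    funext g
    have h0 := q_ne_zero
    have h1 := generic_q.add_inv_ne
    have h2 := generic_q.add_ne
    have e : q ^ (-2 : ℤ) = (q ^ 2)⁻¹ := rfl
    have e1 : q ^ (-1 : ℤ) = q⁻¹ := zpow_neg_one q
    rcases g with i | i | i | i <;> fin_cases i <;>
      simp [braid, swapFree, braidGen, swapGen, gE, gF, gK, gKinv, divPow, shiftHom,
        QRep.lift_toUqG, genVal]
    · simp [nextVec_eq generic_q, Finset.sum_range_succ, qFact_zero, qFact_one, qFact_two, e, gE]
    · simp [nextVecF_eq generic_q, Finset.sum_range_succ, qFact_zero, qFact_one, qFact_two, e, gF]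
  exact DFunLike.congr_fun this z

theorem v_zero : v 0 = toUqG (gE 0) := rfl

theorem swap_gE : swapFree (gE 0) = gE 1 := by simp [swapFree, gE, swapGen]

theorem v_one : v 1 = shiftHom (v 0) := by
  rw [v_zero, ← toUqG_braid_swap, swap_gE]; rfl

theorem v_two : v 2 = shiftHom (v 1) := by
  rw [v_one, v_zero, ← toUqG_braid_swap, ← toUqG_braid_swap]
  change toUqG (braid 0 (braid 1 (gE 0))) = _
  rw [braid_one]; rfl

theorem v_three : v 3 = shiftHom (v 2) := by
  rw [v_two, v_one, v_zero, ← toUqG_braid_swap, ← toUqG_braid_swap, ← toUqG_braid_swap, swap_gE]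
  change toUqG (braid 0 (braid 1 (braid 0 (gE 1)))) = _
  rw [braid_one]; rfl

/-- The root vector of weight `δ` in `U_q(𝔤)`. -/
def delta : UqG := deltaVec q (toUqG (gE 0)) (toUqG (gE 1))

/-- By `Xv`, the image of the twisted commutator is exactly the term that is left when `X` moves
past `nextVec`. Invariance of the imaginary root vector lets its commutators be transported along
the sequence of root vectors. -/
theorem shiftHom_delta : shiftHom delta = delta := by
  have h := qRep_uqG
  have h1 : shiftHom (toUqG (gE 0)) = nextVec q (toUqG (gE 0)) (toUqG (gE 1)) := by
    simp [shiftHom, QRep.lift_toUqG, genVal, gE]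
  have h2 : shiftHom (toUqG (gE 1)) = -(toUqG (gKinv 0) * toUqG (gF 0)) := by
    simp [shiftHom, QRep.lift_toUqG, genVal, gE]
  have h3 := h.Xv generic_q
  rw [delta, deltaVec, map_sub, map_smul, map_mul, map_mul, h1, h2, h3, add_sub_cancel_left]
  rfl

theorem v_one_eq : v 1 = nextVec q (toUqG (gE 0)) (toUqG (gE 1)) := by
  rw [v_one, v_zero]; simp [shiftHom, QRep.lift_toUqG, genVal, gE]

theorem delta_v_zero : delta * v 0 = v 0 * delta + (q + q⁻¹) • v 1 := by
  rw [v_one_eq]; exact qRep_uqG.wa generic_q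

theorem delta_v_one : delta * v 1 = v 1 * delta + (q + q⁻¹) • v 2 := by
  have := congrArg shiftHom delta_v_zero
  simpa only [map_mul, map_add, map_smul, shiftHom_delta, ← v_one, ← v_two] using this

theorem delta_v_two : delta * v 2 = v 2 * delta + (q + q⁻¹) • v 3 := by
  have := congrArg shiftHom delta_v_one
  simpa only [map_mul, map_add, map_smul, shiftHom_delta, ← v_one, ← v_two, ← v_three] using this

theorem v10 : v 1 * v 0 = q ^ 2 • (v 0 * v 1) := by
  rw [v_one_eq]; exact qRep_uqG.va generic_q

theorem v21 : v 2 * v 1 = q ^ 2 • (v 1 * v 2) := by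
  have := congrArg shiftHom v10
  simpa only [map_mul, map_smul, ← v_one, ← v_two] using this

theorem v32 : v 3 * v 2 = q ^ 2 • (v 2 * v 3) := by
  have := congrArg shiftHom v21
  simpa only [map_mul, map_smul, ← v_two, ← v_three] using this

theorem v20 : v 2 * v 0 = q ^ 2 • (v 0 * v 2) + (q ^ 2 - 1) • (v 1 * v 1) :=
  derive_adjacent generic_q delta_v_zero delta_v_one v10

theorem v31 : v 3 * v 1 = q ^ 2 • (v 1 * v 3) + (q ^ 2 - 1) • (v 2 * v 2) := by
  have := congrArg shiftHom v20
  simpa only [map_mul, map_add, map_smul, ← v_one, ← v_two, ← v_three] using this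

theorem v30 : v 3 * v 0 = q ^ 2 • (v 0 * v 3) + (q ^ 2 - (q ^ 2)⁻¹) • (v 2 * v 1) :=
  derive_next generic_q delta_v_zero delta_v_one delta_v_two v21 v20

/-! ### Straightening ordered monomials, and the filtration by the inner exponents. -/

section
variable {R A : Type*} [CommRing R] [Ring A] [Algebra R A]

/-- The straightening relations among four elements of an algebra; `s` plays the role of
`q^{-2}`. -/
structure Straight (s : R) (u : Fin 4 → A) : Prop where
  r01 : u 0 * u 1 = s • (u 1 * u 0)
  r12 : u 1 * u 2 = s • (u 2 * u 1)
  r23 : u 2 * u 3 = s • (u 3 * u 2)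
  r02 : u 0 * u 2 = s • (u 2 * u 0) + (s - 1) • (u 1 * u 1)
  r13 : u 1 * u 3 = s • (u 3 * u 1) + (s - 1) • (u 2 * u 2)
  r03 : u 0 * u 3 = s • (u 3 * u 0) + (s ^ 2 - 1) • (u 2 * u 1)

/-- Ordered monomials. -/
def mon (u : Fin 4 → A) (d c b a : ℕ) : A := u 3 ^ d * u 2 ^ c * u 1 ^ b * u 0 ^ a

variable (R) in
/-- The span of the ordered monomials with large total exponent of `u 1` and `u 2`. -/
def filt (u : Fin 4 → A) (m : ℕ) : Submodule R A :=
  Submodule.span R {x | ∃ d c b a : ℕ, m ≤ c + b ∧ x = mon u d c b a}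

theorem mon_mem (u : Fin 4 → A) {m d c b a : ℕ} (h : m ≤ c + b) : mon u d c b a ∈ filt R u m :=
  Submodule.subset_span ⟨d, c, b, a, h, rfl⟩

theorem filt_anti (u : Fin 4 → A) {m n : ℕ} (h : m ≤ n) : filt R u n ≤ filt R u m :=
  Submodule.span_mono fun _ ⟨d, c, b, a, h1, h2⟩ => ⟨d, c, b, a, h.trans h1, h2⟩

theorem mul_mem_filt (u : Fin 4 → A) {y : A} {m n : ℕ}
    (h : ∀ d c b a, m ≤ c + b → y * mon u d c b a ∈ filt R u n) {x : A} (hx : x ∈ filt R u m) :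
    y * x ∈ filt R u n := by
  induction hx using Submodule.span_induction with
  | mem x hx => obtain ⟨d, c, b, a, h1, rfl⟩ := hx; exact h d c b a h1
  | zero => simp
  | add x y _ _ hx hy => rw [mul_add]; exact add_mem hx hy
  | smul r x _ hx => rw [mul_smul_comm]; exact Submodule.smul_mem _ _ hx

theorem mul_pow_of_comm {s : R} {x y : A} (h : x * y = s • (y * x)) (n : ℕ) :
    x * y ^ n = s ^ n • (y ^ n * x) := by
  induction n with
  | zero => simp
  | succ n ih =>
    rw [pow_succ, ← mul_assoc, ih, smul_mul_assoc, mul_assoc, h, mul_smul_comm, smul_smul,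
      ← pow_succ, mul_assoc]

theorem pow_mul_pow_of_comm {s : R} {x y : A} (h : x * y = s • (y * x)) (m n : ℕ) :
    x ^ m * y ^ n = s ^ (m * n) • (y ^ n * x ^ m) := by
  induction m with
  | zero => simp
  | succ m ih =>
    rw [pow_succ, mul_assoc, mul_pow_of_comm h, mul_smul_comm, ← mul_assoc, ih, smul_mul_assoc,
      smul_smul, mul_assoc, ← pow_add]
    congr 2; ring

theorem u3_mul_mon (u : Fin 4 → A) (d c b a : ℕ) : u 3 * mon u d c b a = mon u (d + 1) c b a := by
  simp only [mon, pow_succ', mul_assoc]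

theorem u2_mul_mon_zero (u : Fin 4 → A) (c b a : ℕ) :
    u 2 * mon u 0 c b a = mon u 0 (c + 1) b a := by
  simp only [mon, pow_succ', mul_assoc, pow_zero, one_mul]

theorem u3_mul_filt (u : Fin 4 → A) {m : ℕ} {x : A} (hx : x ∈ filt R u m) :
    u 3 * x ∈ filt R u m :=
  mul_mem_filt u (fun d c b a h => by rw [u3_mul_mon]; exact mon_mem u h) hx

namespace Straight
variable {s : R} {u : Fin 4 → A} (h : Straight s u)
include h

theorem u2_mul_mon (d c b a : ℕ) : u 2 * mon u d c b a = s ^ d • mon u d (c + 1) b a := by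
  simp only [mon, ← mul_assoc, mul_pow_of_comm h.r23, smul_mul_assoc]
  simp only [mul_assoc, pow_succ']

theorem u2_mul_filt {m : ℕ} {x : A} (hx : x ∈ filt R u m) : u 2 * x ∈ filt R u (m + 1) :=
  mul_mem_filt u (fun d c b a hm => by
    rw [h.u2_mul_mon]; exact Submodule.smul_mem _ _ (mon_mem u (by omega))) hx

/-- Each correction term replaces a pair `u 1, u 3` by `u 2 ^ 2` and so has one more inner factor
than the main term. The same mechanism, with the corrections from `r02` and `r03`, is behind
`u0_mul_mon`. -/
theorem u1_mul_mon (d c b a : ℕ) :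
    u 1 * mon u d c b a - s ^ (d + c) • mon u d c (b + 1) a ∈ filt R u (c + b + 2) := by
  induction d with
  | zero =>
    have : u 1 * mon u 0 c b a = s ^ (0 + c) • mon u 0 c (b + 1) a := by
      simp only [mon, pow_zero, one_mul, ← mul_assoc, mul_pow_of_comm h.r12, smul_mul_assoc,
        zero_add]
      simp only [mul_assoc, pow_succ']
    rw [this, sub_self]; exact zero_mem _
  | succ d ih =>
    have e : u 1 * mon u (d + 1) c b a - s ^ (d + 1 + c) • mon u (d + 1) c (b + 1) a
        = s • (u 3 * (u 1 * mon u d c b a - s ^ (d + c) • mon u d c (b + 1) a))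
          + (s - 1) • (u 2 * (u 2 * mon u d c b a)) := by
      rw [← u3_mul_mon, ← mul_assoc, h.r13, mul_sub, mul_smul_comm, u3_mul_mon, smul_sub, smul_smul,
        add_mul, smul_mul_assoc, smul_mul_assoc, mul_assoc, mul_assoc, ← pow_succ']
      rw [show d + 1 + c = d + c + 1 by ring]; abel
    rw [e]
    exact add_mem (Submodule.smul_mem _ _ (u3_mul_filt u ih)) (Submodule.smul_mem _ _
      (h.u2_mul_filt (h.u2_mul_filt (mon_mem u le_rfl))))

theorem u1_mul_filt {m : ℕ} {x : A} (hx : x ∈ filt R u m) : u 1 * x ∈ filt R u (m + 1) :=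
  mul_mem_filt u (fun d c b a hm => by
    have h1 := h.u1_mul_mon d c b a
    rw [← sub_add_cancel (u 1 * mon u d c b a) (s ^ (d + c) • mon u d c (b + 1) a)]
    exact add_mem (filt_anti u (by omega) h1) (Submodule.smul_mem _ _ (mon_mem u (by omega)))) hx

theorem u0_mul_mon (d c b a : ℕ) :
    u 0 * mon u d c b a - s ^ (d + c + b) • mon u d c b (a + 1) ∈ filt R u (c + b + 1) := by
  induction d with
  | zero =>
    induction c with
    | zero =>
      have : u 0 * mon u 0 0 b a = s ^ (0 + 0 + b) • mon u 0 0 b (a + 1) := by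
        simp only [mon, pow_zero, one_mul, ← mul_assoc, mul_pow_of_comm h.r01, smul_mul_assoc,
          zero_add]
        simp only [mul_assoc, pow_succ']
      rw [this, sub_self]; exact zero_mem _
    | succ c ih =>
      have e : u 0 * mon u 0 (c + 1) b a - s ^ (0 + (c + 1) + b) • mon u 0 (c + 1) b (a + 1)
          = s • (u 2 * (u 0 * mon u 0 c b a - s ^ (0 + c + b) • mon u 0 c b (a + 1)))
            + (s - 1) • (u 1 * (u 1 * mon u 0 c b a)) := by
        rw [← u2_mul_mon_zero, ← mul_assoc, h.r02, mul_sub, mul_smul_comm, u2_mul_mon_zero,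
          smul_sub, smul_smul, add_mul, smul_mul_assoc, smul_mul_assoc, mul_assoc, mul_assoc,
          ← pow_succ']
        rw [show 0 + (c + 1) + b = 0 + c + b + 1 by ring]; abel
      rw [e]
      exact add_mem (Submodule.smul_mem _ _ (filt_anti u (by omega) (h.u2_mul_filt ih)))
        (Submodule.smul_mem _ _ (filt_anti u (by omega)
          (h.u1_mul_filt (h.u1_mul_filt (mon_mem u (m := c + b) le_rfl)))))
  | succ d ih =>
    have e : u 0 * mon u (d + 1) c b a - s ^ (d + 1 + c + b) • mon u (d + 1) c b (a + 1)
        = s • (u 3 * (u 0 * mon u d c b a - s ^ (d + c + b) • mon u d c b (a + 1)))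
          + (s ^ 2 - 1) • (u 2 * (u 1 * mon u d c b a)) := by
      rw [← u3_mul_mon, ← mul_assoc, h.r03, mul_sub, mul_smul_comm, u3_mul_mon, smul_sub, smul_smul,
        add_mul, smul_mul_assoc, smul_mul_assoc, mul_assoc, mul_assoc, ← pow_succ']
      rw [show d + 1 + c + b = d + c + b + 1 by ring]; abel
    rw [e]
    exact add_mem (Submodule.smul_mem _ _ (u3_mul_filt u ih)) (Submodule.smul_mem _ _
      (filt_anti u (by omega) (h.u2_mul_filt (h.u1_mul_filt (mon_mem u (m := c + b) le_rfl)))))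

theorem u0_mul_filt {m : ℕ} {x : A} (hx : x ∈ filt R u m) : u 0 * x ∈ filt R u m :=
  mul_mem_filt u (fun d c b a hm => by
    have h1 := h.u0_mul_mon d c b a
    rw [← sub_add_cancel (u 0 * mon u d c b a) (s ^ (d + c + b) • mon u d c b (a + 1))]
    exact add_mem (filt_anti u (by omega) h1) (Submodule.smul_mem _ _ (mon_mem u (by omega)))) hx

theorem u_mul_filt_zero (i : Fin 4) {x : A} (hx : x ∈ filt R u 0) : u i * x ∈ filt R u 0 := by
  fin_cases i
  · exact h.u0_mul_filt hx
  · exact filt_anti u (by omega) (h.u1_mul_filt hx)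
  · exact filt_anti u (by omega) (h.u2_mul_filt hx)
  · exact u3_mul_filt u hx

/-- The span of all ordered monomials is stable under left multiplication by the generators and
contains `1`. -/
theorem adjoin_le_filt : Subalgebra.toSubmodule (Algebra.adjoin R (Set.range u)) ≤ filt R u 0 := by
  intro x hx
  have key : ∀ y ∈ filt R u 0, x * y ∈ filt R u 0 := by
    change x ∈ Algebra.adjoin R (Set.range u) at hx
    induction hx using Algebra.adjoin_induction with
    | mem x hx => obtain ⟨i, rfl⟩ := hx; exact fun y hy => h.u_mul_filt_zero i hy
    | algebraMap r => intro y hy; rw [← Algebra.smul_def]; exact Submodule.smul_mem _ _ hy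
    | add x y _ _ hx hy => intro z hz; rw [add_mul]; exact add_mem (hx z hz) (hy z hz)
    | mul x y _ _ hx hy => intro z hz; rw [mul_assoc]; exact hx _ (hy z hz)
  have h1 : (1 : A) ∈ filt R u 0 := by
    have := mon_mem (R := R) u (m := 0) (d := 0) (c := 0) (b := 0) (a := 0) le_rfl
    simpa [mon] using this
  simpa using key 1 h1

/-- Monomials in the opposite order are, up to higher terms, multiples of ordered monomials. -/
theorem reverse_mon (d c b a : ℕ) :
    u 0 ^ a * (u 1 ^ b * (u 2 ^ c * u 3 ^ d))
      - s ^ (a * (b + c + d) + b * (c + d) + c * d) • mon u d c b a ∈ filt R u (c + b + 1) := by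
  have e1 : u 2 ^ c * u 3 ^ d = s ^ (c * d) • mon u d c 0 0 := by
    rw [pow_mul_pow_of_comm h.r23]; simp [mon]
  have e2 : ∀ b, u 1 ^ b * mon u d c 0 0 - s ^ (b * (c + d)) • mon u d c b 0
      ∈ filt R u (c + b + 1) := by
    intro b
    induction b with
    | zero => simp
    | succ b ih =>
      have e : u 1 ^ (b + 1) * mon u d c 0 0 - s ^ ((b + 1) * (c + d)) • mon u d c (b + 1) 0
          = u 1 * (u 1 ^ b * mon u d c 0 0 - s ^ (b * (c + d)) • mon u d c b 0)
            + s ^ (b * (c + d)) • (u 1 * mon u d c b 0 - s ^ (d + c) • mon u d c (b + 1) 0) := by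
        rw [mul_sub, smul_sub, mul_smul_comm, smul_smul, ← pow_add, pow_succ', mul_assoc,
          show b * (c + d) + (d + c) = (b + 1) * (c + d) by ring]
        abel
      rw [e]
      exact add_mem (filt_anti u (by omega) (h.u1_mul_filt ih))
        (Submodule.smul_mem _ _ (filt_anti u (by omega) (h.u1_mul_mon d c b 0)))
  have e3 : ∀ a, u 0 ^ a * mon u d c b 0 - s ^ (a * (b + c + d)) • mon u d c b a
      ∈ filt R u (c + b + 1) := by
    intro a
    induction a with
    | zero => simp
    | succ a ih =>
      have e : u 0 ^ (a + 1) * mon u d c b 0 - s ^ ((a + 1) * (b + c + d)) • mon u d c b (a + 1)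
          = u 0 * (u 0 ^ a * mon u d c b 0 - s ^ (a * (b + c + d)) • mon u d c b a)
            + s ^ (a * (b + c + d))
              • (u 0 * mon u d c b a - s ^ (d + c + b) • mon u d c b (a + 1)) := by
        rw [mul_sub, smul_sub, mul_smul_comm, smul_smul, ← pow_add, pow_succ', mul_assoc,
          show a * (b + c + d) + (d + c + b) = (a + 1) * (b + c + d) by ring]
        abel
      rw [e]
      exact add_mem (h.u0_mul_filt ih) (Submodule.smul_mem _ _ (h.u0_mul_mon d c b a))
  have e4 : ∀ {x}, x ∈ filt R u (c + b + 1) → u 0 ^ a * x ∈ filt R u (c + b + 1) := by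
    intro x hx
    induction a with
    | zero => simpa
    | succ a ih => rw [pow_succ', mul_assoc]; exact h.u0_mul_filt ih
  have e : u 0 ^ a * (u 1 ^ b * (u 2 ^ c * u 3 ^ d))
      - s ^ (a * (b + c + d) + b * (c + d) + c * d) • mon u d c b a
      = s ^ (c * d) • (u 0 ^ a * (u 1 ^ b * mon u d c 0 0 - s ^ (b * (c + d)) • mon u d c b 0))
        + s ^ (c * d) • (s ^ (b * (c + d))
          • (u 0 ^ a * mon u d c b 0 - s ^ (a * (b + c + d)) • mon u d c b a)) := by
    simp only [e1, mul_sub, smul_sub, mul_smul_comm, smul_smul, ← pow_add]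
    rw [show c * d + (b * (c + d) + a * (b + c + d)) = a * (b + c + d) + b * (c + d) + c * d by ring,
      show c * d + b * (c + d) = b * (c + d) + c * d by ring]
    abel
  rw [e]
  exact add_mem (Submodule.smul_mem _ _ (e4 (e2 b)))
    (Submodule.smul_mem _ _ (Submodule.smul_mem _ _ (e3 a)))

end Straight
end
-- Evaluation representations and their tensor products.
section
variable {k A : Type*} [Field k] [Ring A] [Algebra k A] {q : k}

/-- The defining relations of the quantized enveloping algebra of `sl_2`. -/
structure SlTwo (q : k) (e f x xi : A) : Prop where
  xxi : x * xi = 1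
  xix : xi * x = 1
  xe : x * e = q ^ 2 • (e * x)
  xf : x * f = (q ^ 2)⁻¹ • (f * x)
  ef : e * f - f * e = (q - q⁻¹)⁻¹ • (x - xi)

theorem qSerre_smul (z : k) (x y : A) : qSerre q x (z • y) = z • qSerre q x y := by
  simp only [qSerre, mul_smul_comm, smul_mul_assoc, smul_sub, smul_add, smul_comm z]

theorem qSerre_smul_left (z : k) (x y : A) : qSerre q (z • x) y = z ^ 3 • qSerre q x y := by
  simp only [qSerre, mul_smul_comm, smul_mul_assoc, smul_sub, smul_add, smul_pow, smul_smul]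
  match_scalars <;> ring

namespace SlTwo
variable {e f x xi : A} (hq : Generic q) (h : SlTwo q e f x xi)
include hq h

theorem swap : SlTwo q f e xi x where
  xxi := h.xix
  xix := h.xxi
  xe := inv_comm_rule' (pow_ne_zero 2 hq.ne_zero) h.xxi h.xix h.xf
  xf := inv_comm_rule (pow_ne_zero 2 hq.ne_zero) h.xxi h.xix h.xe
  ef := by rw [← neg_sub, h.ef, ← smul_neg, neg_sub]

theorem serre_ef : qSerre q e f = 0 := by
  have h0 := hq.ne_zero
  have h1 := hq.sub_inv_ne
  have h2 := hq.sub_ne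
  have r1 : f * e = e * f - (q - q⁻¹)⁻¹ • (x - xi) := by rw [← h.ef]; simp
  have r2 := mul_mul_of_mul r1
  have r3 := mul_mul_of_mul h.xe
  have r4 := (h.swap hq).xf
  have r5 := mul_mul_of_mul r4
  simp only [qSerre, pow_succ, pow_zero, one_mul, mul_sub, sub_mul, smul_sub, smul_add,
    smul_mul_assoc, mul_smul_comm, smul_smul, mul_assoc, r1, r2, r3, r4, r5, h.xe]
  match_scalars <;> field_simp <;> ring

/-- The evaluation representation with parameter `z`. -/
theorem eval {z : k} (hz : z ≠ 0) : QRep q e (z • f) f (z⁻¹ • e) x xi xi x where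
  xxi := h.xxi
  xix := h.xix
  yyi := h.xix
  yiy := h.xxi
  yx := by rw [h.xxi, h.xix]
  xa := h.xe
  xb := by rw [mul_smul_comm, h.xf, smul_mul_assoc, smul_comm]
  ya := (h.swap hq).xf
  yb := by rw [mul_smul_comm, (h.swap hq).xe, smul_mul_assoc, smul_comm]
  xF := h.xf
  xG := by rw [mul_smul_comm, h.xe, smul_mul_assoc, smul_comm]
  yF := (h.swap hq).xe
  yG := by rw [mul_smul_comm, (h.swap hq).xf, smul_mul_assoc, smul_comm]
  aF := h.ef
  bG := by
    rw [smul_mul_smul_comm, smul_mul_smul_comm, mul_inv_cancel₀ hz, inv_mul_cancel₀ hz, one_smul,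
      one_smul, (h.swap hq).ef]
  aG := by rw [mul_smul_comm, smul_mul_assoc]
  bF := by rw [mul_smul_comm, smul_mul_assoc]
  sab := by rw [qSerre_smul, h.serre_ef hq, smul_zero]
  sba := by rw [qSerre_smul_left, (h.swap hq).serre_ef hq, smul_zero]
  sFG := by rw [qSerre_smul, (h.swap hq).serre_ef hq, smul_zero]
  sGF := by rw [qSerre_smul_left, h.serre_ef hq, smul_zero]

end SlTwo

/-- Compatibility of the coproduct with the Serre relation: after reordering, all mixed terms cancel
and the expression is the sum of the Serre expressions of the two factors, the second one multiplied
by `x ^ 3 * y`. -/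
theorem serre_tensor (hq : Generic q) {a b x y a' b' : A} (xa : x * a = q ^ 2 • (a * x))
    (xb : x * b = (q ^ 2)⁻¹ • (b * x)) (ya : y * a = (q ^ 2)⁻¹ • (a * y))
    (yx : y * x = x * y)
    (ca : a' * a = a * a') (cb : a' * b = b * a') (cx : a' * x = x * a') (cy : a' * y = y * a')
    (da : b' * a = a * b') (dx : b' * x = x * b')
    (h : qSerre q a b = 0) (h' : qSerre q a' b' = 0) :
    qSerre q (a + x * a') (b + y * b') = 0 := by
  have h0 := hq.ne_zero
  have e : qSerre q (a + x * a') (b + y * b') - qSerre q a b - x ^ 3 * y * qSerre q a' b' = 0 := by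
    simp only [qSerre, pow_succ, pow_zero, one_mul, mul_sub, sub_mul, smul_sub, smul_add, mul_add,
      add_mul, smul_mul_assoc, mul_smul_comm, smul_smul, mul_assoc, xa, xb, ya, yx,
      mul_mul_of_mul xa, mul_mul_of_mul xb, mul_mul_of_mul ya, mul_mul_of_mul yx,
      ca, cb, cx, cy, da, dx, mul_mul_of_mul ca, mul_mul_of_mul cb, mul_mul_of_mul cx,
      mul_mul_of_mul cy, mul_mul_of_mul da, mul_mul_of_mul dx]
    match_scalars <;> field_simp <;> ring
  simpa [h, h'] using e

namespace QRep
variable {a b F G x xi y yi a' b' F' G' x' xi' y' yi' : A}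

/-- The tensor product of two solutions of the relations whose entries commute. -/
theorem tensor (hq : Generic q) (h : QRep q a b F G x xi y yi)
    (h' : QRep q a' b' F' G' x' xi' y' yi')
    (hc : ∀ s ∈ ({a, b, F, G, x, xi, y, yi} : Set A), ∀ t ∈ ({a', b', F', G', x', xi', y', yi'} : Set A),
      t * s = s * t) :
    QRep q (a + x * a') (b + y * b') (F * xi' + F') (G * yi' + G') (x * x') (xi * xi')
      (y * y') (yi * yi') := by
  have h0 := hq.ne_zero
  have hc' : ∀ s ∈ ({a, b, F, G, x, xi, y, yi} : Set A),
      ∀ t ∈ ({a', b', F', G', x', xi', y', yi'} : Set A), ∀ r, t * (s * r) = s * (t * r) :=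
    fun s hs t ht r => by rw [mul_mul_of_mul (hc s hs t ht), mul_assoc]
  simp only [Set.mem_insert_iff, Set.mem_singleton_iff, forall_eq_or_imp, forall_eq] at hc hc'
  have o := h.opp h0
  have o' := h'.opp h0
  exact {
    xxi := by simp only [mul_assoc, hc, hc', h'.xxi, mul_one, h.xxi]
    xix := by simp only [mul_assoc, hc, hc', h'.xix, mul_one, h.xix]
    yyi := by simp only [mul_assoc, hc, hc', h'.yyi, mul_one, h.yyi]
    yiy := by simp only [mul_assoc, hc, hc', h'.yiy, mul_one, h.yiy]
    yx := by simp only [mul_assoc, hc, hc', h'.yx, h.yx, mul_mul_of_mul h.yx]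
    xa := by simp only [mul_assoc, mul_add, add_mul, hc, hc', h'.xa, h.xa, mul_mul_of_mul h.xa,
      smul_add, smul_mul_assoc, mul_smul_comm]
    xb := by simp only [mul_assoc, mul_add, add_mul, hc, hc', h'.xb, h.xb, mul_mul_of_mul h.xb,
      smul_add, smul_mul_assoc, mul_smul_comm, h.yx, mul_mul_of_mul h.yx]
    ya := by simp only [mul_assoc, mul_add, add_mul, hc, hc', h'.ya, h.ya, mul_mul_of_mul h.ya,
      smul_add, smul_mul_assoc, mul_smul_comm, h.yx, mul_mul_of_mul h.yx]
    yb := by simp only [mul_assoc, mul_add, add_mul, hc, hc', h'.yb, h.yb, mul_mul_of_mul h.yb,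
      smul_add, smul_mul_assoc, mul_smul_comm, h.yx, mul_mul_of_mul h.yx]
    xF := by simp only [mul_assoc, mul_add, add_mul, hc, hc', h'.xF, h.xF, mul_mul_of_mul h.xF,
      smul_add, smul_mul_assoc, mul_smul_comm, h'.xxi, h'.xix]
    xG := by simp only [mul_assoc, mul_add, add_mul, hc, hc', h'.xG, h.xG, mul_mul_of_mul h.xG,
      smul_add, smul_mul_assoc, mul_smul_comm, h'.yix hq]
    yF := by simp only [mul_assoc, mul_add, add_mul, hc, hc', h'.yF, h.yF, mul_mul_of_mul h.yF,
      smul_add, smul_mul_assoc, mul_smul_comm, h'.xiy hq]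
    yG := by simp only [mul_assoc, mul_add, add_mul, hc, hc', h'.yG, h.yG, mul_mul_of_mul h.yG,
      smul_add, smul_mul_assoc, mul_smul_comm, h'.yyi, h'.yiy]
    aF := by
      simp only [mul_assoc, mul_add, add_mul, hc, hc', h'.Fa hq, h.Fa hq, mul_mul_of_mul (h.Fa hq),
        smul_sub, mul_sub, sub_mul, smul_mul_assoc, mul_smul_comm, h.xF, mul_mul_of_mul h.xF,
        h'.xia hq, smul_smul]
      match_scalars <;> field_simp <;> ring
    bG := by
      simp only [mul_assoc, mul_add, add_mul, hc, hc', h'.Gb hq, h.Gb hq, mul_mul_of_mul (h.Gb hq),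
        smul_sub, mul_sub, sub_mul, smul_mul_assoc, mul_smul_comm, h.yG, mul_mul_of_mul h.yG,
        h'.yib hq, smul_smul]
      match_scalars <;> field_simp <;> ring
    aG := by
      simp only [mul_assoc, mul_add, add_mul, hc, hc', h'.aG, h.aG, mul_mul_of_mul h.aG,
        smul_mul_assoc, mul_smul_comm, h.xG, mul_mul_of_mul h.xG, h'.yia hq, smul_smul]
      match_scalars <;> field_simp
    bF := by
      simp only [mul_assoc, mul_add, add_mul, hc, hc', h'.bF, h.bF, mul_mul_of_mul h.bF,
        smul_mul_assoc, mul_smul_comm, h.yF, mul_mul_of_mul h.yF, h'.xib hq, smul_smul]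
      match_scalars <;> field_simp
    sab := by
      refine serre_tensor hq h.xa h.xb h.ya h.yx ?_ ?_ ?_ ?_ ?_ ?_ h.sab h'.sab <;> simp only [hc]
    sba := by
      refine serre_tensor hq h.yb h.ya h.xb h.yx.symm ?_ ?_ ?_ ?_ ?_ ?_ h.sba h'.sba <;>
        simp only [hc]
    -- In the opposite algebra the coproduct of the lowering elements has the form of that of the
    -- raising elements with the two tensor factors exchanged, hence the order of `o'` and `o`.
    sFG := by
      have e := serre_tensor hq.inv (a' := MulOpposite.op F) (b' := MulOpposite.op G)
        o'.xa o'.xb o'.ya o'.yx ?_ ?_ ?_ ?_ ?_ ?_ o'.sab o.sab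
      all_goals simp only [← MulOpposite.op_mul, ← MulOpposite.op_add, hc] at *
      rw [qSerre_op h0, add_comm, add_comm G'] at e
      simpa using e
    sGF := by
      have e := serre_tensor hq.inv (a' := MulOpposite.op G) (b' := MulOpposite.op F)
        o'.yb o'.ya o'.xb o'.yx.symm ?_ ?_ ?_ ?_ ?_ ?_ o'.sba o.sba
      all_goals simp only [← MulOpposite.op_mul, ← MulOpposite.op_add, hc] at *
      rw [qSerre_op h0, add_comm, add_comm F'] at e
      simpa using e }

end QRep
end
-- A representation on the functions on `ℤ × ℕ`.
/-- The space of a representation of `U_q(𝔤)`. -/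
abbrev Lat : Type := ℤ → ℕ → K

/-- Weighted shifts of the first coordinate. -/
def opOne (c : ℤ → K) (d : ℤ) : Module.End K Lat where
  toFun φ m j := c m * φ (m + d) j
  map_add' φ ψ := by funext m j; simp [mul_add]
  map_smul' r φ := by funext m j; simp; ring

/-- Multiplication by a function of the second coordinate. -/
def opDiag (c : ℕ → K) : Module.End K Lat where
  toFun φ m j := c j * φ m j
  map_add' φ ψ := by funext m j; simp [mul_add]
  map_smul' r φ := by funext m j; simp; ring

/-- The raising operator of the second coordinate. -/
def opUp : Module.End K Lat where
  toFun φ m j := if j = 0 then 0 else φ m (j - 1)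
  map_add' φ ψ := by funext m j; by_cases h : j = 0 <;> simp [h]
  map_smul' r φ := by funext m j; by_cases h : j = 0 <;> simp [h]

/-- The weighted lowering operator of the second coordinate. -/
def opDown (c : ℕ → K) : Module.End K Lat where
  toFun φ m j := c j * φ m (j + 1)
  map_add' φ ψ := by funext m j; simp [mul_add]
  map_smul' r φ := by funext m j; simp; ring

/-- The coefficients of the lowering operator of the first factor. -/
def lowOne (m : ℤ) : K :=
  -((q - q⁻¹)⁻¹ ^ 2 * (q ^ (2 * m) * q + (q ^ (2 * m))⁻¹ * q⁻¹))

/-- The coefficients of the lowering operator of the second factor. -/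
def lowTwo (j : ℕ) : K :=
  (q - q⁻¹)⁻¹ ^ 2 * (q + q⁻¹ - (q ^ (2 * j) * q + (q ^ (2 * j))⁻¹ * q⁻¹))

theorem q_zpow_ne (m : ℤ) : q ^ m ≠ 0 := zpow_ne_zero m q_ne_zero

theorem zpow_two_succ (m : ℤ) : q ^ (2 * (m + 1)) = q ^ (2 * m) * q ^ 2 := by
  rw [mul_add, mul_one, zpow_add₀ q_ne_zero]; rfl

theorem zpow_two_pred (m : ℤ) : q ^ (2 * (m - 1)) = q ^ (2 * m) * (q ^ 2)⁻¹ := by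
  rw [mul_sub, mul_one, zpow_sub₀ q_ne_zero, div_eq_mul_inv]; rfl

/-- All weights `q ^ (2 m)` with `m ∈ ℤ` occur and the raising operator is invertible. The
commutator of `e` and `f` determines `lowOne` up to an additive constant, which is taken to be zero.
-/
theorem slTwo_one : SlTwo q (opOne (fun _ => 1) (-1)) (opOne lowOne 1)
    (opOne (fun m => q ^ (2 * m)) 0) (opOne (fun m => (q ^ (2 * m))⁻¹) 0) where
  xxi := by
    ext φ m j
    have := q_zpow_ne (2 * m)
    simp [opOne, this]
  xix := by
    ext φ m j
    have := q_zpow_ne (2 * m)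
    simp [opOne, this]
  xe := by
    ext φ m j
    have h0 := q_ne_zero
    simp [opOne, ← sub_eq_add_neg, zpow_two_pred]
    field_simp
  xf := by
    ext φ m j
    have h0 := q_ne_zero
    simp [opOne, zpow_two_succ]
    field_simp
  ef := by
    ext φ m j
    have h0 := q_ne_zero
    have h1 := generic_q.sub_inv_ne
    have h2 := generic_q.sub_ne
    have h3 := q_zpow_ne (2 * m)
    simp [opOne, lowOne, ← sub_eq_add_neg, zpow_two_pred]
    field_simp
    ring

/-- Here the additive constant of the lowering coefficient is forced: the relation at the boundary
`j = 0` requires `lowTwo 0 = 0`. -/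
theorem slTwo_two : SlTwo q opUp (opDown lowTwo)
    (opDiag (fun j => q ^ (2 * j))) (opDiag (fun j => (q ^ (2 * j))⁻¹)) where
  xxi := by
    ext φ m j
    have := pow_ne_zero (2 * j) q_ne_zero
    simp [opDiag, this]
  xix := by
    ext φ m j
    have := pow_ne_zero (2 * j) q_ne_zero
    simp [opDiag, this]
  xe := by
    ext φ m j
    have h0 := q_ne_zero
    rcases j with _ | j
    · simp [opDiag, opUp]
    · simp [opDiag, opUp, mul_add, pow_add]
      ring
  xf := by
    ext φ m j
    have h0 := q_ne_zero
    simp [opDiag, opDown, mul_add, pow_add]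
    field_simp
  ef := by
    ext φ m j
    have h0 := q_ne_zero
    have h1 := generic_q.sub_inv_ne
    have h2 := generic_q.sub_ne
    rcases j with _ | j
    · simp [opDiag, opUp, opDown, lowTwo]
    · simp [opDiag, opUp, opDown, lowTwo, mul_add, pow_add]
      field_simp
      ring

theorem qRep_lat : ∃ F' G' x xi y yi : Module.End K Lat,
    QRep q (opOne (fun _ => 1) (-1) + opOne (fun m => q ^ (2 * m)) 0 * opUp)
      (opOne lowOne 1 + opOne (fun m => (q ^ (2 * m))⁻¹) 0 * opDown lowTwo)
      F' G' x xi y yi := by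
  have h1 := slTwo_one.eval generic_q (z := (1 : K)) one_ne_zero
  have h2 := slTwo_two.eval generic_q (z := (1 : K)) one_ne_zero
  have h := h1.tensor generic_q h2 ?_
  · rw [one_smul, one_smul] at h
    exact ⟨_, _, _, _, _, _, h⟩
  · simp only [Set.mem_insert_iff, Set.mem_singleton_iff, forall_eq_or_imp, forall_eq, one_smul,
      inv_one]
    refine ⟨?_, ?_, ?_, ?_, ?_, ?_, ?_, ?_⟩ <;> refine ⟨?_, ?_, ?_, ?_, ?_, ?_, ?_, ?_⟩ <;>
      (ext φ m j; rcases j with _ | j <;> simp [opOne, opUp, opDown, opDiag] <;> ring)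

/-- The operator of the first generator. -/
def latA : Module.End K Lat := opOne (fun _ => 1) (-1) + opOne (fun m => q ^ (2 * m)) 0 * opUp

/-- The operator of the second generator. -/
def latB : Module.End K Lat :=
  opOne lowOne 1 + opOne (fun m => (q ^ (2 * m))⁻¹) 0 * opDown lowTwo

theorem exists_rep : ∃ ρ : UqG →ₐ[K] Module.End K Lat,
    ρ (v 0) = latA ∧ ρ delta = deltaVec q latA latB := by
  obtain ⟨F, G, x, xi, y, yi, h⟩ := qRep_lat
  have h0 : h.lift (toUqG (gE 0)) = latA := by simp [h.lift_toUqG, gE, genVal, latA]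
  have h1 : h.lift (toUqG (gE 1)) = latB := by simp [h.lift_toUqG, gE, genVal, latB]
  refine ⟨h.lift, h0, ?_⟩
  simp only [delta, deltaVec, map_sub, map_mul, map_smul, h0, h1]

/-- The functions that vanish at the points with small second coordinate. -/
def lowVanish (J : ℕ) (φ : Lat) : Prop := ∀ m j, j < J → φ m j = 0

/-- The operator `T` acts on the two lowest layers of a function by the coefficients `α`, `β`. -/
def HasSymbol (T : Module.End K Lat) (α : ℤ → K) (β : ℤ → ℕ → K) : Prop :=
  ∀ J φ, lowVanish J φ → lowVanish J (T φ) ∧ (∀ m, T φ m J = α m * φ (m - 1) J) ∧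
    ∀ m, T φ m (J + 1) = α m * φ (m - 1) (J + 1) + β m J * φ m J

theorem hasSymbol_latA : HasSymbol latA (fun _ => 1) (fun m _ => q ^ (2 * m)) := by
  intro J φ h
  refine ⟨fun m j hj => ?_, fun m => ?_, fun m => ?_⟩
  · rcases j with _ | j
    · simp [latA, opOne, opUp, h _ _ hj]
    · simp [latA, opOne, opUp, h _ _ hj, h _ j (by omega)]
  · rcases J with _ | J
    · simp [latA, opOne, opUp, sub_eq_add_neg]
    · simp [latA, opOne, opUp, h _ J (by omega), sub_eq_add_neg]
  · simp [latA, opOne, opUp, sub_eq_add_neg]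

/-- The constant that enters the action of the root vector of weight `δ`. -/
def latConst : K := (1 - (q ^ 2)⁻¹) * ((q - q⁻¹)⁻¹ ^ 2 * (q + q⁻¹))

/-- The diagonal part of the action of the root vector of weight `δ`. -/
def latDiag (m : ℤ) (j : ℕ) : K :=
  latConst - (1 + (q ^ 2)⁻¹) * (q - q⁻¹)⁻¹ * (q ^ (2 * m) + q ^ (2 * j))

/-- The other part of the action of the root vector of weight `δ`. -/
def latOff (m : ℤ) : K := (1 - (q ^ 4)⁻¹) * lowOne m * (q ^ (2 * m) * q ^ 2)

/-- The contributions that lower the second coordinate cancel between the two products in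
`deltaVec`. The operator is therefore triangular in the layers, although `latB` is not. -/
theorem delta_lat (φ : Lat) (m : ℤ) (j : ℕ) : deltaVec q latA latB φ m j
    = latDiag m j * φ m j + latOff m * (if j = 0 then 0 else φ (m + 1) (j - 1)) := by
  have h0 := q_ne_zero
  have h1 := generic_q.sub_inv_ne
  have h2 := generic_q.sub_ne
  have h3 := q_zpow_ne (2 * m)
  rcases j with _ | j
  · simp [deltaVec, latA, latB, opOne, opUp, opDown, latDiag, latOff, ← sub_eq_add_neg,
      zpow_two_pred, zpow_two_succ, latConst, lowOne, lowTwo]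
    field_simp
    ring
  · have e : ∀ j : ℕ, q ^ (2 * (j + 1)) = q ^ (2 * j) * q ^ 2 := fun j => by ring
    simp [deltaVec, latA, latB, opOne, opUp, opDown, latDiag, latOff, ← sub_eq_add_neg,
      zpow_two_pred, zpow_two_succ, latConst, lowOne, lowTwo, e]
    field_simp
    ring

/-- Because the operator of `delta` never looks at higher layers, its commutator with `T` acts on
the two lowest layers through its own two diagonals and the coefficients of `T`. Iterating from the
first root vector gives the symbols of all four. -/
theorem HasSymbol.step {T T' : Module.End K Lat} {α : ℤ → K} {β : ℤ → ℕ → K}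
    (h : HasSymbol T α β)
    (hT : deltaVec q latA latB * T = T * deltaVec q latA latB + (q + q⁻¹) • T') :
    HasSymbol T' (fun m => (q + q⁻¹)⁻¹ * (α m * (latDiag m 0 - latDiag (m - 1) 0)))
      (fun m J => (q + q⁻¹)⁻¹ * (β m J * (latDiag m (J + 1) - latDiag m J)
        + latOff m * α (m + 1) - latOff (m - 1) * α m)) := by
  intro J φ hφ
  have hT' : T' = (q + q⁻¹)⁻¹ • (deltaVec q latA latB * T - T * deltaVec q latA latB) := by
    rw [hT, add_sub_cancel_left, smul_smul, inv_mul_cancel₀ generic_q.add_inv_ne, one_smul]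
  have e : ∀ m j, T' φ m j = (q + q⁻¹)⁻¹
      * (deltaVec q latA latB (T φ) m j - T (deltaVec q latA latB φ) m j) := by
    intro m j; rw [hT']; rfl
  obtain ⟨h1, h2, h3⟩ := h J φ hφ
  have hδ : ∀ ψ, lowVanish J ψ → lowVanish J (deltaVec q latA latB ψ) := by
    intro ψ hψ m j hj
    rw [delta_lat, hψ m j hj, hψ (m + 1) (j - 1) (by omega)]; simp
  have lo : ∀ ψ, lowVanish J ψ → ∀ m, deltaVec q latA latB ψ m J = latDiag m J * ψ m J := by
    intro ψ hψ m
    rw [delta_lat]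
    rcases J with _ | J
    · simp
    · simp [hψ (m + 1) J (by omega)]
  obtain ⟨g1, g2, g3⟩ := h J _ (hδ φ hφ)
  have d : ∀ m j, latDiag m j - latDiag (m - 1) j = latDiag m 0 - latDiag (m - 1) 0 := by
    intro m j; simp [latDiag]; ring
  refine ⟨fun m j hj => ?_, fun m => ?_, fun m => ?_⟩
  · rw [e, hδ _ h1 m j hj, g1 m j hj]; simp
  · rw [e, lo _ h1, g2, lo _ hφ, h2]
    linear_combination ((q + q⁻¹)⁻¹ * α m * φ (m - 1) J) * d m J
  · rw [e, delta_lat, g3, delta_lat, lo _ hφ, h3, if_neg (Nat.succ_ne_zero J), Nat.add_sub_cancel,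
      if_neg (Nat.succ_ne_zero J), h2, sub_add_cancel, add_sub_cancel_right]
    linear_combination ((q + q⁻¹)⁻¹ * α m * φ (m - 1) (J + 1)) * d m (J + 1)

theorem latDiag_sub_left (m : ℤ) :
    latDiag m 0 - latDiag (m - 1) 0 = (q + q⁻¹) * -(q ^ (2 * m) * (q ^ 2)⁻¹) := by
  have h0 := q_ne_zero
  have h1 := generic_q.sub_inv_ne
  have h2 := generic_q.sub_ne
  simp only [latDiag, zpow_two_pred]
  field_simp
  ring

theorem latDiag_sub_right (m : ℤ) (J : ℕ) :
    latDiag m (J + 1) - latDiag m J = (q + q⁻¹) * -(q ^ (2 * J)) := by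
  have h0 := q_ne_zero
  have h1 := generic_q.sub_inv_ne
  have h2 := generic_q.sub_ne
  have e : q ^ (2 * (J + 1)) = q ^ (2 * J) * q ^ 2 := by ring
  simp only [latDiag, e]
  field_simp
  ring

theorem latOff_eq (m : ℤ) : latOff m
    = (q + q⁻¹) * -((q - q⁻¹)⁻¹ * (q ^ 2)⁻¹ * q * ((q ^ (2 * m)) ^ 2 * q ^ 2 + 1)) := by
  have h0 := q_ne_zero
  have h1 := generic_q.sub_inv_ne
  have h2 := generic_q.sub_ne
  have h3 := q_zpow_ne (2 * m)
  simp only [latOff, lowOne]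
  field_simp
  ring

theorem HasSymbol.congr {T : Module.End K Lat} {α α' : ℤ → K} {β β' : ℤ → ℕ → K}
    (h : HasSymbol T α β) (h1 : ∀ m, α m = α' m) (h2 : ∀ m J, β m J = β' m J) :
    HasSymbol T α' β' := by
  rwa [← funext h1, ← funext fun m => funext (h2 m)]

theorem HasSymbol.step' {T T' : Module.End K Lat} {α : ℤ → K} {β : ℤ → ℕ → K}
    (h : HasSymbol T α β)
    (hT : deltaVec q latA latB * T = T * deltaVec q latA latB + (q + q⁻¹) • T') :
    HasSymbol T' (fun m => -(α m * (q ^ (2 * m) * (q ^ 2)⁻¹)))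
      (fun m J => -(β m J * q ^ (2 * J)
        + (q - q⁻¹)⁻¹ * (q ^ 2)⁻¹ * q * (((q ^ (2 * m)) ^ 2 * q ^ 2 + 1) * α (m + 1)
          - ((q ^ (2 * m)) ^ 2 * (q ^ 2)⁻¹ + 1) * α m))) := by
  have h0 := q_ne_zero
  have h1 := generic_q.add_inv_ne
  refine (h.step hT).congr (fun m => ?_) fun m J => ?_
  · rw [latDiag_sub_left, mul_left_comm, inv_mul_cancel_left₀ h1]; ring
  · rw [latDiag_sub_right, latOff_eq, latOff_eq, zpow_two_pred, mul_left_comm, mul_assoc (q + q⁻¹),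
      mul_assoc (q + q⁻¹), ← mul_add, ← mul_sub, inv_mul_cancel_left₀ h1]
    field_simp
    ring

/-- The operators of the root vectors. -/
theorem symbols {ρ : UqG →ₐ[K] Module.End K Lat} (h0 : ρ (v 0) = latA)
    (hd : ρ delta = deltaVec q latA latB) :
    HasSymbol (ρ (v 0)) (fun _ => 1) (fun m _ => q ^ (2 * m)) ∧
    HasSymbol (ρ (v 1)) (fun m => -(q ^ (2 * m) * (q ^ 2)⁻¹)) (fun m J =>
      -(q ^ (2 * m) * q ^ (2 * J) + (1 + (q ^ 2)⁻¹) * (q ^ (2 * m)) ^ 2)) ∧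
    HasSymbol (ρ (v 2)) (fun m => (q ^ (2 * m) * (q ^ 2)⁻¹) ^ 2) (fun m J =>
      q ^ (2 * m) * (q ^ (2 * J)) ^ 2 + (1 + (q ^ 2)⁻¹) * (q ^ (2 * m)) ^ 2 * q ^ (2 * J)
        + (1 + (q ^ 2)⁻¹ + (q ^ 4)⁻¹) * (q ^ (2 * m)) ^ 3 + (q ^ 2)⁻¹ * q ^ (2 * m)) ∧
    HasSymbol (ρ (v 3)) (fun m => -(q ^ (2 * m) * (q ^ 2)⁻¹) ^ 3) (fun m J =>
      -(q ^ (2 * m) * (q ^ (2 * J)) ^ 3 + (1 + (q ^ 2)⁻¹) * (q ^ (2 * m)) ^ 2 * (q ^ (2 * J)) ^ 2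
        + (1 + (q ^ 2)⁻¹ + (q ^ 4)⁻¹) * (q ^ (2 * m)) ^ 3 * q ^ (2 * J)
        + (q ^ 2)⁻¹ * q ^ (2 * m) * q ^ (2 * J)
        + (1 + (q ^ 2)⁻¹ + (q ^ 4)⁻¹ + (q ^ 6)⁻¹) * (q ^ (2 * m)) ^ 4
        + ((q ^ 2)⁻¹ + (q ^ 4)⁻¹) * (q ^ (2 * m)) ^ 2)) := by
  have q0 := q_ne_zero
  have q1 := generic_q.sub_inv_ne
  have q2 := generic_q.sub_ne
  have e0 := congrArg ρ delta_v_zero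
  have e1 := congrArg ρ delta_v_one
  have e2 := congrArg ρ delta_v_two
  simp only [map_mul, map_add, map_smul, hd] at e0 e1 e2
  have s0 : HasSymbol (ρ (v 0)) (fun _ => 1) (fun m _ => q ^ (2 * m)) := by
    rw [h0]; exact hasSymbol_latA
  have s1 : HasSymbol (ρ (v 1)) (fun m => -(q ^ (2 * m) * (q ^ 2)⁻¹)) (fun m J =>
      -(q ^ (2 * m) * q ^ (2 * J) + (1 + (q ^ 2)⁻¹) * (q ^ (2 * m)) ^ 2)) := by
    refine (s0.step' e0).congr (fun m => by ring) fun m J => ?_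
    field_simp
    ring
  have s2 : HasSymbol (ρ (v 2)) (fun m => (q ^ (2 * m) * (q ^ 2)⁻¹) ^ 2) (fun m J =>
      q ^ (2 * m) * (q ^ (2 * J)) ^ 2 + (1 + (q ^ 2)⁻¹) * (q ^ (2 * m)) ^ 2 * q ^ (2 * J)
        + (1 + (q ^ 2)⁻¹ + (q ^ 4)⁻¹) * (q ^ (2 * m)) ^ 3 + (q ^ 2)⁻¹ * q ^ (2 * m)) := by
    refine (s1.step' e1).congr (fun m => by ring) fun m J => ?_
    simp only [zpow_two_succ]
    field_simp
    ring
  refine ⟨s0, s1, s2, (s2.step' e2).congr (fun m => by ring) fun m J => ?_⟩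
  simp only [zpow_two_succ]
  field_simp
  ring

/-- The operator `T` raises the lowest layer of a function by `s`, with coefficients that do not
vanish. -/
def Leads (T : Module.End K Lat) (s : ℕ) : Prop :=
  ∃ (d : ℤ) (c : ℤ → ℕ → K), (∀ m J, c m J ≠ 0) ∧
    ∀ J φ, lowVanish J φ → lowVanish (J + s) (T φ) ∧ ∀ m, T φ m (J + s) = c m J * φ (m - d) J

theorem Leads.mul {T T' : Module.End K Lat} {s s' : ℕ} (h : Leads T s) (h' : Leads T' s') :
    Leads (T * T') (s' + s) := by
  obtain ⟨d, c, hc, h⟩ := h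
  obtain ⟨d', c', hc', h'⟩ := h'
  refine ⟨d + d', fun m J => c m (J + s') * c' (m - d) J,
    fun m J => mul_ne_zero (hc _ _) (hc' _ _), fun J φ hφ => ?_⟩
  obtain ⟨h1, h2⟩ := h' J φ hφ
  obtain ⟨h3, h4⟩ := h _ _ h1
  rw [← add_assoc]
  refine ⟨h3, fun m => ?_⟩
  rw [Module.End.mul_apply, h4, h2, sub_sub, mul_assoc]

theorem Leads.one : Leads 1 0 :=
  ⟨0, fun _ _ => 1, fun _ _ => one_ne_zero, fun J φ hφ => ⟨hφ, fun m => by simp⟩⟩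

theorem Leads.pow {T : Module.End K Lat} {s : ℕ} (h : Leads T s) (n : ℕ) :
    ∃ s', Leads (T ^ n) s' := by
  induction n with
  | zero => exact ⟨0, Leads.one⟩
  | succ n ih => obtain ⟨s', h'⟩ := ih; exact ⟨_, pow_succ T n ▸ h'.mul h⟩

/-- If all layers below `J` of an element of the kernel vanish, the nonzero coefficients force layer
`J` to vanish as well. -/
theorem Leads.injective {T : Module.End K Lat} {s : ℕ} (h : Leads T s) :
    Function.Injective T := by
  obtain ⟨d, c, hc, h⟩ := h
  rw [injective_iff_map_eq_zero]
  intro φ hφ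
  have key : ∀ J, lowVanish J φ := by
    intro J
    induction J with
    | zero => exact fun m j hj => absurd hj (Nat.not_lt_zero j)
    | succ J ih =>
      intro m j hj
      rcases Nat.lt_succ_iff_lt_or_eq.mp hj with hj | rfl
      · exact ih m j hj
      · have := (h _ _ ih).2 (m + d)
        rw [hφ, add_sub_cancel_right] at this
        exact (mul_eq_zero.mp this.symm).resolve_left (hc _ _)
  funext m j
  exact key (j + 1) m j (Nat.lt_succ_self j)

theorem Leads.of_symbol {T : Module.End K Lat} {α : ℤ → K} {β : ℤ → ℕ → K}
    (h : HasSymbol T α β) (hα : ∀ m, α m ≠ 0) : Leads T 0 :=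
  ⟨1, fun m _ => α m, fun m _ => hα m, fun J φ hφ => ⟨(h J φ hφ).1, (h J φ hφ).2.1⟩⟩

/-- By `h0` the two products cancel on the lowest layer, as they would without the second tensor
factor. The next layer is the first that detects the quasi-commuting element, with the coefficient
in `h1`. -/
theorem Leads.of_symbols {S T U : Module.End K Lat} {α α' α'' : ℤ → K} {β β' β'' : ℤ → ℕ → K}
    (hS : HasSymbol S α β) (hT : HasSymbol T α' β') (hU : HasSymbol U α'' β'')
    (h0 : ∀ m, α m * α'' (m - 1) = q ^ 2 * (α' m * α' (m - 1)))
    (h1 : ∀ m J, α m * β'' (m - 1) J + β m J * α'' m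
      - q ^ 2 * (α' m * β' (m - 1) J + β' m J * α' m) ≠ 0) :
    Leads (S * U - q ^ 2 • (T * T)) 1 := by
  refine ⟨1, _, h1, fun J φ hφ => ?_⟩
  obtain ⟨u1, u2, u3⟩ := hU J φ hφ
  obtain ⟨t1, t2, t3⟩ := hT J φ hφ
  obtain ⟨s1, s2, s3⟩ := hS J _ u1
  obtain ⟨r1, r2, r3⟩ := hT J _ t1
  have e : ∀ m j, (S * U - q ^ 2 • (T * T)) φ m j = S (U φ) m j - q ^ 2 * T (T φ) m j :=
    fun m j => rfl
  refine ⟨fun m j hj => ?_, fun m => ?_⟩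
  · rcases Nat.lt_succ_iff_lt_or_eq.mp hj with hj | rfl
    · rw [e, s1 m j hj, r1 m j hj]; simp
    · rw [e, s2, u2, r2, t2]
      linear_combination φ (m - 1 - 1) j * h0 m
  · rw [e, s3, u3, u2, r3, t3, t2]
    linear_combination φ (m - 1 - 1) (J + 1) * h0 m

theorem q_pow_add_one_ne (n : ℕ) : q ^ (n + 1) + 1 ≠ 0 := fun h =>
  q_pow_ne_one (n := 2 * (n + 1)) (by omega) (by linear_combination (q ^ (n + 1) - 1) * h)

/-- A representation in which the quasi-commuting elements act injectively. -/
theorem exists_leads : ∃ ρ : UqG →ₐ[K] Module.End K Lat,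
    Leads (ρ (v 1)) 0 ∧ Leads (ρ (v 2)) 0 ∧ Leads (ρ (v 2 * v 0 - q ^ 2 • (v 1 * v 1))) 1 ∧
      Leads (ρ (v 3 * v 1 - q ^ 2 • (v 2 * v 2))) 1 := by
  obtain ⟨ρ, h0, hd⟩ := exists_rep
  obtain ⟨s0, s1, s2, s3⟩ := symbols h0 hd
  have q0 := q_ne_zero
  have hz : ∀ m : ℤ, q ^ (2 * m) ≠ 0 := fun m => q_zpow_ne _
  -- For both quasi-commuting elements the coefficient on the next layer is a unit times this
  -- factor; its vanishing would make `q` a root of unity.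
  have hY : ∀ J : ℕ, (q ^ (2 * J)) ^ 2 + (q ^ 2)⁻¹ ≠ 0 := fun J => by
    have := mul_ne_zero (q_pow_add_one_ne (4 * J + 1)) (inv_ne_zero (pow_ne_zero 2 q0))
    convert this using 1
    rw [show q ^ (4 * J + 1 + 1) = (q ^ (2 * J)) ^ 2 * q ^ 2 by ring]
    field_simp
  refine ⟨ρ, .of_symbol s1 fun m => ?_, .of_symbol s2 fun m => ?_, ?_, ?_⟩
  · exact neg_ne_zero.mpr (mul_ne_zero (hz m) (inv_ne_zero (pow_ne_zero 2 q0)))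
  · exact pow_ne_zero 2 (mul_ne_zero (hz m) (inv_ne_zero (pow_ne_zero 2 q0)))
  · rw [map_sub, map_smul, map_mul, map_mul]
    refine .of_symbols s2 s1 s0 (fun m => ?_) fun m J => ?_
    · simp only [zpow_two_pred]; field_simp
    · have := mul_ne_zero (hz m) (hY J)
      convert this using 1
      simp only [zpow_two_pred]; field_simp; ring
  · rw [map_sub, map_smul, map_mul, map_mul]
    refine .of_symbols s3 s2 s1 (fun m => ?_) fun m J => ?_
    · simp only [zpow_two_pred]; field_simp
    · have := mul_ne_zero (mul_ne_zero (mul_ne_zero (pow_ne_zero 2 (hz m))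
        (pow_ne_zero (2 * J) q0)) (hY J)) (inv_ne_zero (pow_ne_zero 2 q0))
      convert this using 1
      simp only [zpow_two_pred]; field_simp; ring

/-! ### Two criteria for linear independence. -/

section
variable {k V : Type*} [Field k] [AddCommGroup V] [Module k V]

/-- Vectors that are separated by the ratios of two linear maps are linearly independent. -/
theorem linearIndependent_of_separated {ι : Type*} (N : ι → V) (hN : ∀ i, N i ≠ 0)
    (sep : ∀ i j, i ≠ j → ∃ (f g : V →ₗ[k] V) (μ : ι → k), Function.Injective f ∧
      (∀ a, g (N a) = μ a • f (N a)) ∧ μ i ≠ μ j) : LinearIndependent k N := by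
  classical
  rw [linearIndependent_iff']
  intro s
  induction s using Finset.strongInduction with
  | H s ih =>
    intro c hc i hi
    by_contra hci
    obtain ⟨j, hj, hji, hcj⟩ : ∃ j ∈ s, j ≠ i ∧ c j ≠ 0 := by
      by_contra hne
      push Not at hne
      rw [Finset.sum_eq_single_of_mem i hi fun j hj hji => by rw [hne j hj hji, zero_smul]] at hc
      exact (smul_eq_zero.mp hc).elim hci (hN i)
    obtain ⟨f, g, μ, hf, hg, hμ⟩ := sep i j hji.symm
    -- As with eigenvectors: subtracting `μ j` times the image under `f` from the image under `g`
    -- removes the term of index `j`, and injectivity of `f` turns the result into a shorter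
    -- relation.
    have h1 : ∑ a ∈ s, (c a * (μ a - μ j)) • N a = 0 := by
      apply hf
      have hgc := congrArg g hc
      have hfc := congrArg (fun t => μ j • f t) hc
      simp only [map_sum, map_smul, map_zero, hg, Finset.smul_sum, smul_zero] at hgc hfc ⊢
      refine Eq.trans ?_ (sub_eq_zero.mpr (hgc.trans hfc.symm))
      rw [← Finset.sum_sub_distrib]
      refine Finset.sum_congr rfl fun a _ => ?_
      simp only [smul_smul, ← sub_smul]
      congr 1; ring
    rw [← Finset.add_sum_erase s _ hj, sub_self, mul_zero, zero_smul, zero_add] at h1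
    have h2 := ih _ (Finset.erase_ssubset hj) _ h1 i (Finset.mem_erase.mpr ⟨hji.symm, hi⟩)
    exact (mul_eq_zero.mp h2).elim hci (sub_ne_zero.mpr hμ)

/-- A family that is triangular with respect to a linearly independent one. -/
theorem linearIndependent_of_triangular {ι κ : Type*} {M : κ → V} (hM : LinearIndependent k M)
    (deg : κ → ℕ) (x : ι → V)
    (h : ∀ s : Finset ι, ∃ (T : V →ₗ[k] V) (τ : ι → κ) (c : ι → k), Set.InjOn τ s ∧
      ∀ i ∈ s, c i ≠ 0 ∧
        T (x i) - c i • M (τ i) ∈ Submodule.span k (M '' {l | deg l < deg (τ i)})) :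
    LinearIndependent k x := by
  classical
  rw [linearIndependent_iff']
  intro s a ha
  obtain ⟨T, τ, c, hτ, hT⟩ := h s
  by_contra hne
  push Not at hne
  have hs : (s.filter fun i => a i ≠ 0).Nonempty := by
    obtain ⟨i, hi, hai⟩ := hne
    exact ⟨i, Finset.mem_filter.mpr ⟨hi, hai⟩⟩
  -- Among the terms with nonzero coefficient one of top degree is taken; its leading vector `M (τ
  -- i₀)` cannot occur in the lower parts, and injectivity of `τ` keeps it out of the other leading
  -- terms.
  obtain ⟨i₀, hi₀, hmax⟩ := Finset.exists_max_image _ (fun i => deg (τ i)) hs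
  obtain ⟨hi₀s, hai₀⟩ := Finset.mem_filter.mp hi₀
  obtain ⟨g, hg⟩ := LinearMap.exists_leftInverse_of_injective (Finsupp.linearCombination k M)
    (LinearMap.ker_eq_bot.mpr hM)
  have hgM : ∀ l, g (M l) = Finsupp.single l 1 := fun l => by
    have := LinearMap.congr_fun hg (Finsupp.single l 1)
    simpa using this
  have hlow : ∀ D, D ≤ deg (τ i₀) → ∀ y ∈ Submodule.span k (M '' {l | deg l < D}),
      g y (τ i₀) = 0 := by
    intro D hD y hy
    induction hy using Submodule.span_induction with
    | mem y hy =>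
      obtain ⟨l, hl, rfl⟩ := hy
      rw [hgM, Finsupp.single_apply, if_neg]
      rintro rfl
      exact absurd (show deg (τ i₀) < D from hl) (not_lt.mpr hD)
    | zero => simp
    | add y z _ _ hy hz => simp [hy, hz]
    | smul r y _ hy => simp [hy]
  have key : ∀ i ∈ s, a i * g (T (x i)) (τ i₀) = if i = i₀ then a i₀ * c i₀ else 0 := by
    intro i hi
    by_cases hai : a i = 0
    · rw [hai, zero_mul, if_neg]
      rintro rfl
      exact hai₀ hai
    · have h1 := hlow _ (hmax i (Finset.mem_filter.mpr ⟨hi, hai⟩)) _ (hT i hi).2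
      rw [map_sub, map_smul, hgM, Finsupp.sub_apply, sub_eq_zero] at h1
      rw [h1, Finsupp.smul_apply, Finsupp.single_apply]
      by_cases hii : i = i₀
      · subst hii; simp
      · rw [if_neg hii, if_neg fun h => hii (hτ hi hi₀s h)]; simp
  have h0 := congrArg (fun t => g (T t) (τ i₀)) ha
  simp only [map_sum, map_smul, map_zero, Finsupp.coe_zero, Pi.zero_apply, Finsupp.finsetSum_apply,
    Finsupp.smul_apply, smul_eq_mul] at h0
  rw [Finset.sum_congr rfl key, Finset.sum_ite_eq' s i₀, if_pos hi₀s] at h0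
  exact (mul_eq_zero.mp h0).elim hai₀ (hT i₀ hi₀s).1
end

/-! ### The quasi-commuting elements, and ordered monomials expressed through them. -/

section
variable {k A : Type*} [Field k] [Ring A] [Algebra k A] {q : k} {u : Fin 4 → A}

/-- The quasi-commuting element attached to three consecutive generators. -/
def pElt (q : k) (u : Fin 4 → A) (i j l : Fin 4) : A := u i * u l - q ^ 2 • (u j * u j)

/-- The monomials in the quasi-commuting elements. -/
def qMon (q : k) (u : Fin 4 → A) (e : ℕ × ℕ × ℕ × ℕ) : A :=
  pElt q u 3 2 1 ^ e.1 * u 2 ^ e.2.1 * u 1 ^ e.2.2.1 * pElt q u 2 1 0 ^ e.2.2.2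

namespace Straight
variable (hq : q ≠ 0) (h : Straight (q ^ 2)⁻¹ u)
include hq h

theorem p0_u0 : pElt q u 2 1 0 * u 0 = q ^ 2 • (u 0 * pElt q u 2 1 0) := by
  simp only [pElt, mul_sub, sub_mul, mul_smul_comm, smul_mul_assoc, mul_assoc, mul_mul_of_mul h.r01,
    h.r01, h.r02, mul_mul_of_mul h.r02, mul_add, add_mul, smul_add, smul_sub, smul_smul]
  match_scalars <;> field_simp <;> ring

theorem p0_u1 : pElt q u 2 1 0 * u 1 = u 1 * pElt q u 2 1 0 := by
  simp only [pElt, mul_sub, sub_mul, mul_smul_comm, smul_mul_assoc, mul_assoc, mul_mul_of_mul h.r01,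
    h.r01, h.r12, mul_mul_of_mul h.r12, mul_add, add_mul, smul_add, smul_sub, smul_smul]

theorem p0_u2 : pElt q u 2 1 0 * u 2 = (q ^ 2)⁻¹ • (u 2 * pElt q u 2 1 0) := by
  simp only [pElt, mul_sub, sub_mul, mul_smul_comm, smul_mul_assoc, mul_assoc, mul_mul_of_mul h.r01,
    h.r12, h.r02, mul_mul_of_mul h.r12, mul_add, add_mul, smul_add, smul_sub, smul_smul]
  match_scalars <;> field_simp <;> ring

theorem p0_u3 : pElt q u 2 1 0 * u 3 = (q ^ 4)⁻¹ • (u 3 * pElt q u 2 1 0) := by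
  simp only [pElt, mul_sub, sub_mul, mul_smul_comm, smul_mul_assoc, mul_assoc, h.r01, h.r03, h.r13,
    h.r23, mul_mul_of_mul h.r23, mul_mul_of_mul h.r13, h.r12, mul_mul_of_mul h.r12,
    mul_add, add_mul, smul_add, smul_sub, smul_smul]
  match_scalars <;> field_simp <;> ring

theorem p1_u3 : pElt q u 3 2 1 * u 3 = (q ^ 2)⁻¹ • (u 3 * pElt q u 3 2 1) := by
  simp only [pElt, mul_sub, sub_mul, mul_smul_comm, smul_mul_assoc, mul_assoc, h.r01, h.r03, h.r13,
    h.r23, mul_mul_of_mul h.r23, mul_mul_of_mul h.r13, h.r12, mul_mul_of_mul h.r12,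
    mul_add, add_mul, smul_add, smul_sub, smul_smul]
  match_scalars <;> field_simp <;> ring

theorem p1_u2 : pElt q u 3 2 1 * u 2 = u 2 * pElt q u 3 2 1 := by
  simp only [pElt, mul_sub, sub_mul, mul_smul_comm, smul_mul_assoc, mul_assoc, h.r23,
    mul_mul_of_mul h.r23, h.r12, mul_mul_of_mul h.r12, smul_smul]

theorem p1_u1 : pElt q u 3 2 1 * u 1 = q ^ 2 • (u 1 * pElt q u 3 2 1) := by
  simp only [pElt, mul_sub, sub_mul, mul_smul_comm, smul_mul_assoc, mul_assoc, h.r13,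
    mul_mul_of_mul h.r13, h.r12, mul_mul_of_mul h.r12, smul_smul,
    mul_add, add_mul, smul_add, smul_sub, smul_smul]
  match_scalars <;> field_simp <;> ring

theorem p0_p1 : pElt q u 2 1 0 * pElt q u 3 2 1 = (q ^ 4)⁻¹ • (pElt q u 3 2 1 * pElt q u 2 1 0) := by
  have h3 := h.p0_u3 hq
  have h2 := h.p0_u2 hq
  have h1 := h.p0_u1 hq
  conv_lhs => rw [pElt.eq_1 q u 3 2 1]
  conv_rhs => rw [pElt.eq_1 q u 3 2 1]
  generalize pElt q u 2 1 0 = p at *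
  simp only [mul_sub, sub_mul, mul_smul_comm, smul_mul_assoc, mul_assoc, h3, h2, h1,
    mul_mul_of_mul h3, mul_mul_of_mul h2, mul_mul_of_mul h1, smul_smul, smul_sub]
  match_scalars <;> field_simp

end Straight

end
section
variable {k A : Type*} [Field k] [Ring A] [Algebra k A] {q : k} {u : Fin 4 → A}

theorem pow_comm_of_comm {s : k} {x y : A} (h : x * y = s • (y * x)) (n : ℕ) :
    x ^ n * y = s ^ n • (y * x ^ n) := by
  simpa using pow_mul_pow_of_comm h n 1

theorem comm_symm {s : k} (hs : s ≠ 0) {x y : A} (h : x * y = s • (y * x)) :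
    y * x = s⁻¹ • (x * y) := by
  rw [h, smul_smul, inv_mul_cancel₀ hs, one_smul]

variable (q u) in
/-- The span of left monomials. -/
def leftSpan (D : ℕ) : Submodule k A :=
  Submodule.span k {x | ∃ α β : ℕ, α < D ∧ x = pElt q u 3 2 1 ^ α * u 2 ^ β}

variable (q u) in
/-- The span of right monomials. -/
def rightSpan (D : ℕ) : Submodule k A :=
  Submodule.span k {x | ∃ γ δ : ℕ, δ < D ∧ x = u 1 ^ γ * pElt q u 2 1 0 ^ δ}

theorem leftSpan_mono {D D' : ℕ} (h : D ≤ D') : leftSpan q u D ≤ leftSpan q u D' :=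
  Submodule.span_mono fun _ ⟨α, β, h1, h2⟩ => ⟨α, β, h1.trans_le h, h2⟩

theorem rightSpan_mono {D D' : ℕ} (h : D ≤ D') : rightSpan q u D ≤ rightSpan q u D' :=
  Submodule.span_mono fun _ ⟨α, β, h1, h2⟩ => ⟨α, β, h1.trans_le h, h2⟩

theorem left_mul_right_mem {D D' x y : ℕ} {r t : A} (hr : r ∈ leftSpan q u D)
    (ht : t ∈ rightSpan q u D') : r * (u 2 ^ x * u 1 ^ y) * t
      ∈ Submodule.span k (qMon q u '' {e | e.1 + e.2.2.2 + 1 < D + D'}) := by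
  induction hr using Submodule.span_induction with
  | mem r hr =>
    obtain ⟨α, β, hα, rfl⟩ := hr
    induction ht using Submodule.span_induction with
    | mem t ht =>
      obtain ⟨γ, δ, hδ, rfl⟩ := ht
      refine Submodule.subset_span ⟨(α, β + x, y + γ, δ), ?_, ?_⟩
      · change α + δ + 1 < D + D'; omega
      · simp only [qMon, pow_add, mul_assoc]
    | zero => simp
    | add t t' _ _ h1 h2 => rw [mul_add]; exact add_mem h1 h2
    | smul c t _ h1 => rw [mul_smul_comm]; exact Submodule.smul_mem _ _ h1
  | zero => simp
  | add r r' _ _ h1 h2 => rw [add_mul, add_mul]; exact add_mem h1 h2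
  | smul c r _ h1 => rw [smul_mul_assoc, smul_mul_assoc]; exact Submodule.smul_mem _ _ h1

namespace Straight
variable (hq : q ≠ 0) (h : Straight (q ^ 2)⁻¹ u)
include hq h

theorem p1_mul_left {D : ℕ} {r : A} (hr : r ∈ leftSpan q u D) :
    pElt q u 3 2 1 * r ∈ leftSpan q u (D + 1) := by
  induction hr using Submodule.span_induction with
  | mem r hr =>
    obtain ⟨α, β, hα, rfl⟩ := hr
    exact Submodule.subset_span ⟨α + 1, β, by omega, by rw [← mul_assoc, ← pow_succ']⟩
  | zero => simp
  | add t t' _ _ h1 h2 => rw [mul_add]; exact add_mem h1 h2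
  | smul c t _ h1 => rw [mul_smul_comm]; exact Submodule.smul_mem _ _ h1

theorem u2_mul_left {D : ℕ} {r : A} (hr : r ∈ leftSpan q u D) :
    u 2 * r ∈ leftSpan q u D := by
  induction hr using Submodule.span_induction with
  | mem r hr =>
    obtain ⟨α, β, hα, rfl⟩ := hr
    refine Submodule.subset_span ⟨α, β + 1, hα, ?_⟩
    rw [← mul_assoc, ((show Commute _ _ from h.p1_u2 hq).pow_left α).symm.eq, mul_assoc,
      ← pow_succ']
  | zero => simp
  | add t t' _ _ h1 h2 => rw [mul_add]; exact add_mem h1 h2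
  | smul c t _ h1 => rw [mul_smul_comm]; exact Submodule.smul_mem _ _ h1

theorem right_mul_p0 {D : ℕ} {r : A} (hr : r ∈ rightSpan q u D) :
    r * pElt q u 2 1 0 ∈ rightSpan q u (D + 1) := by
  induction hr using Submodule.span_induction with
  | mem r hr =>
    obtain ⟨α, β, hα, rfl⟩ := hr
    exact Submodule.subset_span ⟨α, β + 1, by omega, by rw [mul_assoc, ← pow_succ]⟩
  | zero => simp
  | add t t' _ _ h1 h2 => rw [add_mul]; exact add_mem h1 h2
  | smul c t _ h1 => rw [smul_mul_assoc]; exact Submodule.smul_mem _ _ h1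

theorem right_mul_u1 {D : ℕ} {r : A} (hr : r ∈ rightSpan q u D) :
    r * u 1 ∈ rightSpan q u D := by
  induction hr using Submodule.span_induction with
  | mem r hr =>
    obtain ⟨α, β, hα, rfl⟩ := hr
    refine Submodule.subset_span ⟨α + 1, β, hα, ?_⟩
    rw [mul_assoc, ((show Commute _ _ from h.p0_u1 hq).pow_left β).eq, ← mul_assoc, ← pow_succ]
  | zero => simp
  | add t t' _ _ h1 h2 => rw [add_mul]; exact add_mem h1 h2
  | smul c t _ h1 => rw [smul_mul_assoc]; exact Submodule.smul_mem _ _ h1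

/-- The innermost product is `u 3 * u 1 = p₁ + q² u₂²`. The first summand adds one power of `p₁` to
the previous case, and the second contributes only powers of `u 2`, which do not raise the degree in
`p₁`. -/
theorem left_leading (d : ℕ) : ∃ c : k, c ≠ 0 ∧
    u 3 ^ d * u 1 ^ d - c • pElt q u 3 2 1 ^ d ∈ leftSpan q u d := by
  have hq2 : q ^ 2 ≠ 0 := pow_ne_zero 2 hq
  induction d with
  | zero => exact ⟨1, one_ne_zero, by simp⟩
  | succ d ih =>
    obtain ⟨c, hc, ih⟩ := ih
    have e0 : u 3 * pElt q u 3 2 1 = q ^ 2 • (pElt q u 3 2 1 * u 3) := by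
      simpa using comm_symm (inv_ne_zero hq2) (h.p1_u3 hq)
    have e1 := pow_comm_of_comm e0 d
    have e3 : u 3 * u 2 = q ^ 2 • (u 2 * u 3) := by
      simpa using comm_symm (inv_ne_zero hq2) h.r23
    have e2 := pow_mul_pow_of_comm e3 d 2
    have e : u 3 ^ (d + 1) * u 1 ^ (d + 1) = (q ^ 2) ^ d • (pElt q u 3 2 1 * (u 3 ^ d * u 1 ^ d))
        + (q ^ 2 * (q ^ 2) ^ (d * 2)) • (u 2 * (u 2 * (u 3 ^ d * u 1 ^ d))) := by
      have e4 : u 3 * u 1 = pElt q u 3 2 1 + q ^ 2 • u 2 ^ 2 := by simp [pElt, pow_two]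
      rw [pow_succ, pow_succ' (u 1), mul_assoc, ← mul_assoc (u 3), e4, add_mul, mul_add, ← mul_assoc,
        e1, smul_mul_assoc, smul_mul_assoc, mul_smul_comm, ← mul_assoc (u 3 ^ d) (u 2 ^ 2), e2,
        smul_mul_assoc, smul_smul, pow_two (u 2)]
      simp only [mul_assoc]
    have hX : u 3 ^ d * u 1 ^ d ∈ leftSpan q u (d + 1) := by
      rw [← sub_add_cancel (u 3 ^ d * u 1 ^ d) (c • pElt q u 3 2 1 ^ d)]
      exact add_mem (leftSpan_mono (Nat.le_succ d) ih) (Submodule.smul_mem _ _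
        (Submodule.subset_span ⟨d, 0, Nat.lt_succ_self d, by simp⟩))
    refine ⟨(q ^ 2) ^ d * c, mul_ne_zero (pow_ne_zero d hq2) hc, ?_⟩
    rw [e, show (q ^ 2) ^ d • (pElt q u 3 2 1 * (u 3 ^ d * u 1 ^ d))
        + (q ^ 2 * (q ^ 2) ^ (d * 2)) • (u 2 * (u 2 * (u 3 ^ d * u 1 ^ d)))
        - ((q ^ 2) ^ d * c) • pElt q u 3 2 1 ^ (d + 1)
        = (q ^ 2) ^ d • (pElt q u 3 2 1 * (u 3 ^ d * u 1 ^ d - c • pElt q u 3 2 1 ^ d))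
        + (q ^ 2 * (q ^ 2) ^ (d * 2)) • (u 2 * (u 2 * (u 3 ^ d * u 1 ^ d))) by
      rw [mul_sub, mul_smul_comm, pow_succ' (pElt q u 3 2 1) d, smul_sub, smul_smul]
      exact add_sub_right_comm _ _ _]
    exact add_mem (Submodule.smul_mem _ _ (h.p1_mul_left hq ih))
      (Submodule.smul_mem _ _ (h.u2_mul_left hq (h.u2_mul_left hq hX)))

theorem right_leading (a : ℕ) : ∃ c : k, c ≠ 0 ∧
    u 2 ^ a * u 0 ^ a - c • pElt q u 2 1 0 ^ a ∈ rightSpan q u a := by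
  have hq2 : q ^ 2 ≠ 0 := pow_ne_zero 2 hq
  induction a with
  | zero => exact ⟨1, one_ne_zero, by simp⟩
  | succ d ih =>
    obtain ⟨c, hc, ih⟩ := ih
    have e1 := mul_pow_of_comm (h.p0_u0 hq) d
    have e3 : u 1 * u 0 = q ^ 2 • (u 0 * u 1) := by
      simpa using comm_symm (inv_ne_zero hq2) h.r01
    have e2 := pow_mul_pow_of_comm e3 2 d
    have e : u 2 ^ (d + 1) * u 0 ^ (d + 1) = (q ^ 2) ^ d • (u 2 ^ d * u 0 ^ d * pElt q u 2 1 0)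
        + (q ^ 2 * (q ^ 2) ^ (2 * d)) • (u 2 ^ d * u 0 ^ d * u 1 * u 1) := by
      have e4 : u 2 * u 0 = pElt q u 2 1 0 + q ^ 2 • u 1 ^ 2 := by simp [pElt, pow_two]
      rw [pow_succ, pow_succ' (u 0), mul_assoc, ← mul_assoc (u 2), e4, add_mul, mul_add,
        e1, smul_mul_assoc, e2, mul_smul_comm, mul_smul_comm, mul_smul_comm, smul_smul, pow_two (u 1)]
      simp only [mul_assoc]
    have hX : u 2 ^ d * u 0 ^ d ∈ rightSpan q u (d + 1) := by
      rw [← sub_add_cancel (u 2 ^ d * u 0 ^ d) (c • pElt q u 2 1 0 ^ d)]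
      exact add_mem (rightSpan_mono (Nat.le_succ d) ih) (Submodule.smul_mem _ _
        (Submodule.subset_span ⟨0, d, Nat.lt_succ_self d, by simp⟩))
    refine ⟨(q ^ 2) ^ d * c, mul_ne_zero (pow_ne_zero d hq2) hc, ?_⟩
    rw [e, show (q ^ 2) ^ d • (u 2 ^ d * u 0 ^ d * pElt q u 2 1 0)
        + (q ^ 2 * (q ^ 2) ^ (2 * d)) • (u 2 ^ d * u 0 ^ d * u 1 * u 1)
        - ((q ^ 2) ^ d * c) • pElt q u 2 1 0 ^ (d + 1)
        = (q ^ 2) ^ d • ((u 2 ^ d * u 0 ^ d - c • pElt q u 2 1 0 ^ d) * pElt q u 2 1 0)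
        + (q ^ 2 * (q ^ 2) ^ (2 * d)) • (u 2 ^ d * u 0 ^ d * u 1 * u 1) by
      rw [sub_mul, smul_mul_assoc, pow_succ (pElt q u 2 1 0) d, smul_sub, smul_smul]
      exact add_sub_right_comm _ _ _]
    exact add_mem (Submodule.smul_mem _ _ (h.right_mul_p0 hq ih))
      (Submodule.smul_mem _ _ (h.right_mul_u1 hq (h.right_mul_u1 hq hX)))

/-- A factor `u 3` turns into `p₁` only when paired with a `u 1`, and a factor `u 0` turns into `p₀`
only when paired with a `u 2`. The outer powers supply the partners as soon as `n` is at least `d`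
and `a`; the exponents `n + c - a` and `b + n - d` count the inner factors that remain. -/
theorem mon_leading {n d c b a : ℕ} (hd : d ≤ n) (ha : a ≤ n) : ∃ r : k, r ≠ 0 ∧
    u 2 ^ n * mon u d c b a * u 1 ^ n - r • qMon q u (d, n + c - a, b + n - d, a)
      ∈ Submodule.span k (qMon q u '' {e | e.1 + e.2.2.2 < d + a}) := by
  have hq2 : q ^ 2 ≠ 0 := pow_ne_zero 2 hq
  have hs : (q ^ 2)⁻¹ ≠ 0 := inv_ne_zero hq2
  obtain ⟨c₁, hc₁, h1⟩ := h.left_leading hq d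
  obtain ⟨c₂, hc₂, h2⟩ := h.right_leading hq a
  have e21 : u 2 * u 1 = q ^ 2 • (u 1 * u 2) := by simpa using comm_symm hs h.r12
  have f1 := pow_mul_pow_of_comm h.r23 n d
  have f2 := pow_mul_pow_of_comm h.r01 a n
  have f3 := pow_mul_pow_of_comm e21 (n + c) d
  have f4 := pow_mul_pow_of_comm e21 a (b + n - d)
  obtain ⟨r, hr, er⟩ : ∃ r : k, r ≠ 0 ∧ u 2 ^ n * mon u d c b a * u 1 ^ n
      = r • (u 3 ^ d * u 1 ^ d * (u 2 ^ (n + c - a) * u 1 ^ (b + n - d)) * (u 2 ^ a * u 0 ^ a)) := by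
    refine ⟨((q ^ 2)⁻¹ ^ (n * d) * (q ^ 2)⁻¹ ^ (a * n)) * ((q ^ 2) ^ ((n + c) * d)
      * (q ^ 2) ^ (a * (b + n - d))), by positivity, ?_⟩
    have g1 : u 2 ^ n * mon u d c b a * u 1 ^ n = ((q ^ 2)⁻¹ ^ (n * d) * (q ^ 2)⁻¹ ^ (a * n)) •
        (u 3 ^ d * (u 2 ^ (n + c) * u 1 ^ (b + n)) * u 0 ^ a) := by
      simp only [mon, mul_assoc, f2, mul_mul_of_mul f1, mul_smul_comm, smul_mul_assoc, smul_smul,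
        pow_add]
    have g2 : u 2 ^ (n + c) * u 1 ^ (b + n) = ((q ^ 2) ^ ((n + c) * d)
        * (q ^ 2) ^ (a * (b + n - d))) •
          (u 1 ^ d * (u 2 ^ (n + c - a) * u 1 ^ (b + n - d)) * u 2 ^ a) := by
      have hb : u 1 ^ (b + n) = u 1 ^ d * u 1 ^ (b + n - d) := by rw [← pow_add]; congr 1; omega
      have hc' : u 2 ^ (n + c) = u 2 ^ (n + c - a) * u 2 ^ a := by rw [← pow_add]; congr 1; omega
      rw [hb, ← mul_assoc, f3, hc', smul_mul_assoc]
      simp only [mul_assoc, f4, mul_smul_comm, smul_smul]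
    rw [g1, g2]
    simp only [mul_smul_comm, smul_mul_assoc, smul_smul, mul_assoc]
  refine ⟨r * (c₁ * c₂), mul_ne_zero hr (mul_ne_zero hc₁ hc₂), ?_⟩
  have hX : u 2 ^ a * u 0 ^ a ∈ rightSpan q u (a + 1) := by
    rw [← sub_add_cancel (u 2 ^ a * u 0 ^ a) (c₂ • pElt q u 2 1 0 ^ a)]
    exact add_mem (rightSpan_mono (Nat.le_succ a) h2) (Submodule.smul_mem _ _
      (Submodule.subset_span ⟨0, a, Nat.lt_succ_self a, by simp⟩))
  have hP : pElt q u 3 2 1 ^ d ∈ leftSpan q u (d + 1) :=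
    Submodule.subset_span ⟨d, 0, Nat.lt_succ_self d, by simp⟩
  have m1 := left_mul_right_mem (x := n + c - a) (y := b + n - d) h1 hX
  have m2 := left_mul_right_mem (x := n + c - a) (y := b + n - d) hP h2
  have e : u 2 ^ n * mon u d c b a * u 1 ^ n
      - (r * (c₁ * c₂)) • qMon q u (d, n + c - a, b + n - d, a)
      = r • ((u 3 ^ d * u 1 ^ d - c₁ • pElt q u 3 2 1 ^ d)
          * (u 2 ^ (n + c - a) * u 1 ^ (b + n - d)) * (u 2 ^ a * u 0 ^ a))
        + (r * c₁) • (pElt q u 3 2 1 ^ d * (u 2 ^ (n + c - a) * u 1 ^ (b + n - d))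
          * (u 2 ^ a * u 0 ^ a - c₂ • pElt q u 2 1 0 ^ a)) := by
    rw [er]
    simp only [qMon, sub_mul, mul_sub, smul_mul_assoc, mul_smul_comm, smul_sub, smul_smul, mul_assoc]
    abel
  rw [e]
  refine add_mem (Submodule.smul_mem _ _ (Submodule.span_mono (Set.image_mono ?_) m1))
    (Submodule.smul_mem _ _ (Submodule.span_mono (Set.image_mono ?_) m2))
  · intro e he
    have : e.1 + e.2.2.2 + 1 < d + (a + 1) := he
    change e.1 + e.2.2.2 < d + a; omega
  · intro e he
    have : e.1 + e.2.2.2 + 1 < d + 1 + a := he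
    change e.1 + e.2.2.2 < d + a; omega

/-- The linear map in the triangular criterion may depend on the finite relation, so the single
exponent `n` only has to bound the outer exponents that occur in it. -/
theorem linearIndependent_mon (hM : LinearIndependent k (qMon q u)) :
    LinearIndependent k fun e : Expo => mon u (e 3) (e 2) (e 1) (e 0) := by
  refine linearIndependent_of_triangular hM (fun e => e.1 + e.2.2.2) _ fun s => ?_
  let n := ∑ e ∈ s, (e 3 + e 0)
  have hn : ∀ e ∈ s, e 3 + e 0 ≤ n := fun e he =>
    Finset.single_le_sum (f := fun e : Expo => e 3 + e 0) (fun _ _ => Nat.zero_le _) he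
  choose! r hr using fun (e : Expo) (he : e ∈ s) => h.mon_leading hq (n := n) (d := e 3) (c := e 2)
    (b := e 1) (a := e 0) (by have := hn e he; omega) (by have := hn e he; omega)
  refine ⟨LinearMap.mulLeft k (u 2 ^ n) ∘ₗ LinearMap.mulRight k (u 1 ^ n),
    fun e => (e 3, n + e 2 - e 0, e 1 + n - e 3, e 0), r, ?_, fun e he => ⟨(hr e he).1, ?_⟩⟩
  · intro e he e' he' hee
    simp only [Prod.mk.injEq] at hee
    have h1 := hn e he
    have h2 := hn e' he'
    funext i
    fin_cases i <;> simp <;> omega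
  · have := (hr e he).2
    simpa [mul_assoc] using this

end Straight

end
-- Independence of the ordered monomials in the root vectors.
section
variable {R A C : Type*} [CommRing R] [Ring A] [Algebra R A] [Ring C] [Algebra R C] {s : R}
  {u : Fin 4 → A}

theorem Straight.map (h : Straight s u) (φ : A →ₐ[R] C) : Straight s (fun i => φ (u i)) where
  r01 := by simpa using congrArg φ h.r01
  r12 := by simpa using congrArg φ h.r12
  r23 := by simpa using congrArg φ h.r23
  r02 := by simpa using congrArg φ h.r02
  r13 := by simpa using congrArg φ h.r13
  r03 := by simpa using congrArg φ h.r03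

theorem Straight.of_map {φ : A →ₐ[R] C} (hφ : Function.Injective φ)
    (h : Straight s (fun i => φ (u i))) : Straight s u where
  r01 := hφ (by simpa using h.r01)
  r12 := hφ (by simpa using h.r12)
  r23 := hφ (by simpa using h.r23)
  r02 := hφ (by simpa using h.r02)
  r13 := hφ (by simpa using h.r13)
  r03 := hφ (by simpa using h.r03)

theorem Straight.scale (h : Straight s u) (r : R) :
    Straight s (fun i => r ^ (i : ℕ) • u i) where
  r01 := by simp [smul_smul, h.r01, mul_comm]
  r12 := by simp [smul_smul, h.r12, mul_comm, mul_assoc, mul_left_comm]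
  r23 := by simp [smul_smul, h.r23, mul_comm, mul_assoc, mul_left_comm]
  r02 := by
    simp only [Fin.coe_ofNat_eq_mod, smul_mul_smul_comm, h.r02, smul_add, smul_smul]
    congr 2 <;> simp <;> ring
  r13 := by
    simp only [Fin.coe_ofNat_eq_mod, smul_mul_smul_comm, h.r13, smul_add, smul_smul]
    congr 2 <;> simp <;> ring
  r03 := by
    simp only [Fin.coe_ofNat_eq_mod, smul_mul_smul_comm, h.r03, smul_add, smul_smul]
    congr 2 <;> simp <;> ring

theorem map_mon (φ : A →ₐ[R] C) (d c b a : ℕ) :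
    φ (mon u d c b a) = mon (fun i => φ (u i)) d c b a := by simp [mon]

theorem mul_comm_smul {s t : R} {x x' y : A} (h : x * y = s • (y * x)) (h' : x' * y = t • (y * x')) :
    x * x' * y = (s * t) • (y * (x * x')) := by
  rw [mul_assoc, h', mul_smul_comm, ← mul_assoc, h, smul_mul_assoc, smul_smul, mul_comm t, mul_assoc]

end

theorem straight_v : Straight (q ^ 2)⁻¹ v := by
  have h0 := q_ne_zero
  have hq := pow_ne_zero 2 q_ne_zero
  refine ⟨?_, ?_, ?_, ?_, ?_, ?_⟩
  · rw [v10, smul_smul, inv_mul_cancel₀ hq, one_smul]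
  · rw [v21, smul_smul, inv_mul_cancel₀ hq, one_smul]
  · rw [v32, smul_smul, inv_mul_cancel₀ hq, one_smul]
  · rw [v20, smul_add, smul_smul, smul_smul, inv_mul_cancel₀ hq, one_smul, add_assoc, ← add_smul,
      show (q ^ 2)⁻¹ * (q ^ 2 - 1) + ((q ^ 2)⁻¹ - 1) = 0 by field_simp; ring, zero_smul, add_zero]
  · rw [v31, smul_add, smul_smul, smul_smul, inv_mul_cancel₀ hq, one_smul, add_assoc, ← add_smul,
      show (q ^ 2)⁻¹ * (q ^ 2 - 1) + ((q ^ 2)⁻¹ - 1) = 0 by field_simp; ring, zero_smul, add_zero]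
  · rw [v30, smul_add, smul_smul, smul_smul, inv_mul_cancel₀ hq, one_smul, add_assoc, ← add_smul,
      show (q ^ 2)⁻¹ * (q ^ 2 - (q ^ 2)⁻¹) + ((q ^ 2)⁻¹ ^ 2 - 1) = 0 by field_simp; ring, zero_smul,
      add_zero]

theorem q_pow_injective : Function.Injective fun n : ℕ => q ^ n := by
  intro m n h
  simp only at h
  wlog hmn : m ≤ n generalizing m n
  · exact (this h.symm (by omega)).symm
  obtain ⟨d, rfl⟩ := Nat.exists_eq_add_of_le hmn
  by_contra hd
  refine q_pow_ne_one (n := d) (by omega) ?_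
  rw [pow_add] at h
  exact (mul_right_injective₀ (pow_ne_zero m q_ne_zero)) (by simpa using h.symm)

section
variable {A : Type*} [Ring A] [Algebra K A] {w : Fin 4 → A}

theorem qMon_mul_p1 (h : Straight (q ^ 2)⁻¹ w) (e : ℕ × ℕ × ℕ × ℕ) :
    qMon q w e * pElt q w 3 2 1
      = (q ^ (2 * e.2.2.1 + 4 * e.2.2.2))⁻¹ • (pElt q w 3 2 1 * qMon q w e) := by
  have h1 : pElt q w 3 2 1 * pElt q w 3 2 1 = (1 : K) • (pElt q w 3 2 1 * pElt q w 3 2 1) := by simp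
  have h2 : w 2 * pElt q w 3 2 1 = (1 : K) • (pElt q w 3 2 1 * w 2) := by
    rw [one_smul, h.p1_u2 q_ne_zero]
  have h3 := comm_symm (pow_ne_zero 2 q_ne_zero) (h.p1_u1 q_ne_zero)
  have := mul_comm_smul (mul_comm_smul (mul_comm_smul (pow_comm_of_comm h1 e.1)
    (pow_comm_of_comm h2 e.2.1)) (pow_comm_of_comm h3 e.2.2.1))
    (pow_comm_of_comm (h.p0_p1 q_ne_zero) e.2.2.2)
  rw [qMon, this]
  congr 1
  simp only [one_pow, one_mul, mul_one, inv_inv, inv_pow]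
  ring

theorem qMon_mul_u2 (h : Straight (q ^ 2)⁻¹ w) (e : ℕ × ℕ × ℕ × ℕ) :
    qMon q w e * w 2 = (q ^ (2 * (e.2.2.1 + e.2.2.2)))⁻¹ • (w 2 * qMon q w e) := by
  have h1 : pElt q w 3 2 1 * w 2 = (1 : K) • (w 2 * pElt q w 3 2 1) := by
    rw [one_smul, h.p1_u2 q_ne_zero]
  have h2 : w 2 * w 2 = (1 : K) • (w 2 * w 2) := by simp
  have := mul_comm_smul (mul_comm_smul (mul_comm_smul (pow_comm_of_comm h1 e.1)
    (pow_comm_of_comm h2 e.2.1)) (pow_comm_of_comm h.r12 e.2.2.1))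
    (pow_comm_of_comm (h.p0_u2 q_ne_zero) e.2.2.2)
  rw [qMon, this]
  congr 1
  simp only [one_pow, one_mul, mul_one, inv_inv, inv_pow]
  ring

theorem qMon_mul_u1 (h : Straight (q ^ 2)⁻¹ w) (e : ℕ × ℕ × ℕ × ℕ) :
    qMon q w e * w 1 = (q ^ (2 * (e.1 + e.2.1))) • (w 1 * qMon q w e) := by
  have h1 : pElt q w 2 1 0 * w 1 = (1 : K) • (w 1 * pElt q w 2 1 0) := by
    rw [one_smul, h.p0_u1 q_ne_zero]
  have h2 : w 1 * w 1 = (1 : K) • (w 1 * w 1) := by simp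
  have h3 : w 2 * w 1 = q ^ 2 • (w 1 * w 2) := by
    simpa using comm_symm (inv_ne_zero (pow_ne_zero 2 q_ne_zero)) h.r12
  have := mul_comm_smul (mul_comm_smul (mul_comm_smul (pow_comm_of_comm (h.p1_u1 q_ne_zero) e.1)
    (pow_comm_of_comm h3 e.2.1)) (pow_comm_of_comm h2 e.2.2.1))
    (pow_comm_of_comm h1 e.2.2.2)
  rw [qMon, this]
  congr 1
  simp only [one_pow, one_mul, mul_one, inv_inv, inv_pow]
  ring

theorem qMon_mul_p0 (h : Straight (q ^ 2)⁻¹ w) (e : ℕ × ℕ × ℕ × ℕ) :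
    qMon q w e * pElt q w 2 1 0
      = q ^ (4 * e.1 + 2 * e.2.1) • (pElt q w 2 1 0 * qMon q w e) := by
  have h1 : pElt q w 2 1 0 * pElt q w 2 1 0 = (1 : K) • (pElt q w 2 1 0 * pElt q w 2 1 0) := by simp
  have h2 : w 1 * pElt q w 2 1 0 = (1 : K) • (pElt q w 2 1 0 * w 1) := by
    rw [one_smul, h.p0_u1 q_ne_zero]
  have h3 := comm_symm (inv_ne_zero (pow_ne_zero 2 q_ne_zero)) (h.p0_u2 q_ne_zero)
  have h4 := comm_symm (inv_ne_zero (pow_ne_zero 4 q_ne_zero)) (h.p0_p1 q_ne_zero)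
  have := mul_comm_smul (mul_comm_smul (mul_comm_smul (pow_comm_of_comm h4 e.1)
    (pow_comm_of_comm h3 e.2.1)) (pow_comm_of_comm h2 e.2.2.1))
    (pow_comm_of_comm h1 e.2.2.2)
  rw [qMon, this]
  congr 1
  simp only [one_pow, one_mul, mul_one, inv_inv, inv_pow]
  ring

end

/-- Left and right multiplication of a monomial by `p₁`, `u 2`, `u 1` or `p₀` differ by powers of
`q` whose exponents are, up to sign, `2 e₃ + 4 e₄`, `2 (e₃ + e₄)`, `2 (e₁ + e₂)` and `4 e₁ + 2 e₂`.
These four numbers determine the monomial, and the factors act injectively by `exists_leads`. -/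
theorem linearIndependent_mon_v :
    LinearIndependent K fun e : Expo => mon v (e 3) (e 2) (e 1) (e 0) := by
  refine straight_v.linearIndependent_mon q_ne_zero ?_
  obtain ⟨ρ, l1, l2, l0, l3⟩ := exists_leads
  have h := straight_v.map ρ
  have hp : ∀ i j l, ρ (pElt q v i j l) = pElt q (fun i => ρ (v i)) i j l := by
    intro i j l; simp [pElt]
  have e1 : Leads (pElt q (fun i => ρ (v i)) 3 2 1) 1 := by rw [← hp]; exact l3
  have e0 : Leads (pElt q (fun i => ρ (v i)) 2 1 0) 1 := by rw [← hp]; exact l0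
  refine LinearIndependent.of_comp ρ.toLinearMap ?_
  have hM : ρ.toLinearMap ∘ qMon q v = qMon q (fun i => ρ (v i)) := by
    funext e; simp [qMon, hp]
  rw [hM]
  have inj : ∀ {T : Module.End K Lat} {s}, Leads T s → Function.Injective (LinearMap.mulLeft K T) := by
    intro T s hT X Y hXY
    refine LinearMap.ext fun φ => hT.injective ?_
    exact LinearMap.congr_fun hXY φ
  refine linearIndependent_of_separated _ ?_ ?_
  · intro e
    obtain ⟨_, h1⟩ := e1.pow e.1
    obtain ⟨_, h2⟩ := l2.pow e.2.1
    obtain ⟨_, h3⟩ := l1.pow e.2.2.1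
    obtain ⟨_, h4⟩ := e0.pow e.2.2.2
    intro h0
    have := inj (((h1.mul h2).mul h3).mul h4) (a₁ := 1) (a₂ := 0)
      ((mul_one _).trans (h0.trans (mul_zero _).symm))
    exact one_ne_zero this
  · intro i j hij
    by_contra hcon
    push Not at hcon
    have c1 := hcon _ (LinearMap.mulRight K _) _ (inj e1) (fun a => qMon_mul_p1 h a)
    have c2 := hcon _ (LinearMap.mulRight K _) _ (inj l2) (fun a => qMon_mul_u2 h a)
    have c3 := hcon _ (LinearMap.mulRight K _) _ (inj l1) (fun a => qMon_mul_u1 h a)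
    have c4 := hcon _ (LinearMap.mulRight K _) _ (inj e0) (fun a => qMon_mul_p0 h a)
    have c1 := q_pow_injective (inv_injective c1)
    have c2 := q_pow_injective (inv_injective c2)
    have c3 := q_pow_injective c3
    have c4 := q_pow_injective c4
    refine hij (Prod.ext ?_ (Prod.ext ?_ (Prod.ext ?_ ?_))) <;> omega

/-! ### The PBW basis of `Uw` -/

theorem straight_vw : Straight (q ^ 2)⁻¹ vw :=
  Straight.of_map (φ := UqPlus.val) Subtype.val_injective straight_v

/-- The ratio of the scaling factors of consecutive generators. -/
def scaleU : K := ((1 - q ^ (-2 : ℤ)) ^ 2)⁻¹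

theorem one_sub_q_ne : (1 : K) - q ^ (-2 : ℤ) ≠ 0 := by
  intro h
  refine q_pow_ne_one (n := 2) two_ne_zero ?_
  have h1 : q ^ (-2 : ℤ) = 1 := (sub_eq_zero.mp h).symm
  have h2 := congrArg (·⁻¹) h1
  simpa [zpow_neg] using h2

theorem scaleU_ne_zero : scaleU ≠ 0 := inv_ne_zero (pow_ne_zero 2 one_sub_q_ne)

theorem u_eq (i : Fin 4) : u i = scaleU ^ (i : ℕ) • vw i := by
  rw [u, scaleU, pow_mul, inv_pow]

theorem straight_u : Straight (q ^ 2)⁻¹ u := by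
  have : u = fun i : Fin 4 => scaleU ^ (i : ℕ) • vw i := funext u_eq
  rw [this]
  exact straight_vw.scale scaleU

theorem uMon_eq_mon (a : Expo) : uMon a = mon u (a 3) (a 2) (a 1) (a 0) := rfl

theorem uMon_eq_smul (a : Expo) : uMon a =
    (scaleU ^ (3 * a 3 + 2 * a 2 + a 1)) • mon vw (a 3) (a 2) (a 1) (a 0) := by
  simp only [uMon, u_eq, smul_pow, mon, smul_mul_smul_comm]
  congr 1
  simp [← pow_mul, ← pow_add]

theorem linearIndependent_uMon : LinearIndependent K uMon := by
  have h1 : LinearIndependent K fun e : Expo => mon vw (e 3) (e 2) (e 1) (e 0) := by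
    refine LinearIndependent.of_comp UqPlus.val.toLinearMap ?_
    convert linearIndependent_mon_v using 1
    funext e
    exact map_mon UqPlus.val _ _ _ _
  have h2 := h1.units_smul
    (fun e : Expo => Units.mk0 (scaleU ^ (3 * e 3 + 2 * e 2 + e 1)) (pow_ne_zero _ scaleU_ne_zero))
  convert h2 using 1
  funext e
  exact uMon_eq_smul e

theorem adjoin_u : Algebra.adjoin K (Set.range u) = ⊤ := by
  have h1 : Algebra.adjoin K (Set.range vw) = ⊤ := by
    have h := Algebra.adjoin_adjoin_coe_preimage (R := K) (s := Set.range v)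
    have e : Set.range vw = (Subtype.val ⁻¹' Set.range v : Set Uw) := by
      ext x
      simp only [Set.mem_range, Set.mem_preimage]
      exact ⟨fun ⟨i, hi⟩ => ⟨i, hi ▸ rfl⟩, fun ⟨i, hi⟩ => ⟨i, Subtype.ext hi⟩⟩
    rw [e]
    exact h
  rw [eq_top_iff, ← h1]
  refine Algebra.adjoin_le ?_
  rintro _ ⟨i, rfl⟩
  have : vw i = (scaleU ^ (i : ℕ))⁻¹ • u i := by
    rw [u_eq, smul_smul, inv_mul_cancel₀ (pow_ne_zero _ scaleU_ne_zero), one_smul]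
  rw [this]
  exact Subalgebra.smul_mem _ (Algebra.subset_adjoin (Set.mem_range_self i)) _

theorem filt_le_span {R A : Type*} [CommRing R] [Ring A] [Algebra R A] (w : Fin 4 → A) :
    filt R w 0 ≤ Submodule.span R (Set.range fun e : Expo => mon w (e 3) (e 2) (e 1) (e 0)) := by
  refine Submodule.span_mono ?_
  rintro _ ⟨d, c, b, a, -, rfl⟩
  exact ⟨![a, b, c, d], rfl⟩

theorem span_uMon : Submodule.span K (Set.range uMon) = ⊤ := by
  rw [eq_top_iff, ← Algebra.top_toSubmodule, ← adjoin_u]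
  exact straight_u.adjoin_le_filt.trans (filt_le_span u)

/-- The PBW basis of `U_q^+(w)`. -/
def pbw : Module.Basis Expo K Uw :=
  Module.Basis.mk linearIndependent_uMon span_uMon.ge

theorem pbw_apply (a : Expo) : pbw a = uMon a := Module.Basis.mk_apply _ _ _

/-! ### The universal property of `Uw` -/

theorem Straight.prod {R A C : Type*} [CommRing R] [Ring A] [Algebra R A] [Ring C] [Algebra R C]
    {s : R} {x : Fin 4 → A} {y : Fin 4 → C} (hx : Straight s x) (hy : Straight s y) :
    Straight s fun i => (x i, y i) where
  r01 := Prod.ext hx.r01 hy.r01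
  r12 := Prod.ext hx.r12 hy.r12
  r23 := Prod.ext hx.r23 hy.r23
  r02 := Prod.ext hx.r02 hy.r02
  r13 := Prod.ext hx.r13 hy.r13
  r03 := Prod.ext hx.r03 hy.r03

section
variable {C : Type*} [Ring C] [Algebra K C]

theorem algHom_ext_u {φ ψ : Uw →ₐ[K] C} (h : ∀ i, φ (u i) = ψ (u i)) : φ = ψ := by
  refine AlgHom.ext_of_adjoin_eq_top adjoin_u ?_
  rintro _ ⟨i, rfl⟩
  exact h i

end

/-- An algebra with independent ordered monomials is presented by the straightening relations. -/
theorem Straight.exists_lift {R A C : Type*} [CommRing R] [Ring A] [Algebra R A] [Ring C]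
    [Algebra R C] {s : R} {x : Fin 4 → A} {w : Fin 4 → C} (hx : Straight s x)
    (hgen : Algebra.adjoin R (Set.range x) = ⊤)
    (hind : LinearIndependent R fun e : Expo => mon x (e 3) (e 2) (e 1) (e 0))
    (hw : Straight s w) : ∃ φ : A →ₐ[R] C, ∀ i, φ (x i) = w i := by
  have hz := hx.prod hw
  let z : Fin 4 → A × C := fun i => (x i, w i)
  let D := Algebra.adjoin R (Set.range z)
  let π : D →ₐ[R] A := (AlgHom.fst R A C).comp D.val
  -- `D` is the graph of the wanted homomorphism: it is spanned by its ordered monomials, which stay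
  -- independent after projection to `A`.
  have hπ : Function.Bijective π := by
    constructor
    · rw [injective_iff_map_eq_zero]
      rintro ⟨y, hy⟩ hy0
      have h1 := filt_le_span z (hz.adjoin_le_filt hy)
      rw [Finsupp.mem_span_range_iff_exists_finsupp] at h1
      obtain ⟨c, rfl⟩ := h1
      have h2 : Finsupp.linearCombination R
          (fun e : Expo => mon x (e 3) (e 2) (e 1) (e 0)) c = 0 := by
        rw [Finsupp.linearCombination_apply, ← hy0]
        change _ = (AlgHom.fst R A C) (c.sum fun i a => a • mon z (i 3) (i 2) (i 1) (i 0))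
        rw [map_finsuppSum]
        refine Finsupp.sum_congr fun e _ => ?_
        rw [map_smul, map_mon]
        rfl
      have h3 : c = 0 := hind (by simpa using h2)
      subst h3
      rfl
    · rw [← AlgHom.range_eq_top, eq_top_iff, ← hgen]
      refine Algebra.adjoin_le ?_
      rintro _ ⟨i, rfl⟩
      exact ⟨⟨z i, Algebra.subset_adjoin ⟨i, rfl⟩⟩, rfl⟩
  let ε := AlgEquiv.ofBijective π hπ
  refine ⟨((AlgHom.snd R A C).comp D.val).comp ε.symm.toAlgHom, fun i => ?_⟩
  have : ε.symm (x i) = ⟨z i, Algebra.subset_adjoin ⟨i, rfl⟩⟩ := by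
    rw [AlgEquiv.symm_apply_eq]; rfl
  change (AlgHom.snd R A C) (D.val (ε.symm (x i))) = _
  rw [this]
  rfl

theorem exists_lift {C : Type*} [Ring C] [Algebra K C] {w : Fin 4 → C}
    (h : Straight (q ^ 2)⁻¹ w) : ∃ φ : Uw →ₐ[K] C, ∀ i, φ (u i) = w i :=
  straight_u.exists_lift adjoin_u linearIndependent_uMon h

/-! ### The bar involution of the scalars -/

theorem transcendental_q_inv : Transcendental ℚ (q⁻¹ : K) := by
  intro h
  refine (RatFunc.transcendental_X (K := ℚ)) ?_
  convert IsAlgebraic.inv_iff.mp h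
  · exact Subsingleton.elim _ _
  · rfl

/-- The automorphism `q ↦ q⁻¹` of the field of scalars. -/
def bar : K →+* K :=
  RatFunc.liftRingHom (Polynomial.aeval (R := ℚ) (q⁻¹ : K)).toRingHom
    (nonZeroDivisors_le_comap_nonZeroDivisors_of_injective _
      (transcendental_iff_injective.mp transcendental_q_inv))

theorem bar_q : bar q = q⁻¹ := by
  simp [bar, q]

theorem ringHom_ext_q {S : Type*} [Semiring S] {φ ψ : K →+* S} (h : φ q = ψ q) : φ = ψ := by
  refine IsLocalization.ringHom_ext (nonZeroDivisors (Polynomial ℚ)) ?_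
  refine Polynomial.ringHom_ext' (Subsingleton.elim _ _) ?_
  simpa [q] using h

theorem bar_bar (c : K) : bar (bar c) = c :=
  RingHom.congr_fun (ringHom_ext_q (φ := bar.comp bar) (ψ := RingHom.id K)
    (by simp [bar_q])) c

section
variable {k A : Type*} [Field k] [Ring A] [Algebra k A] {s : k} {u : Fin 4 → A}

theorem Straight.op (hs : s ≠ 0) (h : Straight s u) :
    Straight s⁻¹ fun i => MulOpposite.op (u i) where
  r01 := by
    rw [← MulOpposite.op_mul, ← MulOpposite.op_mul, h.r01, ← MulOpposite.op_smul, smul_smul,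
      inv_mul_cancel₀ hs, one_smul]
  r12 := by
    rw [← MulOpposite.op_mul, ← MulOpposite.op_mul, h.r12, ← MulOpposite.op_smul, smul_smul,
      inv_mul_cancel₀ hs, one_smul]
  r23 := by
    rw [← MulOpposite.op_mul, ← MulOpposite.op_mul, h.r23, ← MulOpposite.op_smul, smul_smul,
      inv_mul_cancel₀ hs, one_smul]
  r02 := by
    rw [← MulOpposite.op_mul, ← MulOpposite.op_mul, ← MulOpposite.op_mul, h.r02,
      ← MulOpposite.op_smul, ← MulOpposite.op_smul, ← MulOpposite.op_add, smul_add, smul_smul,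
      smul_smul, inv_mul_cancel₀ hs, one_smul, add_assoc, ← add_smul,
      show s⁻¹ * (s - 1) + (s⁻¹ - 1) = 0 by field_simp; ring, zero_smul, add_zero]
  r13 := by
    rw [← MulOpposite.op_mul, ← MulOpposite.op_mul, ← MulOpposite.op_mul, h.r13,
      ← MulOpposite.op_smul, ← MulOpposite.op_smul, ← MulOpposite.op_add, smul_add, smul_smul,
      smul_smul, inv_mul_cancel₀ hs, one_smul, add_assoc, ← add_smul,
      show s⁻¹ * (s - 1) + (s⁻¹ - 1) = 0 by field_simp; ring, zero_smul, add_zero]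
  r03 := by
    rw [← MulOpposite.op_mul, ← MulOpposite.op_mul, ← MulOpposite.op_mul, h.r03, h.r12,
      ← MulOpposite.op_smul, ← MulOpposite.op_smul, ← MulOpposite.op_add, smul_add, smul_smul,
      smul_smul, smul_smul, inv_mul_cancel₀ hs, one_smul, add_assoc, ← add_smul,
      show s⁻¹ * (s ^ 2 - 1) + (s⁻¹ ^ 2 - 1) * s = 0 by field_simp; ring, zero_smul, add_zero]

theorem Straight.op_rev (h : Straight s u) :
    Straight s ![MulOpposite.op (u 3), MulOpposite.op (u 2), MulOpposite.op (u 1),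
      MulOpposite.op (u 0)] where
  r01 := by simpa using congrArg MulOpposite.op h.r23
  r12 := by simpa using congrArg MulOpposite.op h.r12
  r23 := by simpa using congrArg MulOpposite.op h.r01
  r02 := by simpa using congrArg MulOpposite.op h.r13
  r13 := by simpa using congrArg MulOpposite.op h.r02
  r03 := by simpa using congrArg MulOpposite.op h.r03
end

/-! ### The antiautomorphism `σ` -/

/-- The opposite algebra of `Uw` with scalars twisted by `bar`. -/
def UwBar : Type := Uwᵐᵒᵖ

instance : Ring UwBar := inferInstanceAs (Ring Uwᵐᵒᵖ)
instance : Algebra K UwBar := Algebra.compHom Uwᵐᵒᵖ bar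

/-- The identification of `UwBar` with the opposite of `Uw`. -/
def toOp : UwBar ≃+* Uwᵐᵒᵖ := RingEquiv.refl _

theorem toOp_smul (c : K) (x : UwBar) : toOp (c • x) = bar c • toOp x := rfl

/-- Passing to the opposite algebra inverts the parameter, and the twist by `bar` inverts it back.
The factors `q ^ (2 * i)` are harmless because each relation is homogeneous in the sum of the
indices. -/
theorem straight_bar : Straight (q ^ 2)⁻¹
    fun i : Fin 4 => toOp.symm (MulOpposite.op (q ^ (2 * (i : ℕ)) • u i)) := by
  have hq := pow_ne_zero 2 q_ne_zero
  have h := (straight_u.op (inv_ne_zero hq)).scale (q ^ 2)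
  have e : (fun i : Fin 4 => (q ^ 2) ^ (i : ℕ) • MulOpposite.op (u i))
      = fun i : Fin 4 => MulOpposite.op (q ^ (2 * (i : ℕ)) • u i) := by
    funext i; rw [MulOpposite.op_smul, pow_mul]
  rw [e] at h
  have hb : bar (q ^ 2)⁻¹ = ((q ^ 2)⁻¹)⁻¹ := by simp [bar_q]
  refine ⟨?_, ?_, ?_, ?_, ?_, ?_⟩ <;> apply toOp.injective <;>
    simp only [map_mul, map_add, toOp_smul, RingEquiv.apply_symm_apply, map_sub, map_pow, map_one, hb]
  · exact h.r01
  · exact h.r12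
  · exact h.r23
  · exact h.r02
  · exact h.r13
  · exact h.r03

/-- The antiautomorphism `σ` as a map to the twisted opposite algebra. -/
def sigHom : Uw →ₐ[K] UwBar := (exists_lift straight_bar).choose

theorem sigHom_u (i : Fin 4) :
    sigHom (u i) = toOp.symm (MulOpposite.op (q ^ (2 * (i : ℕ)) • u i)) :=
  (exists_lift straight_bar).choose_spec i

/-- The antiautomorphism `σ` as a map. -/
def sig (x : Uw) : Uw := MulOpposite.unop (toOp (sigHom x))

theorem sig_mul (x y : Uw) : sig (x * y) = sig y * sig x := by simp [sig]
theorem sig_add (x y : Uw) : sig (x + y) = sig x + sig y := by simp [sig]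
theorem sig_sub (x y : Uw) : sig (x - y) = sig x - sig y := by simp [sig]
theorem sig_one : sig 1 = 1 := by simp [sig]
theorem sig_zero : sig 0 = 0 := by simp [sig]
theorem sig_smul (c : K) (x : Uw) : sig (c • x) = bar c • sig x := by simp [sig, toOp_smul]
theorem sig_u (i : Fin 4) : sig (u i) = q ^ (2 * (i : ℕ)) • u i := by simp [sig, sigHom_u]
theorem sig_pow (x : Uw) (n : ℕ) : sig (x ^ n) = sig x ^ n := by simp [sig]
theorem sig_sum {ι : Type*} (s : Finset ι) (f : ι → Uw) :
    sig (∑ i ∈ s, f i) = ∑ i ∈ s, sig (f i) :=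
  map_sum (⟨⟨sig, sig_zero⟩, sig_add⟩ : Uw →+ Uw) f s

theorem sig_sig (x : Uw) : sig (sig x) = x := by
  let φ : Uw →ₐ[K] Uw :=
    { toFun := fun x => sig (sig x)
      map_one' := by simp [sig_one]
      map_mul' := fun x y => by simp [sig_mul]
      map_zero' := by simp [sig_zero]
      map_add' := fun x y => by simp [sig_add]
      commutes' := fun c => by
        rw [Algebra.algebraMap_eq_smul_one, sig_smul, sig_smul, bar_bar, sig_one, sig_one] }
  have h : φ = AlgHom.id K Uw := algHom_ext_u fun i => by
    change sig (sig (u i)) = u i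
    rw [sig_u, sig_smul, sig_u, smul_smul, map_pow, bar_q, ← mul_pow,
      inv_mul_cancel₀ q_ne_zero, one_pow, one_smul]
  exact AlgHom.congr_fun h x

/-- The antiautomorphism `σ`. -/
def sigEquiv : Uw ≃+* Uwᵐᵒᵖ where
  toFun x := MulOpposite.op (sig x)
  invFun x := sig x.unop
  left_inv := sig_sig
  right_inv x := by simp [sig_sig]
  map_mul' x y := by simp [sig_mul]
  map_add' x y := by simp [sig_add]

theorem isSigma_sigEquiv : IsSigma sigEquiv := by
  refine ⟨?_, fun i => congrArg MulOpposite.op (sig_u i)⟩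
  change MulOpposite.op (sig _) = _
  rw [Algebra.algebraMap_eq_smul_one, sig_smul, sig_one, bar_q, Algebra.algebraMap_eq_smul_one]

/-- With scalars twisted by `bar`, any such map is a `K`-algebra homomorphism to the opposite
algebra and is determined by the generators. Hence the existential in `IsDualCanonical` may be
replaced by the concrete map `sig`. -/
theorem IsSigma.eq {τ : Uw ≃+* Uwᵐᵒᵖ} (h : IsSigma τ) (x : Uw) : τ x = MulOpposite.op (sig x) := by
  have h1 : ∀ c : K, τ (algebraMap K Uw c) = MulOpposite.op (algebraMap K Uw (bar c)) := by
    refine RingHom.congr_fun (f := (τ : Uw →+* Uwᵐᵒᵖ).comp (algebraMap K Uw))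
      (g := (algebraMap K Uwᵐᵒᵖ).comp bar) (ringHom_ext_q ?_)
    change τ (algebraMap K Uw q) = MulOpposite.op (algebraMap K Uw (bar q))
    rw [h.1, bar_q]
  let ψ : Uw →ₐ[K] UwBar :=
    { toRingHom := (toOp.symm : Uwᵐᵒᵖ →+* UwBar).comp (τ : Uw →+* Uwᵐᵒᵖ)
      commutes' := fun c => by
        change toOp.symm (τ (algebraMap K Uw c)) = _
        rw [h1]; rfl }
  have h2 : ψ = sigHom := algHom_ext_u fun i => by
    rw [sigHom_u, ← h.2 i]; rfl
  have h3 := AlgHom.congr_fun h2 x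
  exact congrArg toOp h3

theorem exists_sigma_iff (x : Uw) (c : K) :
    (∃ τ : Uw ≃+* Uwᵐᵒᵖ, IsSigma τ ∧ τ x = MulOpposite.op (c • x)) ↔ sig x = c • x := by
  constructor
  · rintro ⟨τ, h, hx⟩
    rw [h.eq] at hx
    exact MulOpposite.op_injective hx
  · intro h
    exact ⟨sigEquiv, isSigma_sigEquiv, congrArg MulOpposite.op h⟩

/-! ### The antiautomorphism `θ` that reverses the generators -/

/-- The reversal of the generators as a map to the opposite algebra. -/
def revHom : Uw →ₐ[K] Uwᵐᵒᵖ := (exists_lift straight_u.op_rev).choose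

/-- The linear antiautomorphism that sends `u i` to `u (3 - i)`. -/
def rev : Uw →ₗ[K] Uw := (MulOpposite.opLinearEquiv K).symm.toLinearMap ∘ₗ revHom.toLinearMap

theorem rev_mul (x y : Uw) : rev (x * y) = rev y * rev x := by simp [rev]
theorem rev_one : rev 1 = 1 := by simp [rev]
theorem rev_pow (x : Uw) (n : ℕ) : rev (x ^ n) = rev x ^ n := by simp [rev]
theorem rev_u (i : Fin 4) : rev (u i) = u (Fin.rev i) := by
  have h := (exists_lift straight_u.op_rev).choose_spec i
  change MulOpposite.unop (revHom (u i)) = _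
  rw [revHom, h]
  fin_cases i <;> rfl

/-- The dual PBW basis. -/
def pbwE : Module.Basis Expo K Uw :=
  pbw.unitsSMul fun a => Units.mk0 (q ^ (∑ i, (a i).choose 2)) (pow_ne_zero _ q_ne_zero)

theorem pbwE_apply (a : Expo) : pbwE a = dualPBW a := by
  rw [pbwE, Module.Basis.unitsSMul_apply, pbw_apply]; rfl

theorem repr_filt {m : ℕ} {x : Uw} (hx : x ∈ filt K u m) {b : Expo} (hb : b 2 + b 1 < m) :
    pbwE.repr x b = 0 := by
  induction hx using Submodule.span_induction with
  | mem x hx =>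
    obtain ⟨d, c, b', a, h, rfl⟩ := hx
    have e : mon u d c b' a = (q ^ (∑ i, ((![a, b', c, d] : Expo) i).choose 2))⁻¹ •
        pbwE ![a, b', c, d] := by
      rw [pbwE_apply, dualPBW, smul_smul, inv_mul_cancel₀ (pow_ne_zero _ q_ne_zero), one_smul]
      rfl
    rw [e, map_smul, Module.Basis.repr_self, Finsupp.smul_apply, Finsupp.single_apply, if_neg,
      smul_zero]
    rintro rfl
    simp at hb
    omega
  | zero => simp
  | add x y _ _ hx hy => simp [hx, hy]
  | smul r x _ hx => simp [hx]

/-- The norm depends only on the total exponent and on `∑ (2 i + 1) a i`, and both generating moves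
preserve these. -/
theorem Below.normN {a b : Expo} (h : Below a b) : normN b = normN a := by
  obtain ⟨s, r, h3, h2, h1, h0⟩ := h
  simp only [KroneckerQuantum.normN, h3, h2, h1, h0]
  ring

theorem two_mul_choose_two (n : ℕ) : ((2 * n.choose 2 : ℕ) : ℤ) = (n : ℤ) * n - n := by
  induction n with
  | zero => simp
  | succ n ih =>
    rw [Nat.choose_succ_succ' n 1]
    push_cast at ih ⊢
    simp only [Nat.choose_one_right]
    linarith

/-- Reversing the product and straightening it back produces only terms with more inner factors. The
straightening power, the factors `q ^ (2 i)` and the inverted binomial exponents combine to `-normN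
a` on the diagonal. -/
theorem sig_dualPBW (a : Expo) :
    sig (dualPBW a) - q ^ (-normN a) • dualPBW a ∈ filt K u (a 2 + a 1 + 1) := by
  have h := straight_u.reverse_mon (a 3) (a 2) (a 1) (a 0)
  set X := u 0 ^ a 0 * (u 1 ^ a 1 * (u 2 ^ a 2 * u 3 ^ a 3))
  set E := a 0 * (a 1 + a 2 + a 3) + a 1 * (a 2 + a 3) + a 2 * a 3
  let t : K := (q⁻¹) ^ (∑ i, (a i).choose 2) * q ^ (2 * a 1 + 4 * a 2 + 6 * a 3)
  have e1 : sig (dualPBW a) = t • X := by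
    simp only [dualPBW, uMon, sig_smul, sig_mul, sig_pow, sig_u, map_pow, bar_q, smul_pow,
      smul_mul_assoc, mul_smul_comm, smul_smul, X, t]
    congr 1
    simp only [← pow_mul, pow_add]
    simp
    ring_nf
    simp
  have e2 : (q ^ (-normN a)) • dualPBW a = t • ((q ^ 2)⁻¹ ^ E • mon u (a 3) (a 2) (a 1) (a 0)) := by
    rw [dualPBW, uMon_eq_mon, smul_smul, smul_smul]
    congr 1
    simp only [t, ← zpow_natCast, inv_zpow', ← zpow_mul, ← zpow_neg, ← zpow_add₀ q_ne_zero]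
    congr 1
    have c0 := two_mul_choose_two (a 0)
    have c1 := two_mul_choose_two (a 1)
    have c2 := two_mul_choose_two (a 2)
    have c3 := two_mul_choose_two (a 3)
    simp only [Fin.sum_univ_four, normN, E]
    push_cast at c0 c1 c2 c3 ⊢
    linarith
  rw [e1, e2, ← smul_sub]
  exact Submodule.smul_mem _ _ h

theorem aeval_q_injective : Function.Injective (Polynomial.aeval (R := ℤ) (q : K)) := by
  have h : (Polynomial.aeval (R := ℤ) (q : K) : Polynomial ℤ →+* K)
      = (algebraMap (Polynomial ℚ) K).comp (Polynomial.mapRingHom (Int.castRingHom ℚ)) :=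
    Polynomial.ringHom_ext' (Subsingleton.elim _ _) (by simp [q])
  intro x y hxy
  have h2 : (algebraMap (Polynomial ℚ) K) (x.map (Int.castRingHom ℚ))
      = (algebraMap (Polynomial ℚ) K) (y.map (Int.castRingHom ℚ)) :=
    (RingHom.congr_fun h x).symm.trans (hxy.trans (RingHom.congr_fun h y))
  exact Polynomial.map_injective _ Int.cast_injective (RatFunc.algebraMap_injective ℚ h2)

theorem bar_aeval (p : Polynomial ℤ) : bar (Polynomial.aeval q p) = Polynomial.aeval q⁻¹ p := by
  rw [Polynomial.aeval_def, Polynomial.hom_eval₂, Polynomial.aeval_def, bar_q]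
  congr 1
  exact Subsingleton.elim _ _

/-- One side involves only negative powers of `q` and the other only positive ones. With
denominators cleared, the reversed polynomial would be `X ^ (natDegree + 2)` times `p`, which
contradicts the bound on its degree. -/
theorem bar_eq_zero {p : Polynomial ℤ} (h : bar (q * Polynomial.aeval q p) = q * Polynomial.aeval q p) :
    p = 0 := by
  by_contra hp
  have hq := q_ne_zero
  let : Invertible (q⁻¹ : K) := invertibleOfNonzero (inv_ne_zero hq)
  have h2 := Polynomial.eval₂_reverse_mul_pow (algebraMap ℤ K) q⁻¹ p
  rw [invOf_eq_inv, inv_inv, ← Polynomial.aeval_def, ← Polynomial.aeval_def] at h2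
  rw [map_mul, bar_aeval, bar_q, ← h2] at h
  have h3 : p.reverse = Polynomial.X ^ (p.natDegree + 2) * p := by
    apply aeval_q_injective
    rw [map_mul, map_pow, Polynomial.aeval_X]
    have h4 : q ^ (p.natDegree + 2) * Polynomial.aeval q p
        = q ^ (p.natDegree + 1) * (q * Polynomial.aeval q p) := by ring
    rw [h4, ← h, inv_pow]
    field_simp
    ring
  have h5 := congrArg Polynomial.natDegree h3
  rw [Polynomial.natDegree_X_pow_mul _ hp] at h5
  have := Polynomial.reverse_natDegree_le p
  omega

/-- The integral combinations, with coefficients divisible by `q`, of the dual PBW basis elements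
strictly above `a`. -/
def cone (a : Expo) : AddSubgroup Uw :=
  AddSubgroup.closure {x | ∃ (e : ℕ) (b : Expo), Below a b ∧ b ≠ a ∧ x = q ^ (e + 1) • dualPBW b}

theorem exists_of_mem_cone {a : Expo} {x : Uw} (hx : x ∈ cone a) :
    ∃ c : Expo →₀ Polynomial ℤ, (∀ b ∈ c.support, Below a b ∧ b ≠ a) ∧
      x = c.sum fun b p => (q * Polynomial.aeval q p) • dualPBW b := by
  classical
  induction hx using AddSubgroup.closure_induction with
  | mem x hx =>
    obtain ⟨e, b, h1, h2, rfl⟩ := hx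
    refine ⟨Finsupp.single b (Polynomial.X ^ e), fun b' hb' => ?_, ?_⟩
    · have := Finsupp.support_single_subset hb'
      rw [Finset.mem_singleton] at this
      subst this; exact ⟨h1, h2⟩
    · rw [Finsupp.sum_single_index (by simp)]
      simp [pow_succ']
  | zero => exact ⟨0, by simp, by simp⟩
  | add x y _ _ hx hy =>
    obtain ⟨c, hc, rfl⟩ := hx
    obtain ⟨d, hd, rfl⟩ := hy
    refine ⟨c + d, fun b hb => ?_, ?_⟩
    · exact (Finset.mem_union.mp (Finsupp.support_add hb)).elim (hc b) (hd b)
    · rw [Finsupp.sum_add_index' (by simp) (by intros; simp [mul_add, add_smul])]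
  | neg x _ hx =>
    obtain ⟨c, hc, rfl⟩ := hx
    refine ⟨-c, fun b hb => hc b (by simpa using hb), ?_⟩
    rw [Finsupp.sum_neg_index (by simp)]
    simp [Finsupp.sum]

theorem isDualCanonical_of {a : Expo} {x : Uw} (h1 : x - dualPBW a ∈ cone a)
    (h2 : sig x = q ^ (-normN a) • x) : IsDualCanonical a x :=
  ⟨exists_of_mem_cone h1, (exists_sigma_iff _ _).mpr h2⟩

theorem repr_sum (c : Expo →₀ Polynomial ℤ) (b : Expo) :
    pbwE.repr (c.sum fun b p => (q * Polynomial.aeval q p) • dualPBW b) b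
      = q * Polynomial.aeval q (c b) := by
  classical
  rw [map_finsuppSum, Finsupp.sum_apply]
  simp only [map_smul, ← pbwE_apply, Module.Basis.repr_self, Finsupp.smul_apply, smul_eq_mul,
    Finsupp.single_apply]
  rw [Finsupp.sum, Finset.sum_eq_single b]
  · simp
  · intro b' _ hb; simp [hb]
  · intro hb; simp [Finsupp.notMem_support_iff.mp hb]

/-- On the difference of two candidates `sig` is triangular with all diagonal entries equal to `q ^
(-normN a)`, since the norm is constant on the indices involved. At an index with the smallest inner
exponent no other term interferes, so its coefficient is bar invariant and lies in `q ℤ[q]`; hence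
it is zero. -/
theorem IsDualCanonical.unique {a : Expo} {x y : Uw} (hx : IsDualCanonical a x)
    (hy : IsDualCanonical a y) : x = y := by
  classical
  obtain ⟨⟨c, hc, ec⟩, hxs⟩ := hx
  obtain ⟨⟨d, hd, ed⟩, hys⟩ := hy
  rw [exists_sigma_iff] at hxs hys
  have hz : x - y = (c - d).sum fun b p => (q * Polynomial.aeval q p) • dualPBW b := by
    rw [Finsupp.sum_sub_index (by intros; simp [mul_sub, sub_smul]), ← ec, ← ed]
    abel
  have hs : sig (x - y) = q ^ (-normN a) • (x - y) := by rw [sig_sub, hxs, hys, smul_sub]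
  set e := c - d
  have he : ∀ b ∈ e.support, normN b = normN a := fun b hb =>
    (Finset.mem_union.mp (Finsupp.support_sub hb)).elim (fun h => (hc b h).1.normN)
      (fun h => (hd b h).1.normN)
  suffices e = 0 by
    rw [this] at hz
    exact sub_eq_zero.mp (by simpa using hz)
  by_contra hne
  obtain ⟨b, hb, hmin⟩ := Finset.exists_min_image e.support (fun b => b 2 + b 1)
    (Finsupp.support_nonempty_iff.mpr hne)
  refine Finsupp.mem_support_iff.mp hb (bar_eq_zero ?_)
  have h1 := congrArg (fun t => pbwE.repr t b) hs
  simp only [map_smul, Finsupp.smul_apply, smul_eq_mul] at h1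
  rw [hz, repr_sum, Finsupp.sum, sig_sum, map_sum, Finsupp.finsetSum_apply,
    Finset.sum_eq_single b] at h1
  · rw [sig_smul, ← sub_add_cancel (sig (dualPBW b)) (q ^ (-normN b) • dualPBW b), smul_add, map_add,
      Finsupp.add_apply, map_smul, Finsupp.smul_apply, repr_filt (sig_dualPBW b) (Nat.lt_succ_self _),
      map_smul, map_smul, ← pbwE_apply, Module.Basis.repr_self, he b hb] at h1
    simp only [smul_zero, zero_add, mul_zero, zero_mul, smul_eq_mul, Finsupp.smul_apply, Finsupp.single_eq_same, smul_eq_mul,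
      mul_one] at h1
    rw [mul_comm] at h1
    exact mul_left_cancel₀ (zpow_ne_zero _ q_ne_zero) h1
  · intro b' hb' hne'
    rw [sig_smul, ← sub_add_cancel (sig (dualPBW b')) (q ^ (-normN b') • dualPBW b'), smul_add,
      map_add, Finsupp.add_apply, map_smul, Finsupp.smul_apply,
      repr_filt (sig_dualPBW b') (Nat.lt_succ_of_le (hmin b' hb')),
      map_smul, map_smul, ← pbwE_apply, Module.Basis.repr_self]
    simp [Finsupp.single_apply, hne']
  · intro h; exact absurd hb h

theorem IsDualCanonical.dualCanonical_eq {a : Expo} {x : Uw} (h : IsDualCanonical a x) :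
    dualCanonical a = x := by
  have hu : ∃! x : Uw, IsDualCanonical a x := ⟨x, h, fun y hy => hy.unique h⟩
  rw [dualCanonical, dif_pos hu]
  exact hu.choose_spec.1.unique h

/-! ### The elements with indices `(n,0,0,n)` and `(n+1,0,0,n)` -/

/-- The triple `(S_n, x_n, S_{n+1})`. -/
def dcState : ℕ → Uw × Uw × Uw
  | 0 => (1, u 3, u 3 * u 0 - q ^ 2 • (u 2 * u 1))
  | n + 1 =>
    -- The factors `q ^ (n + 1)` normalize the leading coefficient to `1`. The exponents `5 n + 3`
    -- and `5 n + 4` are the ones that the coefficient identities `fCoef_succ_succ` at `n + 1` and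
    -- `gCoef_succ_succ` at `n + 2` require.
    let t := dcState n
    let x := q ^ (n + 1) • (u 3 * t.2.2) - q ^ (5 * n + 3) • (p₁ * u 2 * t.1)
    (t.2.2, x, q ^ (n + 1) • (x * u 0) - q ^ (5 * n + 4) • (t.2.1 * u 1 * p₀))

/-- The dual canonical basis element with index `(n,0,0,n)`. -/
def dcS (n : ℕ) : Uw := (dcState n).1

/-- The dual canonical basis element with index `(n+1,0,0,n)`. -/
def dcX (n : ℕ) : Uw := (dcState n).2.1

theorem dcS_zero : dcS 0 = 1 := rfl
theorem dcX_zero : dcX 0 = u 3 := rfl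
theorem dcS_one : dcS 1 = u 3 * u 0 - q ^ 2 • (u 2 * u 1) := rfl
theorem dcX_succ (n : ℕ) : dcX (n + 1)
    = q ^ (n + 1) • (u 3 * dcS (n + 1)) - q ^ (5 * n + 3) • (p₁ * u 2 * dcS n) := rfl
theorem dcS_succ_succ (n : ℕ) : dcS (n + 2)
    = q ^ (n + 1) • (dcX (n + 1) * u 0) - q ^ (5 * n + 4) • (dcX n * u 1 * p₀) := rfl

theorem p₁_eq : p₁ = pElt q u 3 2 1 := by rw [p₁, pElt, pow_two (u 2)]
theorem p₀_eq : p₀ = pElt q u 2 1 0 := by rw [p₀, pElt, pow_two (u 1)]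

/-- Induction along the recursion of the elements `dcS` and `dcX`. -/
theorem dc_induction {P : ℕ → Uw → Prop} {Q : ℕ → Uw → Prop} (hS0 : P 0 (dcS 0))
    (hX0 : Q 0 (dcX 0)) (hS1 : P 1 (dcS 1))
    (hX : ∀ n, P n (dcS n) → P (n + 1) (dcS (n + 1)) → Q (n + 1) (dcX (n + 1)))
    (hS : ∀ n, Q n (dcX n) → Q (n + 1) (dcX (n + 1)) → P (n + 2) (dcS (n + 2))) (n : ℕ) :
    P n (dcS n) ∧ Q n (dcX n) := by
  have key : ∀ n, P n (dcS n) ∧ Q n (dcX n) ∧ P (n + 1) (dcS (n + 1)) := by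
    intro n
    induction n with
    | zero => exact ⟨hS0, hX0, hS1⟩
    | succ n ih =>
      obtain ⟨h1, h2, h3⟩ := ih
      have h4 := hX n h1 h3
      exact ⟨h3, h4, hS n h2 h4⟩
  exact ⟨(key n).1, (key n).2.1⟩

/-- The dual PBW basis element with given exponents. -/
def monE (d c b a : ℕ) : Uw := dualPBW ![a, b, c, d]

theorem monE_eq (d c b a : ℕ) : monE d c b a
    = q ^ (d.choose 2 + c.choose 2 + b.choose 2 + a.choose 2) • mon u d c b a := by
  rw [monE, dualPBW, Fin.sum_univ_four]
  congr 2
  simp only [Matrix.cons_val]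
  ring

theorem choose_two_succ (n : ℕ) : (n + 1).choose 2 = n.choose 2 + n := by
  rw [Nat.choose_succ_succ' n 1, Nat.choose_one_right, add_comm]

theorem u3_mul_monE (d c b a : ℕ) : u 3 * monE d c b a = q ^ (-(d : ℤ)) • monE (d + 1) c b a := by
  rw [monE_eq, monE_eq, mul_smul_comm, u3_mul_mon, smul_smul, choose_two_succ]
  congr 1
  simp only [← zpow_natCast, ← zpow_add₀ q_ne_zero]
  congr 1
  push_cast
  ring

theorem monE_mul_u0 (d c b a : ℕ) : monE d c b a * u 0 = q ^ (-(a : ℤ)) • monE d c b (a + 1) := by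
  rw [monE_eq, monE_eq, smul_mul_assoc, mon, mul_assoc, ← pow_succ, smul_smul, choose_two_succ, mon]
  congr 1
  simp only [← zpow_natCast, ← zpow_add₀ q_ne_zero]
  congr 1
  push_cast
  ring

theorem p1_u2_mul_mon (d c b a : ℕ) : p₁ * u 2 * mon u d c b a
    = q ^ (-(4 * d + 2 * c + 2 : ℤ)) • mon u (d + 1) (c + 1) (b + 1) a
      - q ^ (-(4 * d - 2 : ℤ)) • mon u d (c + 3) b a := by
  have h := straight_u
  have e1 := mul_pow_of_comm h.r23 d
  have e2 := mul_pow_of_comm (h.p1_u3 q_ne_zero) d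
  have e3 := (show Commute (pElt q u 3 2 1) (u 2) from h.p1_u2 q_ne_zero).pow_right (c + 1)
  have e4 := pow_comm_of_comm h.r23 (c + 1)
  have e5 : p₁ * u 2 * mon u d c b a = ((q ^ 2)⁻¹ ^ d * (q ^ 2)⁻¹ ^ d) •
      (u 3 ^ d * (u 2 ^ (c + 1) * (u 3 * u 1 - q ^ 2 • (u 2 * u 2))) * u 1 ^ b * u 0 ^ a) := by
    rw [← pElt, ← e3.eq, p₁_eq]
    simp only [mon, mul_assoc, mul_mul_of_mul e1, smul_mul_assoc, mul_smul_comm, smul_smul,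
      mul_mul_of_mul e2, pow_succ']
  have e6 : u 2 ^ (c + 1) * (u 3 * u 1 - q ^ 2 • (u 2 * u 2))
      = (q ^ 2)⁻¹ ^ (c + 1) • (u 3 * u 2 ^ (c + 1) * u 1) - q ^ 2 • u 2 ^ (c + 3) := by
    rw [mul_sub, ← mul_assoc, e4, smul_mul_assoc, mul_smul_comm, ← pow_two, ← pow_add]
  have e7 : u 3 ^ d * (u 3 * u 2 ^ (c + 1) * u 1) * u 1 ^ b * u 0 ^ a
      = mon u (d + 1) (c + 1) (b + 1) a := by
    rw [mon, pow_succ (u 3), pow_succ' (u 1)]; simp only [mul_assoc]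
  rw [e5, e6, mul_sub, sub_mul, sub_mul, mul_smul_comm, smul_mul_assoc, smul_mul_assoc, e7,
    mul_smul_comm, smul_mul_assoc, smul_mul_assoc, smul_sub, smul_smul, smul_smul, ← mon]
  congr 2
  · simp only [← zpow_natCast, inv_zpow', ← zpow_mul, ← zpow_neg, ← zpow_add₀ q_ne_zero]
    congr 1; push_cast; ring
  · simp only [← zpow_natCast, inv_zpow', ← zpow_mul, ← zpow_neg, ← zpow_add₀ q_ne_zero]
    congr 1; push_cast; ring

theorem mon_mul_u1_p0 (d c b a : ℕ) : mon u d c b a * u 1 * p₀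
    = q ^ (-(4 * a + 2 * b + 2 : ℤ)) • mon u d (c + 1) (b + 1) (a + 1)
      - q ^ (-(4 * a - 2 : ℤ)) • mon u d c (b + 3) a := by
  have h := straight_u
  have e1 := pow_comm_of_comm h.r01 a
  have e2 := pow_comm_of_comm (comm_symm (pow_ne_zero 2 q_ne_zero) (h.p0_u0 q_ne_zero)) a
  have e4 := pow_comm_of_comm h.r12 (b + 1)
  have e5 : mon u d c b a * u 1 * p₀ = ((q ^ 2)⁻¹ ^ a * (q ^ 2)⁻¹ ^ a) •
      (u 3 ^ d * u 2 ^ c * (u 1 ^ (b + 1) * (u 2 * u 0 - q ^ 2 • (u 1 * u 1))) * u 0 ^ a) := by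
    rw [← pElt, p₀_eq]
    simp only [mon, mul_assoc, mul_mul_of_mul e1, smul_mul_assoc, mul_smul_comm, smul_smul,
      e2, pow_succ]
  have e6 : u 1 ^ (b + 1) * (u 2 * u 0 - q ^ 2 • (u 1 * u 1))
      = (q ^ 2)⁻¹ ^ (b + 1) • (u 2 * u 1 ^ (b + 1) * u 0) - q ^ 2 • u 1 ^ (b + 3) := by
    rw [mul_sub, ← mul_assoc, e4, smul_mul_assoc, mul_smul_comm, ← pow_two, ← pow_add]
  have e7 : u 3 ^ d * u 2 ^ c * (u 2 * u 1 ^ (b + 1) * u 0) * u 0 ^ a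
      = mon u d (c + 1) (b + 1) (a + 1) := by
    rw [mon, pow_succ (u 2), pow_succ' (u 0)]; simp only [mul_assoc]
  rw [e5, e6, mul_sub, sub_mul, mul_smul_comm, smul_mul_assoc, e7,
    mul_smul_comm, smul_mul_assoc, smul_sub, smul_smul, smul_smul, ← mon]
  congr 2
  · simp only [← zpow_natCast, inv_zpow', ← zpow_mul, ← zpow_neg, ← zpow_add₀ q_ne_zero]
    congr 1; push_cast; ring
  · simp only [← zpow_natCast, inv_zpow', ← zpow_mul, ← zpow_neg, ← zpow_add₀ q_ne_zero]
    congr 1; push_cast; ring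

theorem p1_u2_mul_monE (d c b a : ℕ) : p₁ * u 2 * monE d c b a
    = q ^ (-(5 * d + 3 * c + b + 2 : ℤ)) • monE (d + 1) (c + 1) (b + 1) a
      - q ^ (-(4 * d + 3 * c + 1 : ℤ)) • monE d (c + 3) b a := by
  rw [monE_eq, monE_eq, monE_eq, mul_smul_comm, p1_u2_mul_mon, smul_sub, smul_smul, smul_smul,
    smul_smul, smul_smul]
  simp only [choose_two_succ]
  congr 2
  · simp only [← zpow_natCast, ← zpow_add₀ q_ne_zero]
    congr 1; push_cast; ring
  · simp only [← zpow_natCast, ← zpow_add₀ q_ne_zero]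
    congr 1; push_cast; ring

theorem monE_mul_u1_p0 (d c b a : ℕ) : monE d c b a * u 1 * p₀
    = q ^ (-(5 * a + 3 * b + c + 2 : ℤ)) • monE d (c + 1) (b + 1) (a + 1)
      - q ^ (-(4 * a + 3 * b + 1 : ℤ)) • monE d c (b + 3) a := by
  rw [monE_eq, monE_eq, monE_eq, smul_mul_assoc, smul_mul_assoc, mon_mul_u1_p0, smul_sub, smul_smul,
    smul_smul, smul_smul, smul_smul]
  simp only [choose_two_succ]
  congr 2
  · simp only [← zpow_natCast, ← zpow_add₀ q_ne_zero]
    congr 1; push_cast; ring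
  · simp only [← zpow_natCast, ← zpow_add₀ q_ne_zero]
    congr 1; push_cast; ring

/-- The cone of the index `(N,0,0,M)`. -/
def corner (N M : ℕ) : AddSubgroup Uw :=
  AddSubgroup.closure {x | ∃ e s r d c b a : ℕ, 1 ≤ e ∧ 1 ≤ s ∧ d + s = N ∧ c + r = 2 * s ∧
    b + s = 2 * r ∧ a + r = M ∧ x = q ^ e • monE d c b a}

theorem corner_le_cone (N M : ℕ) : corner N M ≤ cone ![M, 0, 0, N] := by
  refine AddSubgroup.closure_mono ?_
  rintro x ⟨e, s, r, d, c, b, a, he, hs, h3, h2, h1, h0, rfl⟩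
  refine ⟨e - 1, ![a, b, c, d], ⟨s, r, ?_, ?_, ?_, ?_⟩, ?_, ?_⟩
  · simp; omega
  · simp; omega
  · simp; omega
  · simp; omega
  · intro h
    have := congrFun h 3
    simp at this
    omega
  · rw [Nat.sub_add_cancel he]; rfl

theorem mem_corner {N M d c b a : ℕ} (e : ℤ) (s r : ℕ) (he : 1 ≤ e) (hs : 1 ≤ s) (h3 : d + s = N)
    (h2 : c + r = 2 * s) (h1 : b + s = 2 * r) (h0 : a + r = M) :
    q ^ e • monE d c b a ∈ corner N M := by
  obtain ⟨e, rfl⟩ := Int.eq_ofNat_of_zero_le (show 0 ≤ e by omega)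
  exact AddSubgroup.subset_closure ⟨e, s, r, d, c, b, a, by omega, hs, h3, h2, h1, h0, by
    simp⟩

/-- A map that sends the leading term and the cone of one corner to another cone. -/
theorem corner_map {N M : ℕ} {D : AddSubgroup Uw} (T : Uw →+ Uw)
    (hT : ∀ e s r d c b a : ℕ, 1 ≤ e → 1 ≤ s → d + s = N → c + r = 2 * s → b + s = 2 * r →
      a + r = M → T (q ^ e • monE d c b a) ∈ D) {x : Uw} (hx : x ∈ corner N M) : T x ∈ D := by
  have : corner N M ≤ D.comap T := by
    rw [corner, AddSubgroup.closure_le]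
    rintro x ⟨e, s, r, d, c, b, a, he, hs, h3, h2, h1, h0, rfl⟩
    exact hT e s r d c b a he hs h3 h2 h1 h0
  exact this hx

/-- Only the normalized product in the recursion reaches the corner `s = 0`. Everything else has `s
≥ 1`, and what must be checked is that its power of `q` stays positive. -/
theorem dc_leading (n : ℕ) : dcS n - monE n 0 0 n ∈ corner n n ∧
    dcX n - monE (n + 1) 0 0 n ∈ corner (n + 1) n := by
  refine dc_induction (P := fun n x => x - monE n 0 0 n ∈ corner n n)
    (Q := fun n x => x - monE (n + 1) 0 0 n ∈ corner (n + 1) n) ?_ ?_ ?_ ?_ ?_ n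
  · simp [dcS_zero, monE_eq, mon]
  · simp [dcX_zero, monE_eq, mon]
  · have e : dcS 1 - monE 1 0 0 1 = -(q ^ (2 : ℤ) • monE 0 1 1 0) := by
      simp [dcS_one, monE_eq, mon]
    rw [e]
    exact neg_mem (mem_corner 2 1 1 (by norm_num) le_rfl rfl rfl rfl rfl)
  · intro n h0 h1
    -- With `d = n - s`, `c = 2 s - r`, `b = 2 r - s` the two exponents of `q` are `e + r + 1` and
    -- `e + d + b + r + 2`, so even the leading term of `dcS n` (`e = s = r = 0`) lands in the cone.
    have low : ∀ e s r d c b a : ℕ, d + s = n → c + r = 2 * s → b + s = 2 * r → a + r = n →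
        q ^ (5 * n + 3) • (p₁ * u 2 * (q ^ e • monE d c b a)) ∈ corner (n + 2) (n + 1) := by
      intro e s r d c b a h3 h2 h1 h0
      rw [mul_smul_comm, p1_u2_mul_monE, smul_sub, smul_sub]
      simp only [smul_smul, ← zpow_natCast, ← zpow_add₀ q_ne_zero]
      refine sub_mem (mem_corner _ (s + 1) (r + 1) ?_ (by omega) (by omega) (by omega) (by omega)
        (by omega)) (mem_corner _ (s + 2) (r + 1) ?_ (by omega) (by omega) (by omega) (by omega)
        (by omega)) <;> push_cast <;> omega
    have a1 : q ^ (n + 1) • (u 3 * (dcS (n + 1) - monE (n + 1) 0 0 (n + 1)))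
        ∈ corner (n + 2) (n + 1) := by
      refine corner_map (((DistribSMul.toAddMonoidHom Uw (q ^ (n + 1))).comp
        (AddMonoidHom.mulLeft (u 3)))) ?_ h1
      intro e s r d c b a he hs h3 h2 h1 h0
      change q ^ (n + 1) • (u 3 * (q ^ e • monE d c b a)) ∈ _
      rw [mul_smul_comm, u3_mul_monE]
      simp only [smul_smul, ← zpow_natCast, ← zpow_add₀ q_ne_zero]
      refine mem_corner _ s r ?_ hs (by omega) h2 h1 h0
      push_cast; omega
    have a2 : q ^ (5 * n + 3) • (p₁ * u 2 * (dcS n - monE n 0 0 n)) ∈ corner (n + 2) (n + 1) := by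
      refine corner_map (((DistribSMul.toAddMonoidHom Uw (q ^ (5 * n + 3))).comp
        (AddMonoidHom.mulLeft (p₁ * u 2)))) ?_ h0
      intro e s r d c b a he hs h3 h2 h1 h0
      exact low e s r d c b a h3 h2 h1 h0
    have a3 := low 0 0 0 n 0 0 n rfl rfl rfl rfl
    have a4 : q ^ (n + 1) • (u 3 * monE (n + 1) 0 0 (n + 1)) = monE (n + 2) 0 0 (n + 1) := by
      rw [u3_mul_monE, smul_smul, ← zpow_natCast, ← zpow_add₀ q_ne_zero]
      simp
    have e : dcX (n + 1) - monE (n + 2) 0 0 (n + 1)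
        = q ^ (n + 1) • (u 3 * (dcS (n + 1) - monE (n + 1) 0 0 (n + 1)))
          - q ^ (5 * n + 3) • (p₁ * u 2 * (dcS n - monE n 0 0 n))
          - q ^ (5 * n + 3) • (p₁ * u 2 * (q ^ 0 • monE n 0 0 n)) := by
      rw [dcX_succ, mul_sub, smul_sub, a4, mul_sub, smul_sub, pow_zero, one_smul]
      abel
    rw [e]
    exact sub_mem (sub_mem a1 a2) a3
  · intro n h0 h1
    -- Now the two exponents are `e + s + 2` and `e + a + c + s + 3`.
    have low : ∀ e s r d c b a : ℕ, d + s = n + 1 → c + r = 2 * s → b + s = 2 * r → a + r = n →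
        q ^ (5 * n + 4) • ((q ^ e • monE d c b a) * u 1 * p₀) ∈ corner (n + 2) (n + 2) := by
      intro e s r d c b a h3 h2 h1 h0
      rw [smul_mul_assoc, smul_mul_assoc, monE_mul_u1_p0, smul_sub, smul_sub]
      simp only [smul_smul, ← zpow_natCast, ← zpow_add₀ q_ne_zero]
      refine sub_mem (mem_corner _ (s + 1) (r + 1) ?_ (by omega) (by omega) (by omega) (by omega)
        (by omega)) (mem_corner _ (s + 1) (r + 2) ?_ (by omega) (by omega) (by omega) (by omega)
        (by omega)) <;> push_cast <;> omega
    have a1 : q ^ (n + 1) • ((dcX (n + 1) - monE (n + 2) 0 0 (n + 1)) * u 0)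
        ∈ corner (n + 2) (n + 2) := by
      refine corner_map (((DistribSMul.toAddMonoidHom Uw (q ^ (n + 1))).comp
        (AddMonoidHom.mulRight (u 0)))) ?_ h1
      intro e s r d c b a he hs h3 h2 h1 h0
      change q ^ (n + 1) • ((q ^ e • monE d c b a) * u 0) ∈ _
      rw [smul_mul_assoc, monE_mul_u0]
      simp only [smul_smul, ← zpow_natCast, ← zpow_add₀ q_ne_zero]
      refine mem_corner _ s r ?_ hs h3 h2 h1 (by omega)
      push_cast; omega
    have a2 : q ^ (5 * n + 4) • ((dcX n - monE (n + 1) 0 0 n) * u 1 * p₀)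
        ∈ corner (n + 2) (n + 2) := by
      refine corner_map (((DistribSMul.toAddMonoidHom Uw (q ^ (5 * n + 4))).comp
        ((AddMonoidHom.mulRight p₀).comp (AddMonoidHom.mulRight (u 1))))) ?_ h0
      intro e s r d c b a he hs h3 h2 h1 h0
      exact low e s r d c b a h3 h2 h1 h0
    have a3 := low 0 0 0 (n + 1) 0 0 n rfl rfl rfl rfl
    have a4 : q ^ (n + 1) • (monE (n + 2) 0 0 (n + 1) * u 0) = monE (n + 2) 0 0 (n + 2) := by
      rw [monE_mul_u0, smul_smul, ← zpow_natCast, ← zpow_add₀ q_ne_zero]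
      simp
    have e : dcS (n + 2) - monE (n + 2) 0 0 (n + 2)
        = q ^ (n + 1) • ((dcX (n + 1) - monE (n + 2) 0 0 (n + 1)) * u 0)
          - q ^ (5 * n + 4) • ((dcX n - monE (n + 1) 0 0 n) * u 1 * p₀)
          - q ^ (5 * n + 4) • ((q ^ 0 • monE (n + 1) 0 0 n) * u 1 * p₀) := by
      rw [dcS_succ_succ, sub_mul, smul_sub, a4, sub_mul, sub_mul, smul_sub, pow_zero, one_smul]
      abel
    rw [e]
    exact sub_mem (sub_mem a1 a2) a3

/-! ### Quantum binomial coefficients -/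

theorem qInt_add (a b : ℤ) : qInt (a + b) = q ^ b * qInt a + q ^ (-a) * qInt b := by
  simp only [qInt, mul_div_assoc', ← add_div, mul_sub, ← zpow_add₀ q_ne_zero]
  congr 1
  rw [show -(a + b) = -a + -b by ring, show b + a = a + b by ring, show b + -a = -a + b by ring]
  ring

theorem qInt_add' (a b : ℤ) : qInt (a + b) = q ^ (-b) * qInt a + q ^ a * qInt b := by
  simp only [qInt, mul_div_assoc', ← add_div, mul_sub, ← zpow_add₀ q_ne_zero]
  congr 1
  rw [show -(a + b) = -a + -b by ring, show -b + a = a + -b by ring, show -b + -a = -a + -b by ring]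
  ring

theorem qInt_succ_ne (k : ℕ) : qInt ((k : ℤ) + 1) ≠ 0 := by
  rw [qInt]
  refine div_ne_zero ?_ generic_q.sub_inv_ne
  intro h
  refine q_pow_ne_one (n := 2 * (k + 1)) (by omega) ?_
  have h1 : q ^ ((k : ℤ) + 1) = q ^ (-((k : ℤ) + 1)) := sub_eq_zero.mp h
  have h2 : q ^ ((k : ℤ) + 1) * q ^ ((k : ℤ) + 1) = 1 := by
    nth_rewrite 2 [h1]
    rw [← zpow_add₀ q_ne_zero]; simp
  rw [← zpow_add₀ q_ne_zero] at h2
  rw [← h2, ← zpow_natCast]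
  congr 1; push_cast; ring

theorem qFact_ne_zero (k : ℕ) : qFact k ≠ 0 :=
  Finset.prod_ne_zero_iff.mpr fun i _ => qInt_succ_ne i

theorem qFact_succ (k : ℕ) : qFact (k + 1) = qFact k * qInt ((k : ℤ) + 1) :=
  Finset.prod_range_succ _ _

theorem qBinom_zero_right (m : ℤ) : qBinom m 0 = 1 := by simp [qBinom, qFact]

theorem qBinom_mul (m : ℤ) (k : ℕ) :
    qBinom m (k + 1) * qInt ((k : ℤ) + 1) = qBinom m k * qInt (m - k) := by
  have h1 := qFact_ne_zero k
  have h2 := qInt_succ_ne k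
  rw [qBinom, qBinom, qFact_succ, Finset.prod_range_succ]
  field_simp

theorem qBinom_succ_mul (m : ℤ) (k : ℕ) :
    qBinom (m + 1) (k + 1) * qInt ((k : ℤ) + 1) = qBinom m k * qInt (m + 1) := by
  have h1 := qFact_ne_zero k
  have h2 := qInt_succ_ne k
  rw [qBinom, qBinom, qFact_succ, Finset.prod_range_succ']
  have : ∀ i : ℕ, m + 1 - ((i + 1 : ℕ) : ℤ) = m - i := fun i => by push_cast; ring
  simp only [this, Nat.cast_zero, sub_zero]
  field_simp

theorem qBinom_pascal (m : ℤ) (k : ℕ) : qBinom (m + 1) (k + 1)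
    = q ^ ((k : ℤ) + 1) * qBinom m (k + 1) + q ^ (-(m - k)) * qBinom m k := by
  refine mul_right_cancel₀ (qInt_succ_ne k) ?_
  have h := qInt_add (m - k) (k + 1)
  rw [show m - k + (k + 1) = m + 1 by ring] at h
  rw [qBinom_succ_mul, add_mul, mul_assoc, qBinom_mul, h]
  ring

theorem qBinom_pascal' (m : ℤ) (k : ℕ) : qBinom (m + 1) (k + 1)
    = q ^ (-((k : ℤ) + 1)) * qBinom m (k + 1) + q ^ (m - k) * qBinom m k := by
  refine mul_right_cancel₀ (qInt_succ_ne k) ?_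
  have h := qInt_add' (m - k) (k + 1)
  rw [show m - k + (k + 1) = m + 1 by ring] at h
  rw [qBinom_succ_mul, add_mul, mul_assoc, qBinom_mul, h]
  ring

theorem qBinom_eq_zero {m : ℤ} {k : ℕ} (h0 : 0 ≤ m) (h : m < k) : qBinom m k = 0 := by
  obtain ⟨n, rfl⟩ := Int.eq_ofNat_of_zero_le h0
  rw [qBinom, Finset.prod_eq_zero (i := n) (Finset.mem_range.mpr (by omega)), zero_div]
  simp [qInt]

theorem bar_zpow (m : ℤ) : bar (q ^ m) = q ^ (-m) := by
  rw [map_zpow₀, bar_q, inv_zpow']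

theorem bar_qInt (m : ℤ) : bar (qInt m) = qInt m := by
  rw [qInt, map_div₀, map_sub, map_sub, bar_zpow, bar_zpow, map_inv₀, bar_q, neg_neg, inv_inv,
    ← neg_sub, ← neg_sub q, neg_div_neg_eq]

theorem bar_qBinom (m : ℤ) (k : ℕ) : bar (qBinom m k) = qBinom m k := by
  simp only [qBinom, qFact, map_div₀, map_prod, bar_qInt]

/-! ### The coefficients of the two expansions -/

/-- The coefficients in the expansion of the element with index `(n+1,0,0,n)`. -/
def fCoef (n : ℤ) (k l : ℕ) : K := q ^ f n k l * qBinom (n - k) l * qBinom (n + 1 - l) k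

/-- The coefficients in the expansion of the element with index `(n,0,0,n)`. -/
def gCoef (n : ℤ) (k l : ℕ) : K := q ^ g n k l * qBinom (n - k) l * qBinom (n - l) k

theorem fCoef_zero (n : ℤ) (l : ℕ) : fCoef n 0 l = q ^ n * gCoef n 0 l := by
  simp only [fCoef, gCoef, qBinom_zero_right, mul_one, ← mul_assoc, ← zpow_add₀ q_ne_zero]
  congr 2; simp only [f, g]; push_cast; ring

theorem fCoef_succ_zero (n : ℤ) (k : ℕ) : fCoef n (k + 1) 0
    = q ^ (n + 2 * k + 2) * gCoef n (k + 1) 0 + q ^ (n + 2 * k + 2) * gCoef n k 0 := by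
  have h := qBinom_pascal n k
  simp only [fCoef, gCoef, qBinom_zero_right, mul_one, Nat.cast_zero, sub_zero, h, mul_add,
    ← mul_assoc, ← zpow_add₀ q_ne_zero]
  congr 2
  · congr 1; simp only [f, g]; push_cast; ring
  · congr 1; simp only [f, g]; push_cast; ring

/-- The Pascal rule for the second binomial produces the first two terms, except that the middle one
carries the upper index `n - 1 - k` where `gCoef n k (l + 1)` has `n - k`. The other Pascal rule,
applied to that binomial, shows that the excess is the last term. -/
theorem fCoef_succ_succ (n : ℤ) (k l : ℕ) : fCoef n (k + 1) (l + 1)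
    = q ^ (n + 2 * k + 2) * gCoef n (k + 1) (l + 1) + q ^ (n + 2 * k + 2) * gCoef n k (l + 1)
      - q ^ (5 * n - 2) * gCoef (n - 1) k l := by
  have e1 : n + 1 - ((l + 1 : ℕ) : ℤ) = (n - 1 - l) + 1 := by push_cast; ring
  have e2 : n - (k : ℤ) = (n - 1 - k) + 1 := by ring
  have e3 : n - ((k + 1 : ℕ) : ℤ) = n - 1 - k := by push_cast; ring
  have e4 : n - ((l + 1 : ℕ) : ℤ) = n - 1 - l := by push_cast; ring
  simp only [fCoef, gCoef, e1, e3, e4]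
  rw [e2, qBinom_pascal (n - 1 - l) k, qBinom_pascal' (n - 1 - k) l]
  have h1 : q ^ f n (k + 1 : ℕ) (l + 1 : ℕ) * q ^ ((k : ℤ) + 1)
      = q ^ (n + 2 * k + 2) * q ^ g n (k + 1 : ℕ) (l + 1 : ℕ) := by
    simp only [← zpow_add₀ q_ne_zero]; congr 1; simp only [f, g]; push_cast; ring
  have h2 : q ^ f n (k + 1 : ℕ) (l + 1 : ℕ) * q ^ (-(n - 1 - (l : ℤ) - k))
      = q ^ (n + 2 * k + 2) * q ^ g n k (l + 1 : ℕ) * q ^ (-((l : ℤ) + 1)) := by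
    simp only [← zpow_add₀ q_ne_zero]; congr 1; simp only [f, g]; push_cast; ring
  have h3 : q ^ (n + 2 * k + 2) * q ^ g n k (l + 1 : ℕ) * q ^ (n - 1 - (k : ℤ) - l)
      = q ^ (5 * n - 2) * q ^ g (n - 1) k l := by
    simp only [← zpow_add₀ q_ne_zero]; congr 1; simp only [g]; push_cast; ring
  generalize q ^ f n (k + 1 : ℕ) (l + 1 : ℕ) = F at *
  generalize q ^ g n (k + 1 : ℕ) (l + 1 : ℕ) = G at *
  generalize q ^ g n k (l + 1 : ℕ) = G' at *
  generalize q ^ g (n - 1) k l = G'' at *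
  generalize q ^ (n + 2 * (k : ℤ) + 2) = a at *
  generalize q ^ (5 * n - 2) = b at *
  generalize q ^ (n - 1 - (k : ℤ) - l) = c at *
  generalize q ^ (-((l : ℤ) + 1)) = d at *
  generalize q ^ (-(n - 1 - (l : ℤ) - k)) = d' at *
  generalize q ^ ((k : ℤ) + 1) = d'' at *
  linear_combination (qBinom (n - 1 - k) (l + 1) * qBinom (n - 1 - l) (k + 1)) * h1
    + (qBinom (n - 1 - k) (l + 1) * qBinom (n - 1 - l) k) * h2
    - (qBinom (n - 1 - k) l * qBinom (n - 1 - l) k) * h3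

theorem gCoef_zero (n : ℤ) (k : ℕ) :
    gCoef n k 0 = q ^ (n - 3) * fCoef (n - 1) k 0 := by
  simp only [fCoef, gCoef, qBinom_zero_right, mul_one, ← mul_assoc, ← zpow_add₀ q_ne_zero]
  congr 1
  · congr 1; simp only [f, g]; push_cast; ring
  · congr 1; push_cast; ring

theorem gCoef_zero_succ (n : ℤ) (l : ℕ) : gCoef n 0 (l + 1)
    = q ^ (n + 2 * l - 1) * fCoef (n - 1) 0 (l + 1) + q ^ (n + 2 * l - 1) * fCoef (n - 1) 0 l := by
  have h := qBinom_pascal (n - 1) l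
  rw [sub_add_cancel] at h
  simp only [fCoef, gCoef, qBinom_zero_right, mul_one, Nat.cast_zero, sub_zero, h, mul_add,
    ← mul_assoc, ← zpow_add₀ q_ne_zero]
  congr 2
  · congr 1; simp only [f, g]; push_cast; ring
  · congr 1; simp only [f, g]; push_cast; ring

theorem gCoef_succ_succ (n : ℤ) (k l : ℕ) : gCoef n (k + 1) (l + 1)
    = q ^ (n + 2 * l - 1) * fCoef (n - 1) (k + 1) (l + 1)
      + q ^ (n + 2 * l - 1) * fCoef (n - 1) (k + 1) l
      - q ^ (5 * n - 6) * fCoef (n - 2) k l := by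
  have e1 : n - ((k + 1 : ℕ) : ℤ) = (n - 2 - k) + 1 := by push_cast; ring
  have e2 : n - 1 + 1 - (l : ℤ) = (n - 1 - l) + 1 := by ring
  have e3 : n - 1 - ((k + 1 : ℕ) : ℤ) = n - 2 - k := by push_cast; ring
  have e4 : n - ((l + 1 : ℕ) : ℤ) = n - 1 - l := by push_cast; ring
  have e5 : n - 1 + 1 - ((l + 1 : ℕ) : ℤ) = n - 1 - l := by push_cast; ring
  have e6 : n - 2 + 1 - (l : ℤ) = n - 1 - l := by ring
  simp only [fCoef, gCoef, e1, e2, e3, e4, e5, e6]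
  rw [qBinom_pascal (n - 2 - k) l, qBinom_pascal' (n - 1 - l) k]
  have h1 : q ^ g n (k + 1 : ℕ) (l + 1 : ℕ) * q ^ ((l : ℤ) + 1)
      = q ^ (n + 2 * l - 1) * q ^ f (n - 1) (k + 1 : ℕ) (l + 1 : ℕ) := by
    simp only [← zpow_add₀ q_ne_zero]; congr 1; simp only [f, g]; push_cast; ring
  have h2 : q ^ g n (k + 1 : ℕ) (l + 1 : ℕ) * q ^ (-(n - 2 - (k : ℤ) - l))
      = q ^ (n + 2 * l - 1) * q ^ f (n - 1) (k + 1 : ℕ) l * q ^ (-((k : ℤ) + 1)) := by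
    simp only [← zpow_add₀ q_ne_zero]; congr 1; simp only [f, g]; push_cast; ring
  have h3 : q ^ (n + 2 * l - 1) * q ^ f (n - 1) (k + 1 : ℕ) l * q ^ (n - 1 - (l : ℤ) - k)
      = q ^ (5 * n - 6) * q ^ f (n - 2) k l := by
    simp only [← zpow_add₀ q_ne_zero]; congr 1; simp only [f]; push_cast; ring
  generalize q ^ g n (k + 1 : ℕ) (l + 1 : ℕ) = F at *
  generalize q ^ f (n - 1) (k + 1 : ℕ) (l + 1 : ℕ) = G at *
  generalize q ^ f (n - 1) (k + 1 : ℕ) l = G' at *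
  generalize q ^ f (n - 2) k l = G'' at *
  generalize q ^ (n + 2 * (l : ℤ) - 1) = a at *
  generalize q ^ (5 * n - 6) = b at *
  generalize q ^ (n - 1 - (l : ℤ) - k) = c at *
  generalize q ^ (-((k : ℤ) + 1)) = d at *
  generalize q ^ (-(n - 2 - (k : ℤ) - l)) = d' at *
  generalize q ^ ((l : ℤ) + 1) = d'' at *
  linear_combination (qBinom (n - 2 - k) (l + 1) * qBinom (n - 1 - l) (k + 1)) * h1
    + (qBinom (n - 2 - k) l * qBinom (n - 1 - l) (k + 1)) * h2
    - (qBinom (n - 2 - k) l * qBinom (n - 1 - l) k) * h3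

/-- A recursion for the coefficients of a double sum. -/
theorem sum_rectangle {k V : Type*} [Ring k] [AddCommGroup V] [Module k V] {m n : ℕ}
    (N : ℕ → ℕ → V) {a b c t : ℕ → ℕ → k} (ha : ∀ l < n + 1, a m l = 0)
    (h0 : ∀ l < n + 1, t 0 l = a 0 l) (h1 : ∀ i < m, t (i + 1) 0 = a (i + 1) 0 + b i 0)
    (h2 : ∀ i < m, ∀ l < n, t (i + 1) (l + 1) = a (i + 1) (l + 1) + b i (l + 1) - c i l) :
    ∑ i ∈ Finset.range m, ∑ l ∈ Finset.range (n + 1), a i l • N i l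
      + ∑ i ∈ Finset.range m, ∑ l ∈ Finset.range (n + 1), b i l • N (i + 1) l
      - ∑ i ∈ Finset.range m, ∑ l ∈ Finset.range n, c i l • N (i + 1) (l + 1)
    = ∑ i ∈ Finset.range (m + 1), ∑ l ∈ Finset.range (n + 1), t i l • N i l := by
  have e : ∑ i ∈ Finset.range m, ∑ l ∈ Finset.range (n + 1), a i l • N i l
      = ∑ i ∈ Finset.range (m + 1), ∑ l ∈ Finset.range (n + 1), a i l • N i l := by
    rw [Finset.sum_range_succ, Finset.sum_eq_zero (s := Finset.range (n + 1)), add_zero]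
    intro l hl
    rw [ha l (Finset.mem_range.mp hl), zero_smul]
  rw [e, Finset.sum_range_succ', Finset.sum_range_succ' (fun i => ∑ l ∈ _, t i l • N i l),
    add_right_comm, add_sub_right_comm, ← Finset.sum_add_distrib, ← Finset.sum_sub_distrib]
  congr 1
  · refine Finset.sum_congr rfl fun i hi => ?_
    have hi := Finset.mem_range.mp hi
    rw [Finset.sum_range_succ', Finset.sum_range_succ' (fun l => b i l • N (i + 1) l),
      Finset.sum_range_succ' (fun l => t (i + 1) l • N (i + 1) l), h1 i hi, add_smul]
    have e' : ∑ l ∈ Finset.range n, t (i + 1) (l + 1) • N (i + 1) (l + 1)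
        = ∑ l ∈ Finset.range n, (a (i + 1) (l + 1) + b i (l + 1) - c i l) • N (i + 1) (l + 1) :=
      Finset.sum_congr rfl fun l hl => by rw [h2 i hi l (Finset.mem_range.mp hl)]
    rw [e']
    simp only [add_smul, sub_smul, Finset.sum_add_distrib, Finset.sum_sub_distrib]
    abel
  · exact Finset.sum_congr rfl fun l hl => by rw [h0 l (Finset.mem_range.mp hl)]

/-- In the column `k = n + 1` the first binomial has upper index `-1` and does not vanish, so the
second one has to. It does so except at `l = 0`, which accounts for the extra pair in `pairs'`. -/
theorem fCoef_eq_zero {n k l : ℕ} (hk : k ≤ n + 1) (hl : l ≤ n) (h : n < k + l)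
    (h' : ¬(k = n + 1 ∧ l = 0)) : fCoef n k l = 0 := by
  by_cases hkn : k ≤ n
  · rw [fCoef, qBinom_eq_zero (m := (n : ℤ) - k) (by omega) (by omega), mul_zero, zero_mul]
  · rw [fCoef, qBinom_eq_zero (m := (n : ℤ) + 1 - l) (by omega) (by omega), mul_zero]

theorem gCoef_eq_zero {n k l : ℕ} (hl : l ≤ n) (hk : k ≤ n + 1) (h : n < k + l) :
    gCoef n k l = 0 := by
  by_cases hkn : k ≤ n
  · rw [gCoef, qBinom_eq_zero (m := (n : ℤ) - k) (by omega) (by omega), mul_zero, zero_mul]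
  · rw [gCoef, qBinom_eq_zero (m := (n : ℤ) - l) (by omega) (by omega), mul_zero]

theorem fCoef_eq_zero_right {n k : ℕ} (hk : k ≤ n + 1) : fCoef n k (n + 1) = 0 := by
  by_cases hk0 : k = 0
  · rw [fCoef, qBinom_eq_zero (m := (n : ℤ) - k) (by omega) (by push_cast; omega), mul_zero, zero_mul]
  · rw [fCoef, qBinom_eq_zero (m := (n : ℤ) + 1 - ((n + 1 : ℕ) : ℤ)) (by push_cast; omega)
      (by push_cast; omega), mul_zero]

section
variable {k A : Type*} [Field k] [Ring A] [Algebra k A] {q : k} {u : Fin 4 → A}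
  (hq : q ≠ 0) (h : Straight (q ^ 2)⁻¹ u)

namespace Straight
include hq h

theorem u3_qMon_u1 (i c b j : ℕ) : u 3 * qMon q u (i, c, b, j) * u 1
    = (q ^ 2) ^ (i + c) • (qMon q u (i + 1, c, b, j) + q ^ 2 • qMon q u (i, c + 2, b, j)) := by
  have e1 : u 3 * pElt q u 3 2 1 ^ i = (q ^ 2) ^ i • (pElt q u 3 2 1 ^ i * u 3) := by
    refine mul_pow_of_comm ?_ i
    simpa using comm_symm (inv_ne_zero (pow_ne_zero 2 hq)) (h.p1_u3 hq)
  have e2 : u 3 * u 2 ^ c = (q ^ 2) ^ c • (u 2 ^ c * u 3) := by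
    refine mul_pow_of_comm ?_ c
    simpa using comm_symm (inv_ne_zero (pow_ne_zero 2 hq)) h.r23
  have e3 := (show Commute (pElt q u 2 1 0) (u 1) from h.p0_u1 hq).pow_left j
  have e4 : u 3 * u 1 = pElt q u 3 2 1 + q ^ 2 • u 2 ^ 2 := by simp [pElt, pow_two]
  have e5 := ((show Commute (pElt q u 3 2 1) (u 2) from h.p1_u2 hq).pow_right c).symm
  have e6 : u 3 * qMon q u (i, c, b, j) * u 1 = (q ^ 2) ^ (i + c) •
      (pElt q u 3 2 1 ^ i * (u 2 ^ c * (u 3 * u 1)) * u 1 ^ b * pElt q u 2 1 0 ^ j) := by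
    simp only [qMon, mul_assoc, e3.eq, mul_mul_of_mul e1, smul_mul_assoc, mul_smul_comm,
      mul_mul_of_mul e2, smul_smul, pow_add (q ^ 2) i c]
    rw [mul_mul_of_mul ((Commute.refl (u 1)).pow_left b).eq, mul_assoc]
  rw [e6, e4, mul_add, e5.eq, mul_add, add_mul, add_mul, mul_smul_comm, mul_smul_comm, smul_mul_assoc,
    smul_mul_assoc, ← pow_add, ← mul_assoc, ← pow_succ]
  rfl

theorem u2_qMon_u0 (i c b j : ℕ) : u 2 * qMon q u (i, c, b, j) * u 0
    = (q ^ 2) ^ (b + j) • (qMon q u (i, c, b, j + 1) + q ^ 2 • qMon q u (i, c, b + 2, j)) := by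
  have e1 := pow_comm_of_comm (h.p0_u0 hq) j
  have e2 : u 1 ^ b * u 0 = (q ^ 2) ^ b • (u 0 * u 1 ^ b) := by
    refine pow_comm_of_comm ?_ b
    simpa using comm_symm (inv_ne_zero (pow_ne_zero 2 hq)) h.r01
  have e3 := ((show Commute (pElt q u 3 2 1) (u 2) from h.p1_u2 hq).pow_left i).symm
  have e4 : u 2 * u 0 = pElt q u 2 1 0 + q ^ 2 • u 1 ^ 2 := by simp [pElt, pow_two]
  have e5 := ((show Commute (pElt q u 2 1 0) (u 1) from h.p0_u1 hq).pow_right b)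
  have e6 : u 2 * qMon q u (i, c, b, j) * u 0 = (q ^ 2) ^ (b + j) •
      (pElt q u 3 2 1 ^ i * u 2 ^ c * ((u 2 * u 0) * u 1 ^ b) * pElt q u 2 1 0 ^ j) := by
    simp only [qMon, mul_assoc, e1, smul_mul_assoc, mul_smul_comm, mul_mul_of_mul e2, smul_smul,
      pow_add (q ^ 2) b j, mul_comm ((q ^ 2) ^ b)]
    rw [mul_mul_of_mul e3.eq, mul_assoc, mul_mul_of_mul ((Commute.refl (u 2)).pow_right c).eq,
      mul_assoc]
  rw [e6, e4, add_mul, e5.eq, mul_add, add_mul, smul_mul_assoc, mul_smul_comm,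
    smul_mul_assoc, ← pow_add, add_comm 2 b, ← mul_assoc, mul_assoc _ (pElt q u 2 1 0), ← pow_succ']
  rfl

theorem p1_u2_qMon_u1 (i c b j : ℕ) :
    pElt q u 3 2 1 * u 2 * (u 2 * qMon q u (i, c, b, j) * u 1) * u 1
      = qMon q u (i + 1, c + 2, b + 2, j) := by
  have e3 := (show Commute (pElt q u 2 1 0) (u 1) from h.p0_u1 hq).pow_left j
  have e5 := ((show Commute (pElt q u 3 2 1) (u 2) from h.p1_u2 hq).pow_left i).symm
  simp only [qMon, mul_assoc, e3.eq, mul_mul_of_mul e3.eq, mul_mul_of_mul e5.eq]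
  rw [pow_succ' _ i, add_comm c 2, pow_add, pow_two]
  simp only [← mul_assoc]
  rw [pow_add (u 1), pow_two (u 1)]
  simp only [← mul_assoc]

theorem u2_qMon_u1_p0 (i c b j : ℕ) :
    u 2 * (u 2 * qMon q u (i, c, b, j) * u 1) * u 1 * pElt q u 2 1 0
      = qMon q u (i, c + 2, b + 2, j + 1) := by
  have e3 := (show Commute (pElt q u 2 1 0) (u 1) from h.p0_u1 hq).pow_left j
  have e5 := ((show Commute (pElt q u 3 2 1) (u 2) from h.p1_u2 hq).pow_left i).symm
  simp only [qMon, mul_assoc, e3.eq, mul_mul_of_mul e3.eq, mul_mul_of_mul e5.eq]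
  rw [pow_succ _ j, add_comm c 2, pow_add, pow_two]
  simp only [← mul_assoc]
  rw [pow_add (u 1), pow_two (u 1)]
  simp only [← mul_assoc]

end Straight
end

/-- The monomials in the expansion of the element with index `(n+1,0,0,n)`. -/
def xMon (n k l : ℕ) : Uw := qMon q u (n + 1 - k, 2 * k, 2 * l, n - l)

/-- The monomials in the expansion of the element with index `(n,0,0,n)`. -/
def sMon (n k l : ℕ) : Uw := qMon q u (n - k, 2 * k, 2 * l, n - l)

theorem xMon_succ (n k l : ℕ) (hk : k ≤ n + 1) : u 3 * sMon (n + 1) k l * u 1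
    = q ^ (2 * (n + 1) + 2 * k : ℤ) • xMon (n + 1) k l
      + q ^ (2 * (n + 1) + 2 * k + 2 : ℤ) • xMon (n + 1) (k + 1) l := by
  rw [sMon, straight_u.u3_qMon_u1 q_ne_zero, smul_add, smul_smul, xMon, xMon,
    show n + 1 - k + 1 = n + 1 + 1 - k by omega, show n + 1 + 1 - (k + 1) = n + 1 - k by omega]
  congr 2
  · rw [← pow_mul, ← zpow_natCast]; congr 1; push_cast [hk]; ring
  · rw [← pow_mul, ← pow_add, ← zpow_natCast]; congr 1; push_cast [hk]; ring

theorem sMon_succ (n k l : ℕ) (hl : l ≤ n) : u 2 * xMon n k l * u 0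
    = q ^ (2 * n + 2 * l : ℤ) • sMon (n + 1) k l
      + q ^ (2 * n + 2 * l + 2 : ℤ) • sMon (n + 1) k (l + 1) := by
  rw [xMon, straight_u.u2_qMon_u0 q_ne_zero, smul_add, smul_smul, sMon, sMon,
    show n - l + 1 = n + 1 - l by omega, show n + 1 - (l + 1) = n - l by omega]
  congr 2
  · rw [← pow_mul, ← zpow_natCast]; congr 1; push_cast [hl]; ring
  · rw [← pow_mul, ← pow_add, ← zpow_natCast]; congr 1; push_cast [hl]; ring

theorem xMon_of_sMon (n k l : ℕ) (hk : k ≤ n) : p₁ * u 2 * (u 2 * sMon n k l * u 1) * u 1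
    = xMon (n + 1) (k + 1) (l + 1) := by
  rw [sMon, p₁_eq, straight_u.p1_u2_qMon_u1 q_ne_zero, xMon,
    show n + 1 + 1 - (k + 1) = n - k + 1 by omega, show n + 1 - (l + 1) = n - l by omega]
  rfl

theorem sMon_of_xMon (n k l : ℕ) (hl : l ≤ n) : u 2 * (u 2 * xMon n k l * u 1) * u 1 * p₀
    = sMon (n + 2) (k + 1) (l + 1) := by
  rw [xMon, p₀_eq, straight_u.u2_qMon_u1_p0 q_ne_zero, sMon,
    show n + 2 - (k + 1) = n + 1 - k by omega, show n + 2 - (l + 1) = n - l + 1 by omega]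
  rfl

/-- The expansion of the elements `dcS` and `dcX` over rectangles. -/
theorem dc_expansion (n : ℕ) :
    u 2 ^ n * dcS n * u 1 ^ n
      = ∑ k ∈ Finset.range (n + 1), ∑ l ∈ Finset.range (n + 1), gCoef n k l • sMon n k l ∧
    u 2 ^ n * dcX n * u 1 ^ (n + 1)
      = ∑ k ∈ Finset.range (n + 2), ∑ l ∈ Finset.range (n + 1), fCoef n k l • xMon n k l := by
  refine dc_induction (P := fun n x => u 2 ^ n * x * u 1 ^ n
      = ∑ k ∈ Finset.range (n + 1), ∑ l ∈ Finset.range (n + 1), gCoef n k l • sMon n k l)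
    (Q := fun n x => u 2 ^ n * x * u 1 ^ (n + 1)
      = ∑ k ∈ Finset.range (n + 2), ∑ l ∈ Finset.range (n + 1), fCoef n k l • xMon n k l)
    ?_ ?_ ?_ ?_ ?_ n
  · simp [dcS_zero, gCoef, g, qBinom_zero_right, sMon, qMon]
  · have h1 : qBinom 1 1 = 1 := by simp [qBinom, qFact, qInt_one]
    simp [dcX_zero, Finset.sum_range_succ, fCoef, f, qBinom_zero_right, xMon, qMon, h1, pElt, pow_two]
  · have h1 : qBinom 1 1 = 1 := by simp [qBinom, qFact, qInt_one]
    have h2 : qBinom 0 1 = 0 := qBinom_eq_zero le_rfl (by norm_num)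
    have e0 : dcX 0 * u 1 = xMon 0 0 0 + q ^ 2 • xMon 0 1 0 := by
      simp [dcX_zero, xMon, qMon, pElt, pow_two]
    have e1 : u 2 * (u 3 * u 0) * u 1 = (q ^ 2)⁻¹ • (u 2 * (dcX 0 * u 1) * u 0) := by
      simp only [dcX_zero, mul_assoc, straight_u.r01, mul_smul_comm]
    have e2 : u 2 * (u 2 * u 1) * u 1 = sMon 1 1 1 := by
      simp [sMon, qMon, pow_two, mul_assoc]
    have g0 : gCoef 1 0 0 = (q ^ 2)⁻¹ := by
      simp [gCoef, g, qBinom_zero_right, zpow_neg]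
    have g1 : gCoef 1 0 1 = 1 := by simp [gCoef, g, qBinom_zero_right, h1]
    have g2 : gCoef 1 1 0 = 1 := by simp [gCoef, g, qBinom_zero_right, h1]
    have g3 : gCoef 1 1 1 = 0 := by simp [gCoef, h2]
    have s0 := sMon_succ 0 0 0 le_rfl
    have s1 := sMon_succ 0 1 0 le_rfl
    simp only [Nat.cast_zero, mul_zero, add_zero, zero_add, zpow_zero, one_smul] at s0 s1
    rw [dcS_one, pow_one, pow_one, mul_sub, sub_mul, e1, e0, mul_smul_comm, smul_mul_assoc, e2, mul_add,
      add_mul, mul_smul_comm, smul_mul_assoc, s0, s1]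
    simp only [Finset.sum_range_succ, Finset.sum_range_zero, zero_add, Nat.cast_one, g0, g1, g2, g3,
      zero_smul, add_zero, one_smul, smul_add, smul_smul]
    have c1 : (q ^ 2)⁻¹ * q ^ 2 = 1 := inv_mul_cancel₀ (pow_ne_zero 2 q_ne_zero)
    have c2 : q ^ (2 : ℤ) = q ^ 2 := by norm_cast
    rw [c2, c1, ← mul_assoc, c1, one_mul, one_smul, one_smul]
    abel
  · intro n h0 h1
    -- The powers of `u 2` pass `u 3` at the cost of a scalar and commute with `p₁`, so both terms
    -- of the recursion are expressed through the expansions already known.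
    have r1 := pow_comm_of_comm straight_u.r23 (n + 1)
    have e1 : u 2 ^ (n + 1) * (u 3 * dcS (n + 1)) * u 1 ^ (n + 1 + 1)
        = (q ^ 2)⁻¹ ^ (n + 1) • (u 3 * (u 2 ^ (n + 1) * dcS (n + 1) * u 1 ^ (n + 1)) * u 1) := by
      rw [← mul_assoc, r1, pow_succ (u 1) (n + 1)]
      simp only [smul_mul_assoc, mul_assoc]
    have r2 := (show Commute p₁ (u 2) by rw [p₁_eq]; exact straight_u.p1_u2 q_ne_zero).pow_right (n + 1)
    have e2 : u 2 ^ (n + 1) * (p₁ * u 2 * dcS n) * u 1 ^ (n + 1 + 1)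
        = p₁ * u 2 * (u 2 * (u 2 ^ n * dcS n * u 1 ^ n) * u 1) * u 1 := by
      rw [mul_assoc p₁, ← mul_assoc (u 2 ^ (n + 1)), ← r2.eq, pow_succ (u 1) (n + 1), pow_succ (u 1) n]
      simp only [mul_assoc]
      rw [← mul_assoc (u 2 ^ (n + 1)), ← pow_succ, pow_succ', pow_succ']
      simp only [mul_assoc]
    have e3 : u 3 * (u 2 ^ (n + 1) * dcS (n + 1) * u 1 ^ (n + 1)) * u 1
        = ∑ k ∈ Finset.range (n + 2), ∑ l ∈ Finset.range (n + 2),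
            (gCoef (n + 1 : ℕ) k l * q ^ (2 * (n + 1) + 2 * k : ℤ)) • xMon (n + 1) k l
          + ∑ k ∈ Finset.range (n + 2), ∑ l ∈ Finset.range (n + 2),
            (gCoef (n + 1 : ℕ) k l * q ^ (2 * (n + 1) + 2 * k + 2 : ℤ)) • xMon (n + 1) (k + 1) l := by
      rw [h1, ← Finset.sum_add_distrib, Finset.mul_sum, Finset.sum_mul]
      refine Finset.sum_congr rfl fun k hk => ?_
      rw [← Finset.sum_add_distrib, Finset.mul_sum, Finset.sum_mul]
      refine Finset.sum_congr rfl fun l hl => ?_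
      rw [mul_smul_comm, smul_mul_assoc, xMon_succ _ _ _ (by have := Finset.mem_range.mp hk; omega),
        smul_add, smul_smul, smul_smul]
    have e4 : p₁ * u 2 * (u 2 * (u 2 ^ n * dcS n * u 1 ^ n) * u 1) * u 1
        = ∑ k ∈ Finset.range (n + 2), ∑ l ∈ Finset.range (n + 1),
            gCoef n k l • xMon (n + 1) (k + 1) (l + 1) := by
      rw [h0, Finset.sum_range_succ _ (n + 1), Finset.sum_eq_zero (s := Finset.range (n + 1))
        (f := fun l => gCoef n (n + 1) l • xMon (n + 1) (n + 1 + 1) (l + 1)), add_zero]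
      · simp only [Finset.mul_sum, Finset.sum_mul]
        refine Finset.sum_congr rfl fun k hk => Finset.sum_congr rfl fun l hl => ?_
        simp only [mul_smul_comm, smul_mul_assoc]
        rw [xMon_of_sMon _ _ _ (by have := Finset.mem_range.mp hk; omega)]
      · intro l hl
        have := Finset.mem_range.mp hl
        rw [gCoef_eq_zero (by omega) le_rfl (by omega), zero_smul]
    rw [dcX_succ, mul_sub, sub_mul, mul_smul_comm, mul_smul_comm, smul_mul_assoc, smul_mul_assoc,
      e1, e2, e3, e4, smul_smul, smul_add]
    simp only [Finset.smul_sum, smul_smul]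
    have hA : ∀ k : ℤ, q ^ (((n + 1 : ℕ) : ℤ) + 2 * k)
        = q ^ (n + 1) * ((q ^ 2)⁻¹ ^ (n + 1) * q ^ (2 * (n + 1) + 2 * k : ℤ)) := by
      intro k
      simp only [← zpow_natCast, inv_zpow', ← zpow_mul, ← zpow_neg, ← zpow_add₀ q_ne_zero]
      congr 1; push_cast; ring
    refine sum_rectangle (xMon (n + 1)) ?_ ?_ ?_ ?_
    · intro l hl
      rw [gCoef_eq_zero (by omega) le_rfl (by omega), zero_mul, mul_zero]
    · intro l hl
      have := hA 0
      rw [mul_zero, add_zero, add_zero] at this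
      rw [fCoef_zero, this, Nat.cast_zero, mul_zero, add_zero]
      ring
    · intro k hk
      have := hA (k + 1)
      rw [fCoef_succ_zero, add_assoc, show 2 * (k : ℤ) + 2 = 2 * (k + 1) by ring, this,
        add_assoc (2 * ((n : ℤ) + 1)), show 2 * (k : ℤ) + 2 = 2 * (k + 1) by ring, Nat.cast_succ k]
      ring
    · intro k hk l hl
      have := hA (k + 1)
      rw [fCoef_succ_succ, add_assoc, show 2 * (k : ℤ) + 2 = 2 * (k + 1) by ring, this,
        add_assoc (2 * ((n : ℤ) + 1)), show 2 * (k : ℤ) + 2 = 2 * (k + 1) by ring, Nat.cast_succ k,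
        show 5 * ((n + 1 : ℕ) : ℤ) - 2 = ((5 * n + 3 : ℕ) : ℤ) by push_cast; ring, zpow_natCast,
        show ((n + 1 : ℕ) : ℤ) - 1 = n by push_cast; ring]
      ring
  · intro n h0 h1
    have r1 := mul_pow_of_comm straight_u.r01 (n + 2)
    have e1 : u 2 ^ (n + 2) * (dcX (n + 1) * u 0) * u 1 ^ (n + 2)
        = (q ^ 2)⁻¹ ^ (n + 2) • (u 2 * (u 2 ^ (n + 1) * dcX (n + 1) * u 1 ^ (n + 1 + 1)) * u 0) := by
      rw [pow_succ' (u 2) (n + 1)]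
      simp only [mul_assoc, r1, mul_smul_comm]
    have r2 := (show Commute p₀ (u 1) by rw [p₀_eq]; exact straight_u.p0_u1 q_ne_zero).pow_right (n + 2)
    have e2 : u 2 ^ (n + 2) * (dcX n * u 1 * p₀) * u 1 ^ (n + 2)
        = u 2 * (u 2 * (u 2 ^ n * dcX n * u 1 ^ (n + 1)) * u 1) * u 1 * p₀ := by
      rw [mul_assoc (u 2 ^ (n + 2)), mul_assoc (dcX n * u 1), r2.eq, pow_succ' (u 2) (n + 1),
        pow_succ' (u 2) n, pow_succ (u 1) (n + 1), pow_succ (u 1) n]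
      simp only [mul_assoc]
      rw [← mul_assoc (u 1) (u 1 ^ n), ← pow_succ', pow_succ, mul_assoc]
    have e3 : u 2 * (u 2 ^ (n + 1) * dcX (n + 1) * u 1 ^ (n + 1 + 1)) * u 0
        = ∑ l ∈ Finset.range (n + 2), ∑ k ∈ Finset.range (n + 3),
            (fCoef (n + 1 : ℕ) k l * q ^ (2 * ((n + 1 : ℕ) : ℤ) + 2 * l : ℤ)) • sMon (n + 2) k l
          + ∑ l ∈ Finset.range (n + 2), ∑ k ∈ Finset.range (n + 3),
            (fCoef (n + 1 : ℕ) k l * q ^ (2 * ((n + 1 : ℕ) : ℤ) + 2 * l + 2 : ℤ))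
              • sMon (n + 2) k (l + 1) := by
      rw [h1, Finset.sum_comm, ← Finset.sum_add_distrib, Finset.mul_sum, Finset.sum_mul]
      refine Finset.sum_congr rfl fun l hl => ?_
      rw [← Finset.sum_add_distrib, Finset.mul_sum, Finset.sum_mul]
      refine Finset.sum_congr rfl fun k hk => ?_
      rw [mul_smul_comm, smul_mul_assoc, sMon_succ _ _ _ (by have := Finset.mem_range.mp hl; omega),
        smul_add, smul_smul, smul_smul]
    have e4 : u 2 * (u 2 * (u 2 ^ n * dcX n * u 1 ^ (n + 1)) * u 1) * u 1 * p₀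
        = ∑ l ∈ Finset.range (n + 2), ∑ k ∈ Finset.range (n + 2),
            fCoef n k l • sMon (n + 2) (k + 1) (l + 1) := by
      rw [h0, Finset.sum_comm, Finset.sum_range_succ _ (n + 1), Finset.sum_eq_zero
        (s := Finset.range (n + 2))
        (f := fun k => fCoef n k (n + 1) • sMon (n + 2) (k + 1) (n + 1 + 1)), add_zero]
      · simp only [Finset.mul_sum, Finset.sum_mul]
        refine Finset.sum_congr rfl fun l hl => Finset.sum_congr rfl fun k hk => ?_
        simp only [mul_smul_comm, smul_mul_assoc]
        rw [sMon_of_xMon _ _ _ (by have := Finset.mem_range.mp hl; omega)]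
      · intro k hk
        have := Finset.mem_range.mp hk
        rw [fCoef_eq_zero_right (by omega), zero_smul]
    rw [dcS_succ_succ, mul_sub, sub_mul, mul_smul_comm, mul_smul_comm, smul_mul_assoc, smul_mul_assoc,
      e1, e2, e3, e4, smul_smul, smul_add, Finset.sum_comm (s := Finset.range (n + 2 + 1))]
    simp only [Finset.smul_sum, smul_smul]
    have hA : ∀ l : ℤ, q ^ (((n + 2 : ℕ) : ℤ) + 2 * l - 1)
        = q ^ (n + 1) * ((q ^ 2)⁻¹ ^ (n + 2) * q ^ (2 * ((n + 1 : ℕ) : ℤ) + 2 * l + 2 : ℤ)) := by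
      intro l
      simp only [← zpow_natCast, inv_zpow', ← zpow_mul, ← zpow_neg, ← zpow_add₀ q_ne_zero]
      congr 1; push_cast; ring
    have hB : q ^ (((n + 2 : ℕ) : ℤ) - 3)
        = q ^ (n + 1) * ((q ^ 2)⁻¹ ^ (n + 2) * q ^ (2 * ((n + 1 : ℕ) : ℤ))) := by
      simp only [← zpow_natCast, inv_zpow', ← zpow_mul, ← zpow_neg, ← zpow_add₀ q_ne_zero]
      congr 1; push_cast; ring
    have en : ((n + 2 : ℕ) : ℤ) - 1 = (n + 1 : ℕ) := by push_cast; ring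
    -- Multiplication by `u 0` shifts `l` where multiplication by `u 3` shifts `k`, so the same
    -- summation lemma is used with the indices transposed.
    refine sum_rectangle (fun l k => sMon (n + 2) k l) ?_ ?_ ?_ ?_
    · intro k hk
      rw [fCoef_eq_zero_right (by omega), zero_mul, mul_zero]
    · intro k hk
      rw [gCoef_zero, hB, en, Nat.cast_zero, mul_zero, add_zero]
      ring
    · intro l hl
      rw [gCoef_zero_succ, hA, en, Nat.cast_succ l, mul_add, mul_one, ← add_assoc]
      ring
    · intro l hl k hk
      rw [gCoef_succ_succ, hA, en, Nat.cast_succ l, mul_add, mul_one, ← add_assoc,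
        show 5 * ((n + 2 : ℕ) : ℤ) - 6 = ((5 * n + 4 : ℕ) : ℤ) by push_cast; ring, zpow_natCast,
        show ((n + 2 : ℕ) : ℤ) - 2 = n by push_cast; ring]
      ring

/-- The expansion of the element with index `(n+1,0,0,n)`. -/
theorem dcX_expansion (n : ℕ) : u 2 ^ n * dcX n * u 1 ^ (n + 1) =
    ∑ p ∈ pairs' n, (q ^ f n p.1 p.2 * qBinom ((n : ℤ) - p.1) p.2 * qBinom ((n : ℤ) + 1 - p.2) p.1) •
      (p₁ ^ (n + 1 - p.1) * u 2 ^ (2 * p.1) * u 1 ^ (2 * p.2) * p₀ ^ (n - p.2)) := by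
  rw [(dc_expansion n).2, ← Finset.sum_product', p₁_eq, p₀_eq]
  symm
  refine Finset.sum_subset ?_ ?_
  · rintro ⟨k, l⟩ h
    simp only [pairs', pairs, Finset.mem_insert, Finset.mem_filter, Finset.mem_product,
      Finset.mem_range, Prod.mk.injEq] at h ⊢
    omega
  · rintro ⟨k, l⟩ h h'
    simp only [pairs', pairs, Finset.mem_insert, Finset.mem_filter, Finset.mem_product,
      Finset.mem_range, Prod.mk.injEq] at h h'
    change fCoef n k l • _ = _
    rw [fCoef_eq_zero (by omega) (by omega) (by omega) (by omega), zero_smul]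

/-- The expansion of the element with index `(n,0,0,n)`. -/
theorem dcS_expansion (n : ℕ) : u 2 ^ n * dcS n * u 1 ^ n =
    ∑ p ∈ pairs n, (q ^ g n p.1 p.2 * qBinom ((n : ℤ) - p.1) p.2 * qBinom ((n : ℤ) - p.2) p.1) •
      (p₁ ^ (n - p.1) * u 2 ^ (2 * p.1) * u 1 ^ (2 * p.2) * p₀ ^ (n - p.2)) := by
  rw [(dc_expansion n).1, ← Finset.sum_product', p₁_eq, p₀_eq]
  symm
  refine Finset.sum_subset ?_ ?_
  · rintro ⟨k, l⟩ h
    simp only [pairs, Finset.mem_filter, Finset.mem_product, Finset.mem_range] at h ⊢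
    omega
  · rintro ⟨k, l⟩ h h'
    simp only [pairs, Finset.mem_filter, Finset.mem_product, Finset.mem_range] at h h'
    change gCoef n k l • _ = _
    rw [gCoef_eq_zero (by omega) (by omega) (by omega), zero_smul]

/-! ### Regularity of the inner generators -/

/-- The coordinate of `T x` at `τ b` is a nonzero multiple of that of `x` at `b`. -/
theorem injective_of_monomial {T : Uw →ₗ[K] Uw} {τ : Expo → Expo} {r : Expo → K}
    (hτ : Function.Injective τ) (hr : ∀ e, r e ≠ 0) (hT : ∀ e, T (uMon e) = r e • uMon (τ e)) :
    Function.Injective T := by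
  classical
  rw [injective_iff_map_eq_zero]
  intro x hx
  have key : ∀ b, pbw.coord (τ b) ∘ₗ T = r b • pbw.coord b := fun b => by
    refine pbw.ext fun e => ?_
    rw [LinearMap.comp_apply, pbw_apply, hT, map_smul, ← pbw_apply, LinearMap.smul_apply,
      Module.Basis.coord_apply, Module.Basis.coord_apply, Module.Basis.repr_self, ← pbw_apply,
      Module.Basis.repr_self, Finsupp.single_apply, Finsupp.single_apply]
    by_cases h : e = b
    · subst h; simp
    · rw [if_neg h, if_neg fun h' => h (hτ h'), smul_zero, smul_zero]
  refine pbw.ext_elem fun b => ?_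
  have h1 := LinearMap.congr_fun (key b) x
  rw [LinearMap.comp_apply, hx, map_zero, LinearMap.smul_apply, Module.Basis.coord_apply] at h1
  rw [map_zero]
  exact (smul_eq_zero.mp h1.symm).resolve_left (hr b)

theorem uMon_add (e : Expo) (i : Fin 4) : uMon (e + Pi.single i 1)
    = mon u (e 3 + (Pi.single i 1 : Expo) 3) (e 2 + (Pi.single i 1 : Expo) 2)
      (e 1 + (Pi.single i 1 : Expo) 1) (e 0 + (Pi.single i 1 : Expo) 0) := rfl

theorem u2_mul_injective : Function.Injective fun x : Uw => u 2 * x := by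
  refine injective_of_monomial (T := LinearMap.mulLeft K (u 2)) (τ := fun e => e + Pi.single 2 1)
    (r := fun e => (q ^ 2)⁻¹ ^ e 3) (add_left_injective _)
    (fun e => pow_ne_zero _ (inv_ne_zero (pow_ne_zero 2 q_ne_zero))) fun e => ?_
  rw [uMon_add]
  exact straight_u.u2_mul_mon _ _ _ _

theorem mul_u1_injective : Function.Injective fun x : Uw => x * u 1 := by
  refine injective_of_monomial (T := LinearMap.mulRight K (u 1)) (τ := fun e => e + Pi.single 1 1)
    (r := fun e => (q ^ 2)⁻¹ ^ e 0) (add_left_injective _)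
    (fun e => pow_ne_zero _ (inv_ne_zero (pow_ne_zero 2 q_ne_zero))) fun e => ?_
  rw [uMon_add]
  change uMon e * u 1 = _
  rw [uMon, mul_assoc, pow_comm_of_comm straight_u.r01, mul_smul_comm, ← mul_assoc,
    mul_assoc _ (u 1 ^ e 1), ← pow_succ]
  rfl

/-- `sig` is bijective, exchanges left and right multiplication, and rescales the generators. -/
theorem mul_u2_injective : Function.Injective fun x : Uw => x * u 2 := by
  intro x y h
  have h1 := congrArg sig h
  simp only [sig_mul, sig_u, smul_mul_assoc] at h1
  have h2 := u2_mul_injective (smul_right_injective Uw (pow_ne_zero _ q_ne_zero) h1)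
  rw [← sig_sig x, h2, sig_sig]

theorem u1_mul_injective : Function.Injective fun x : Uw => u 1 * x := by
  intro x y h
  have h1 := congrArg sig h
  simp only [sig_mul, sig_u, mul_smul_comm] at h1
  have h2 := mul_u1_injective (smul_right_injective Uw (pow_ne_zero _ q_ne_zero) h1)
  rw [← sig_sig x, h2, sig_sig]

theorem pow_mul_injective {A : Type*} [Monoid A] {x : A} (h : Function.Injective fun y => x * y)
    (n : ℕ) : Function.Injective fun y => x ^ n * y := by
  induction n with
  | zero => intro y z h; simpa using h
  | succ n ih =>
    intro y z hyz
    simp only [pow_succ, mul_assoc] at hyz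
    exact h (ih hyz)

theorem mul_pow_injective {A : Type*} [Monoid A] {x : A} (h : Function.Injective fun y => y * x)
    (n : ℕ) : Function.Injective fun y => y * x ^ n := by
  induction n with
  | zero => intro y z h; simpa using h
  | succ n ih =>
    intro y z hyz
    simp only [pow_succ, ← mul_assoc] at hyz
    exact ih (h hyz)

/-! ### Invariance under `σ` -/

theorem sig_p1 : sig p₁ = q ^ (6 : ℤ) • p₁ := by
  have e : u 1 * u 3 = (q ^ 2)⁻¹ • (u 3 * u 1) + ((q ^ 2)⁻¹ - 1) • u 2 ^ 2 := by
    rw [pow_two (u 2)]; exact straight_u.r13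
  rw [p₁, sig_sub, sig_smul, sig_mul, sig_pow, sig_u, sig_u, sig_u, smul_mul_smul_comm, smul_pow, e,
    map_pow, bar_q, smul_sub, smul_add, smul_smul, smul_smul, smul_smul, smul_smul, add_sub_assoc,
    ← sub_smul, sub_eq_add_neg (_ • (u 3 * u 1)), ← neg_smul]
  have h0 := q_ne_zero
  congr 2
  · simp only [Fin.coe_ofNat_eq_mod]; norm_num; field_simp
  · simp only [Fin.coe_ofNat_eq_mod]; norm_num; field_simp; ring

theorem sig_p0 : sig p₀ = q ^ (2 : ℤ) • p₀ := by
  have e : u 0 * u 2 = (q ^ 2)⁻¹ • (u 2 * u 0) + ((q ^ 2)⁻¹ - 1) • u 1 ^ 2 := by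
    rw [pow_two (u 1)]; exact straight_u.r02
  rw [p₀, sig_sub, sig_smul, sig_mul, sig_pow, sig_u, sig_u, sig_u, smul_mul_smul_comm, smul_pow, e,
    map_pow, bar_q, smul_sub, smul_add, smul_smul, smul_smul, smul_smul, smul_smul, add_sub_assoc,
    ← sub_smul, sub_eq_add_neg (_ • (u 2 * u 0)), ← neg_smul]
  have h0 := q_ne_zero
  congr 2
  · simp only [Fin.coe_ofNat_eq_mod]; norm_num; field_simp
  · simp only [Fin.coe_ofNat_eq_mod]; norm_num; field_simp; ring

theorem sig_qMon (i c b j : ℕ) : sig (qMon q u (i, c, b, j))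
    = q ^ (6 * i + 4 * c + 2 * b + 2 * j - 4 * i * j - 2 * j * c - 2 * b * c - 2 * b * i : ℤ) •
      qMon q u (i, c, b, j) := by
  have h := straight_u
  have c1 : p₀ * u 1 = (1 : K) • (u 1 * p₀) := by rw [one_smul, p₀_eq, h.p0_u1 q_ne_zero]
  have c2 : p₀ * u 2 = (q ^ 2)⁻¹ • (u 2 * p₀) := by rw [p₀_eq, h.p0_u2 q_ne_zero]
  have c3 : p₀ * p₁ = (q ^ 4)⁻¹ • (p₁ * p₀) := by rw [p₀_eq, p₁_eq, h.p0_p1 q_ne_zero]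
  have c4 : u 1 * p₁ = (q ^ 2)⁻¹ • (p₁ * u 1) := by
    rw [p₁_eq, h.p1_u1 q_ne_zero, smul_smul, inv_mul_cancel₀ (pow_ne_zero 2 q_ne_zero), one_smul]
  have c5 : u 2 * p₁ = (1 : K) • (p₁ * u 2) := by rw [one_smul, p₁_eq, h.p1_u2 q_ne_zero]
  have d1 := pow_mul_pow_of_comm c1 j b
  have d2 := pow_mul_pow_of_comm c2 j c
  have d3 := pow_mul_pow_of_comm c3 j i
  have d4 := pow_mul_pow_of_comm c4 b i
  have d5 := pow_mul_pow_of_comm c5 c i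
  have d6 := pow_mul_pow_of_comm h.r12 b c
  rw [qMon, ← p₁_eq, ← p₀_eq]
  simp only [sig_mul, sig_pow, sig_p1, sig_p0, sig_u, smul_pow, smul_mul_assoc, mul_smul_comm,
    smul_smul, mul_assoc]
  have e : p₀ ^ j * (u 1 ^ b * (u 2 ^ c * p₁ ^ i))
      = (q ^ 2)⁻¹ ^ (b * i + b * c + j * c) • (q ^ 4)⁻¹ ^ (j * i) •
        (p₁ ^ i * (u 2 ^ c * (u 1 ^ b * p₀ ^ j))) := by
    simp only [d5, one_pow, one_smul, mul_mul_of_mul d4, d6, mul_mul_of_mul d3, mul_mul_of_mul d2, d1,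
      smul_mul_assoc, mul_smul_comm, smul_smul, mul_assoc]
    congr 1
    ring
  rw [e]
  simp only [smul_smul]
  congr 1
  simp only [← zpow_natCast, inv_zpow', ← zpow_mul, ← zpow_neg, ← zpow_add₀ q_ne_zero]
  congr 1; push_cast; simp; ring

theorem qMon_mul_u2_pow (i c b j A : ℕ) : qMon q u (i, c, b, j) * u 2 ^ A
    = q ^ (-(2 * (b + j) * A) : ℤ) • (u 2 ^ A * qMon q u (i, c, b, j)) := by
  rw [mul_pow_of_comm (qMon_mul_u2 straight_u (i, c, b, j))]
  congr 1
  simp only [← zpow_natCast, inv_zpow', ← zpow_mul, ← zpow_neg]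
  congr 1; push_cast; ring

theorem qMon_mul_u1_pow (i c b j B : ℕ) : qMon q u (i, c, b, j) * u 1 ^ B
    = q ^ (2 * (i + c) * B : ℤ) • (u 1 ^ B * qMon q u (i, c, b, j)) := by
  rw [mul_pow_of_comm (qMon_mul_u1 straight_u (i, c, b, j))]
  congr 1
  simp only [← zpow_natCast, ← zpow_mul]
  congr 1

theorem u2_pow_mul_u1_pow (A B : ℕ) :
    u 2 ^ A * u 1 ^ B = q ^ (2 * A * B : ℤ) • (u 1 ^ B * u 2 ^ A) := by
  have h : u 2 * u 1 = q ^ 2 • (u 1 * u 2) := by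
    simpa using comm_symm (inv_ne_zero (pow_ne_zero 2 q_ne_zero)) straight_u.r12
  rw [pow_mul_pow_of_comm h]
  congr 1
  simp only [← zpow_natCast, ← zpow_mul]
  congr 1; push_cast; ring

/-- The exponent by which conjugation and `σ` rescale a monomial. -/
def sigExp (A B : ℤ) (i c b j : ℤ) : ℤ :=
  6 * i + 4 * c + 2 * b + 2 * j - 4 * i * j - 2 * j * c - 2 * b * c - 2 * b * i
    + 2 * (i + c) * B + 2 * (b + j) * A - 2 * A * B - 2 * B - 4 * A

theorem sig_sandwich_qMon (A B i c b j : ℕ) :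
    u 2 ^ A * sig (qMon q u (i, c, b, j)) * u 1 ^ B
      = q ^ (sigExp A B i c b j + 4 * A * B + 2 * B + 4 * A) • (u 1 ^ B * qMon q u (i, c, b, j) * u 2 ^ A) := by
  rw [sig_qMon, mul_smul_comm, smul_mul_assoc, mul_assoc (u 2 ^ A), qMon_mul_u1_pow, mul_smul_comm, ← mul_assoc,
    u2_pow_mul_u1_pow, mul_assoc (u 1 ^ B), qMon_mul_u2_pow, mul_smul_comm, ← mul_assoc, smul_mul_assoc,
    smul_smul, smul_smul, smul_smul]
  congr 1
  simp only [← zpow_add₀ q_ne_zero, sigExp]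
  congr 1; ring

/-- `sig` sends `u₂^A Y u₁^B` to a multiple of `u₁^B σ(Y) u₂^A`. Multiplying by `u₂^A` on the left
and `u₁^B` on the right and quasi-commuting restores the sandwich around `σ(Y)`, with additional
outer powers. The expansion evaluates the same element termwise, and regularity cancels all outer
powers. The summand `4AB + 2B + 4A`, common to both computations, is left out of `sigExp`. -/
theorem sig_eq_of_expansion {A B : ℕ} {Y : Uw} {ι : Type*} (s : Finset ι) (t : ι → K)
    (e : ι → ℕ × ℕ × ℕ × ℕ) (m : ℤ) (h : u 2 ^ A * Y * u 1 ^ B = ∑ i ∈ s, t i • qMon q u (e i))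
    (ht : ∀ i ∈ s, bar (t i) * q ^ sigExp A B (e i).1 (e i).2.1 (e i).2.2.1 (e i).2.2.2
      = q ^ m * t i) : sig Y = q ^ m • Y := by
  have h1 : u 2 ^ A * sig (u 2 ^ A * Y * u 1 ^ B) * u 1 ^ B
      = q ^ (m + 4 * A * B + 2 * B + 4 * A) • (u 1 ^ B * (u 2 ^ A * Y * u 1 ^ B) * u 2 ^ A) := by
    rw [h, sig_sum, Finset.mul_sum, Finset.sum_mul, Finset.mul_sum, Finset.sum_mul, Finset.smul_sum]
    refine Finset.sum_congr rfl fun i hi => ?_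
    have h2 := sig_sandwich_qMon A B (e i).1 (e i).2.1 (e i).2.2.1 (e i).2.2.2
    rw [sig_smul, mul_smul_comm, smul_mul_assoc, h2, smul_smul, mul_smul_comm, smul_mul_assoc,
      smul_smul]
    congr 1
    rw [add_assoc, add_assoc, zpow_add₀ q_ne_zero, ← mul_assoc, ht i hi, add_assoc m, add_assoc m,
      zpow_add₀ q_ne_zero m]
    ring_nf
  have h3 : u 2 ^ A * sig (u 2 ^ A * Y * u 1 ^ B) * u 1 ^ B
      = q ^ (4 * A * B + 2 * B + 4 * A : ℤ) • (u 1 ^ B * (u 2 ^ A * sig Y * u 1 ^ B) * u 2 ^ A) := by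
    simp only [sig_mul, sig_pow, sig_u, smul_pow, mul_smul_comm, smul_mul_assoc, smul_smul]
    have h4 : u 2 ^ A * (u 1 ^ B * (sig Y * u 2 ^ A)) * u 1 ^ B
        = q ^ (4 * A * B : ℤ) • (u 1 ^ B * (u 2 ^ A * sig Y * u 1 ^ B) * u 2 ^ A) := by
      rw [← mul_assoc, u2_pow_mul_u1_pow, smul_mul_assoc, smul_mul_assoc, mul_assoc (u 1 ^ B * u 2 ^ A),
        mul_assoc (sig Y), u2_pow_mul_u1_pow, mul_smul_comm, mul_smul_comm, smul_smul, ← zpow_add₀ q_ne_zero]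
      congr 1
      · congr 1; ring
      · simp only [mul_assoc]
    rw [h4, smul_smul]
    congr 1
    simp only [← zpow_natCast, ← zpow_mul, ← zpow_add₀ q_ne_zero]
    congr 1; simp; ring
  rw [h3, show m + 4 * A * B + 2 * B + 4 * A = (4 * A * B + 2 * B + 4 * A) + m by ring,
    zpow_add₀ q_ne_zero _ m, mul_smul] at h1
  have h5 := smul_right_injective Uw (zpow_ne_zero _ q_ne_zero) h1
  have h6 : u 1 ^ B * (u 2 ^ A * sig Y * u 1 ^ B) * u 2 ^ A
      = u 1 ^ B * (u 2 ^ A * (q ^ m • Y) * u 1 ^ B) * u 2 ^ A := by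
    simp only [mul_smul_comm, smul_mul_assoc]; exact h5
  exact pow_mul_injective u2_mul_injective A (mul_pow_injective mul_u1_injective B
    (pow_mul_injective u1_mul_injective B (mul_pow_injective mul_u2_injective A h6)))

/-- The quantum binomials are bar invariant, so only the exponents of `q` have to be compared, and
these agree for every pair `(k, l)`. -/
theorem sig_dcS (n : ℕ) : sig (dcS n) = q ^ (-normN ![n, 0, 0, n]) • dcS n := by
  have h := (dc_expansion n).1
  rw [← Finset.sum_product'] at h
  refine sig_eq_of_expansion _ (fun p : ℕ × ℕ => gCoef n p.1 p.2)
    (fun p => (n - p.1, 2 * p.1, 2 * p.2, n - p.2)) _ h ?_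
  rintro ⟨k, l⟩ hkl
  rw [Finset.mem_product, Finset.mem_range, Finset.mem_range] at hkl
  have hk : k ≤ n := Nat.le_of_lt_succ hkl.1
  have hl : l ≤ n := Nat.le_of_lt_succ hkl.2
  simp only [gCoef, map_mul, bar_qBinom, bar_zpow]
  have e : q ^ (-g n k l) * q ^ sigExp n n (n - k : ℕ) (2 * k : ℕ) (2 * l : ℕ) (n - l : ℕ)
      = q ^ (-normN ![n, 0, 0, n]) * q ^ g n k l := by
    simp only [← zpow_add₀ q_ne_zero]
    congr 1
    simp only [sigExp, g, normN, Matrix.cons_val]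
    push_cast [hk, hl]
    ring
  linear_combination (qBinom (n - k) l * qBinom (n - l) k) * e

theorem sig_dcX (n : ℕ) : sig (dcX n) = q ^ (-normN ![n, 0, 0, n + 1]) • dcX n := by
  have h := (dc_expansion n).2
  rw [← Finset.sum_product'] at h
  refine sig_eq_of_expansion _ (fun p : ℕ × ℕ => fCoef n p.1 p.2)
    (fun p => (n + 1 - p.1, 2 * p.1, 2 * p.2, n - p.2)) _ h ?_
  rintro ⟨k, l⟩ hkl
  rw [Finset.mem_product, Finset.mem_range, Finset.mem_range] at hkl
  have hk : k ≤ n + 1 := Nat.le_of_lt_succ hkl.1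
  have hl : l ≤ n := Nat.le_of_lt_succ hkl.2
  simp only [fCoef, map_mul, bar_qBinom, bar_zpow]
  have e : q ^ (-f n k l) * q ^ sigExp n (n + 1 : ℕ) (n + 1 - k : ℕ) (2 * k : ℕ) (2 * l : ℕ) (n - l : ℕ)
      = q ^ (-normN ![n, 0, 0, n + 1]) * q ^ f n k l := by
    simp only [← zpow_add₀ q_ne_zero]
    congr 1
    simp only [sigExp, f, normN, Matrix.cons_val]
    push_cast [hk, hl]
    ring
  linear_combination (qBinom (n - k) l * qBinom (n + 1 - l) k) * e

theorem isDualCanonical_dcS (n : ℕ) : IsDualCanonical ![n, 0, 0, n] (dcS n) :=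
  isDualCanonical_of (corner_le_cone n n (dc_leading n).1) (sig_dcS n)

theorem isDualCanonical_dcX (n : ℕ) : IsDualCanonical ![n, 0, 0, n + 1] (dcX n) :=
  isDualCanonical_of (corner_le_cone (n + 1) n (dc_leading n).2) (sig_dcX n)

theorem B_diag (n : ℕ) : B n 0 0 n = dcS n := (isDualCanonical_dcS n).dualCanonical_eq
theorem B_succ (n : ℕ) : B (n + 1) 0 0 n = dcX n := (isDualCanonical_dcX n).dualCanonical_eq

/-! ### The elements with indices `(n,0,0,n+1)` -/

/-- Elements for which the two antiautomorphisms commute up to a power of `q`. -/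
def RevWeight (e : ℤ) (x : Uw) : Prop := sig (rev x) = q ^ e • rev (sig x)

theorem RevWeight.mul {d e : ℤ} {x y : Uw} (hx : RevWeight d x) (hy : RevWeight e y) :
    RevWeight (d + e) (x * y) := by
  rw [RevWeight, rev_mul, sig_mul, sig_mul, rev_mul, hx, hy, smul_mul_smul_comm,
    zpow_add₀ q_ne_zero]

theorem RevWeight.sub {e : ℤ} {x y : Uw} (hx : RevWeight e x) (hy : RevWeight e y) :
    RevWeight e (x - y) := by
  rw [RevWeight, map_sub, sig_sub, sig_sub, map_sub, hx, hy, smul_sub]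

theorem RevWeight.smul {e : ℤ} {x : Uw} (c : K) (hx : RevWeight e x) : RevWeight e (c • x) := by
  rw [RevWeight, map_smul, sig_smul, sig_smul, map_smul, hx, smul_comm]

theorem RevWeight.pow_two {e : ℤ} {x : Uw} (hx : RevWeight e x) : RevWeight (e + e) (x ^ 2) := by
  rw [_root_.pow_two]; exact hx.mul hx

theorem revWeight_one : RevWeight 0 1 := by
  rw [RevWeight, rev_one, sig_one, rev_one, zpow_zero, one_smul]

/-- The exponent is the difference of those of `σ` at the indices `3 - i` and `i`. -/
theorem revWeight_u (i : Fin 4) : RevWeight (6 - 4 * (i : ℕ)) (u i) := by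
  rw [RevWeight, rev_u, sig_u, sig_u, map_smul, rev_u, smul_smul]
  congr 1
  rw [← zpow_natCast, ← zpow_natCast, ← zpow_add₀ q_ne_zero]
  congr 1
  have := i.2
  rw [Fin.val_rev]
  push_cast
  omega

theorem revWeight_p₁ : RevWeight (-4) p₁ :=
  ((revWeight_u 3).mul (revWeight_u 1)).sub ((revWeight_u 2).pow_two.smul _)

theorem revWeight_p₀ : RevWeight 4 p₀ :=
  ((revWeight_u 2).mul (revWeight_u 0)).sub ((revWeight_u 1).pow_two.smul _)

/-- The weight is additive on products and both terms of each recursion have the same weight. Hence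
`rev (dcX n)` is again an eigenvector of `sig`. -/
theorem revWeight_dc (n : ℕ) : RevWeight 0 (dcS n) ∧ RevWeight (-6) (dcX n) := by
  refine dc_induction (P := fun _ x => RevWeight 0 x) (Q := fun _ x => RevWeight (-6) x)
    revWeight_one (show RevWeight (-6) (u 3) from revWeight_u 3) ?_ ?_ ?_ n
  · exact ((revWeight_u 3).mul (revWeight_u 0)).sub (((revWeight_u 2).mul (revWeight_u 1)).smul _)
  · intro n h0 h1
    exact (((revWeight_u 3).mul h1).smul _).sub (((revWeight_p₁.mul (revWeight_u 2)).mul h0).smul _)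
  · intro n h0 h1
    exact ((h1.mul (revWeight_u 0)).smul _).sub (((h0.mul (revWeight_u 1)).mul revWeight_p₀).smul _)

theorem rev_monE (d c b a : ℕ) : rev (monE d c b a) = monE a b c d := by
  rw [monE_eq, monE_eq, map_smul, mon, mon, rev_mul, rev_mul, rev_mul, rev_pow, rev_pow, rev_pow,
    rev_pow, rev_u, rev_u, rev_u, rev_u]
  congr 1
  · congr 1; ring
  · simp only [mul_assoc]; rfl

/-- The reversal exchanges the two generating moves; `s ≥ 1` forces `r ≥ 1` because `b + s = 2 r`.
-/
theorem rev_corner {N M : ℕ} {x : Uw} (hx : x ∈ corner N M) : rev x ∈ corner M N := by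
  refine corner_map rev.toAddMonoidHom ?_ hx
  intro e s r d c b a he hs h3 h2 h1 h0
  change rev (q ^ e • monE d c b a) ∈ _
  rw [map_smul, rev_monE, ← zpow_natCast]
  exact mem_corner _ r s (by omega) (by omega) h0 h1 h2 h3

theorem isDualCanonical_rev_dcX (n : ℕ) : IsDualCanonical ![n + 1, 0, 0, n] (rev (dcX n)) := by
  refine isDualCanonical_of (corner_le_cone n (n + 1) ?_) ?_
  · have h := rev_corner (dc_leading n).2
    rwa [map_sub, rev_monE] at h
  · rw [(revWeight_dc n).2, sig_dcX, map_smul, smul_smul, ← zpow_add₀ q_ne_zero]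
    congr 2
    simp only [normN, Matrix.cons_val]
    push_cast
    ring

theorem B_rev (n : ℕ) : B n 0 0 (n + 1) = rev (dcX n) :=
  (isDualCanonical_rev_dcX n).dualCanonical_eq

/-! ### The generators and the frozen elements -/

theorem normN_single (i : Fin 4) : normN (Pi.single i 1) = -(2 * (i : ℕ)) := by
  fin_cases i <;> simp [normN]

theorem dualPBW_single (i : Fin 4) : dualPBW (Pi.single i 1) = u i := by
  fin_cases i <;> simp [dualPBW, uMon, Fin.sum_univ_four]

theorem isDualCanonical_u (i : Fin 4) : IsDualCanonical (Pi.single i 1) (u i) := by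
  refine isDualCanonical_of ?_ ?_
  · rw [dualPBW_single, sub_self]; exact zero_mem _
  · rw [sig_u, normN_single, neg_neg]
    congr 1

theorem dualCanonical_single (i : Fin 4) : dualCanonical (Pi.single i 1) = u i :=
  (isDualCanonical_u i).dualCanonical_eq

theorem mem_cone {a b : Expo} (h : Below a b) (hne : b ≠ a) : q • dualPBW b ∈ cone a :=
  AddSubgroup.subset_closure ⟨0, b, h, hne, by simp⟩

theorem isDualCanonical_p₁ : IsDualCanonical ![0, 1, 0, 1] p₁ := by
  refine isDualCanonical_of ?_ ?_
  · have e : p₁ - dualPBW ![0, 1, 0, 1] = -(q • dualPBW ![0, 0, 2, 0]) := by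
      simp [p₁, dualPBW, uMon, Fin.sum_univ_four, smul_smul, ← pow_two]
    rw [e]
    refine neg_mem (mem_cone ⟨1, 0, by simp, by simp, by simp, by simp⟩ fun h => ?_)
    simpa using congrFun h 3
  · rw [sig_p1]
    congr 1

theorem isDualCanonical_p₀ : IsDualCanonical ![1, 0, 1, 0] p₀ := by
  refine isDualCanonical_of ?_ ?_
  · have e : p₀ - dualPBW ![1, 0, 1, 0] = -(q • dualPBW ![0, 2, 0, 0]) := by
      simp [p₀, dualPBW, uMon, Fin.sum_univ_four, smul_smul, ← pow_two]
    rw [e]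
    refine neg_mem (mem_cone ⟨0, 1, by simp, by simp, by simp, by simp⟩ fun h => ?_)
    simpa using congrFun h 0
  · rw [sig_p0]
    congr 1

theorem B_p₁ : B 1 0 1 0 = p₁ := isDualCanonical_p₁.dualCanonical_eq
theorem B_p₀ : B 0 1 0 1 = p₀ := isDualCanonical_p₀.dualCanonical_eq

theorem B_u₁ : B 0 0 1 0 = u 1 := by
  rw [← dualCanonical_single, B]; congr 1; funext i; fin_cases i <;> rfl
theorem B_u₂ : B 0 1 0 0 = u 2 := by
  rw [← dualCanonical_single, B]; congr 1; funext i; fin_cases i <;> rfl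

/-! ### The integral form -/

theorem laurent_smul (r : ℤ[T;T⁻¹]) (x : Uw) : r • x = laurentToK r • x := rfl

theorem laurentToK_T (n : ℤ) : laurentToK (LaurentPolynomial.T n) = q ^ n := by
  simp [laurentToK]

theorem laurentToK_injective : Function.Injective laurentToK := by
  rw [injective_iff_map_eq_zero]
  intro r hr
  obtain ⟨n, p, hp⟩ := LaurentPolynomial.exists_T_pow r
  have h1 : laurentToK.comp (Polynomial.toLaurent : Polynomial ℤ →+* ℤ[T;T⁻¹])
      = (Polynomial.aeval q : Polynomial ℤ →ₐ[ℤ] K) :=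
    Polynomial.ringHom_ext' (Subsingleton.elim _ _) (by
      simp [Polynomial.toLaurent_X, laurentToK_T])
  have h2 := RingHom.congr_fun h1 p
  rw [RingHom.comp_apply, hp, map_mul, hr, zero_mul] at h2
  have h3 : p = 0 := aeval_q_injective (by rw [map_zero]; exact h2.symm)
  rw [h3, map_zero] at hp
  have h4 : 0 * LaurentPolynomial.T (-(n : ℤ)) = r * LaurentPolynomial.T n * LaurentPolynomial.T (-n) :=
    congrArg (· * LaurentPolynomial.T (-(n : ℤ))) hp
  rw [mul_assoc, ← LaurentPolynomial.T_add, add_neg_cancel, LaurentPolynomial.T_zero, mul_one,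
    zero_mul] at h4
  exact h4.symm

theorem straight_uZ : Straight (LaurentPolynomial.T (-2) : ℤ[T;T⁻¹]) uZ := by
  refine Straight.of_map (φ := AZ.val) Subtype.val_injective ?_
  have h := straight_u
  have e : laurentToK (LaurentPolynomial.T (-2)) = (q ^ 2)⁻¹ := by
    rw [laurentToK_T, zpow_neg]; norm_cast
  refine ⟨?_, ?_, ?_, ?_, ?_, ?_⟩ <;>
    simp only [laurent_smul, map_sub, map_pow, map_one, e]
  · exact h.r01
  · exact h.r12
  · exact h.r23
  · exact h.r02
  · exact h.r13
  · exact h.r03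

theorem adjoin_uZ : Algebra.adjoin ℤ[T;T⁻¹] (Set.range uZ) = ⊤ := by
  have h := Algebra.adjoin_adjoin_coe_preimage (R := ℤ[T;T⁻¹]) (s := Set.range u)
  have e : Set.range uZ = (Subtype.val ⁻¹' Set.range u : Set AZ) := by
    ext x
    simp only [Set.mem_range, Set.mem_preimage]
    exact ⟨fun ⟨i, hi⟩ => ⟨i, hi ▸ rfl⟩, fun ⟨i, hi⟩ => ⟨i, Subtype.ext hi⟩⟩
  rw [e]
  exact h

theorem linearIndependent_uZ :
    LinearIndependent ℤ[T;T⁻¹] fun e : Expo => mon uZ (e 3) (e 2) (e 1) (e 0) := by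
  refine LinearIndependent.of_comp AZ.val.toLinearMap ?_
  rw [linearIndependent_iff']
  intro s c hc i hi
  refine laurentToK_injective ?_
  rw [map_zero]
  refine linearIndependent_iff'.mp linearIndependent_uMon s (fun i => laurentToK (c i)) ?_ i hi
  rw [← hc]
  refine Finset.sum_congr rfl fun e _ => ?_
  rw [laurent_smul]
  congr 1

/-! ### The classical limit -/

/-- The polynomial ring as an algebra over the Laurent polynomials through `q ↦ 1`. -/
@[reducible] def laurentAlgebraPol : Algebra ℤ[T;T⁻¹] Pol :=
  ((algebraMap ℚ Pol).comp (LaurentPolynomial.eval₂ (Int.castRingHom ℚ) 1)).toAlgebra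

/-- The polynomial ring as an algebra over the field `Qone`. -/
@[reducible] def qoneAlgebraPol : Algebra Qone Pol := inferInstanceAs (Algebra ℚ Pol)

attribute [local instance] laurentAlgebraPol qoneAlgebraPol

instance : IsScalarTower ℤ[T;T⁻¹] Qone Pol := IsScalarTower.of_algebraMap_eq' rfl

theorem T_smul_pol (n : ℤ) (p : Pol) : (LaurentPolynomial.T n : ℤ[T;T⁻¹]) • p = p := by
  rw [Algebra.smul_def]
  change (algebraMap ℚ Pol) (LaurentPolynomial.eval₂ (Int.castRingHom ℚ) 1 (LaurentPolynomial.T n)) * p = p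
  simp

/-- At `q = 1` the parameter is `1` and all correction terms vanish, so the relations reduce to
commutativity. -/
theorem straight_X : Straight (LaurentPolynomial.T (-2) : ℤ[T;T⁻¹])
    (MvPolynomial.X : Fin 4 → Pol) := by
  refine ⟨?_, ?_, ?_, ?_, ?_, ?_⟩ <;>
    simp only [sub_smul, LaurentPolynomial.T_pow, T_smul_pol, one_smul, sub_self, add_zero] <;> ring

/-- The specialization of the integral form at `q = 1`. -/
def special : AZ →ₐ[ℤ[T;T⁻¹]] Pol :=
  (straight_uZ.exists_lift adjoin_uZ linearIndependent_uZ straight_X).choose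

theorem special_uZ (i : Fin 4) : special (uZ i) = MvPolynomial.X i :=
  (straight_uZ.exists_lift adjoin_uZ linearIndependent_uZ straight_X).choose_spec i

theorem special_mon (e : Expo) : special (mon uZ (e 3) (e 2) (e 1) (e 0))
    = MvPolynomial.monomial (Finsupp.equivFunOnFinite.symm e) (1 : ℚ) := by
  rw [map_mon, MvPolynomial.monomial_eq, Finsupp.prod_fintype _ _ (by simp), Fin.prod_univ_four]
  simp only [special_uZ, mon, map_one, one_mul, Finsupp.equivFunOnFinite_symm_apply_apply]
  ring

/-- The map from the classical limit to the polynomial ring. -/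
def limitHom : A₁ →ₐ[Qone] Pol :=
  Algebra.TensorProduct.lift (Algebra.ofId Qone Pol) special fun _ _ => Commute.all _ _

theorem limitHom_tmul (y : AZ) : limitHom (1 ⊗ₜ y) = special y := by
  simp [limitHom]

theorem span_limit : Submodule.span Qone
    (Set.range fun e : Expo => (1 ⊗ₜ mon uZ (e 3) (e 2) (e 1) (e 0) : A₁)) = ⊤ := by
  rw [eq_top_iff]
  rintro x -
  induction x using TensorProduct.induction_on with
  | zero => exact zero_mem _
  | add x y hx hy => exact add_mem hx hy
  | tmul r y =>
    have hy : y ∈ Algebra.adjoin ℤ[T;T⁻¹] (Set.range uZ) := adjoin_uZ ▸ Algebra.mem_top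
    have h1 := filt_le_span uZ (straight_uZ.adjoin_le_filt hy)
    clear hy
    induction h1 using Submodule.span_induction with
    | mem y hy =>
      obtain ⟨e, rfl⟩ := hy
      have : (r ⊗ₜ mon uZ (e 3) (e 2) (e 1) (e 0) : A₁)
          = r • (1 ⊗ₜ mon uZ (e 3) (e 2) (e 1) (e 0) : A₁) := by
        rw [TensorProduct.smul_tmul', smul_eq_mul, mul_one]
      rw [this]
      exact Submodule.smul_mem _ _ (Submodule.subset_span ⟨e, rfl⟩)
    | zero => rw [TensorProduct.tmul_zero]; exact zero_mem _
    | add y z _ _ hy hz =>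
      rw [TensorProduct.tmul_add]
      exact add_mem hy hz
    | smul c y _ hy =>
      have : (r ⊗ₜ (c • y) : A₁) = (algebraMap ℤ[T;T⁻¹] Qone c) • (r ⊗ₜ y : A₁) := by
        rw [TensorProduct.tmul_smul, algebraMap_smul]
      rw [this]
      exact Submodule.smul_mem _ _ hy

/-- The identity map from `Qone` to the rational numbers. -/
def qoneToRat (r : Qone) : ℚ := r

theorem limitHom_smul_mon (r : Qone) (e : Expo) :
    limitHom (r • (1 ⊗ₜ mon uZ (e 3) (e 2) (e 1) (e 0) : A₁))
      = MvPolynomial.monomial (Finsupp.equivFunOnFinite.symm e) (qoneToRat r) := by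
  rw [map_smul, limitHom_tmul, special_mon, Algebra.smul_def]
  change MvPolynomial.C (qoneToRat r) * _ = _
  rw [MvPolynomial.C_mul_monomial, mul_one]

/-- The ordered monomials span the classical limit and are sent to the distinct monomials of the
polynomial ring. -/
theorem limitHom_bijective : Function.Bijective limitHom := by
  classical
  constructor
  · rw [injective_iff_map_eq_zero]
    intro x hx
    have h1 : x ∈ Submodule.span Qone _ := span_limit ▸ Submodule.mem_top
    rw [Finsupp.mem_span_range_iff_exists_finsupp] at h1
    obtain ⟨c, rfl⟩ := h1
    rw [map_finsuppSum, Finsupp.sum] at hx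
    simp only [limitHom_smul_mon] at hx
    suffices c = 0 by rw [this]; simp
    ext b
    have h2 := congrArg (MvPolynomial.coeff (Finsupp.equivFunOnFinite.symm b)) hx
    rw [MvPolynomial.coeff_sum, MvPolynomial.coeff_zero] at h2
    simp only [MvPolynomial.coeff_monomial, EmbeddingLike.apply_eq_iff_eq] at h2
    rw [Finset.sum_ite_eq' c.support b] at h2
    by_cases hb : b ∈ c.support
    · rw [if_pos hb] at h2; exact h2
    · exact Finsupp.notMem_support_iff.mp hb
  · intro p
    induction p using MvPolynomial.induction_on with
    | C a => exact ⟨algebraMap Qone A₁ a, limitHom.commutes a⟩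
    | add p p' hp hp' =>
      obtain ⟨x, rfl⟩ := hp
      obtain ⟨y, rfl⟩ := hp'
      exact ⟨x + y, map_add _ _ _⟩
    | mul_X p i hp =>
      obtain ⟨x, rfl⟩ := hp
      exact ⟨x * (1 ⊗ₜ uZ i), by rw [map_mul, limitHom_tmul, special_uZ]⟩

/-- The classical limit is the polynomial ring. -/
def limitEquiv : A₁ ≃ₐ[ℚ] Pol :=
  AlgEquiv.ofRingEquiv (f := RingEquiv.ofBijective limitHom limitHom_bijective) fun a =>
    limitHom.commutes (show Qone from a)

theorem limitEquiv_tmul (y : AZ) : limitEquiv (1 ⊗ₜ y) = special y := limitHom_tmul y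

/-! ### The specializations of the dual canonical basis elements -/

/-- `x` belongs to the integral form and specializes to `p`. -/
def SpecTo (x : Uw) (p : Pol) : Prop := ∃ h : x ∈ AZ, special ⟨x, h⟩ = p

theorem specTo_u (i : Fin 4) : SpecTo (u i) (MvPolynomial.X i) := ⟨(uZ i).2, special_uZ i⟩

theorem specTo_one : SpecTo 1 1 := ⟨one_mem _, map_one special⟩

theorem SpecTo.mul {x y : Uw} {p p' : Pol} (hx : SpecTo x p) (hy : SpecTo y p') :
    SpecTo (x * y) (p * p') := by
  obtain ⟨hx, rfl⟩ := hx
  obtain ⟨hy, rfl⟩ := hy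
  exact ⟨mul_mem hx hy, map_mul special ⟨x, hx⟩ ⟨y, hy⟩⟩

theorem SpecTo.add {x y : Uw} {p p' : Pol} (hx : SpecTo x p) (hy : SpecTo y p') :
    SpecTo (x + y) (p + p') := by
  obtain ⟨hx, rfl⟩ := hx
  obtain ⟨hy, rfl⟩ := hy
  exact ⟨add_mem hx hy, map_add special ⟨x, hx⟩ ⟨y, hy⟩⟩

theorem SpecTo.sub {x y : Uw} {p p' : Pol} (hx : SpecTo x p) (hy : SpecTo y p') :
    SpecTo (x - y) (p - p') := by
  obtain ⟨hx, rfl⟩ := hx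
  obtain ⟨hy, rfl⟩ := hy
  exact ⟨sub_mem hx hy, map_sub special ⟨x, hx⟩ ⟨y, hy⟩⟩

theorem SpecTo.pow {x : Uw} {p : Pol} (hx : SpecTo x p) (n : ℕ) : SpecTo (x ^ n) (p ^ n) := by
  obtain ⟨hx, rfl⟩ := hx
  exact ⟨pow_mem hx n, map_pow special ⟨x, hx⟩ n⟩

theorem SpecTo.q_smul {x : Uw} {p : Pol} (hx : SpecTo x p) (n : ℕ) : SpecTo (q ^ n • x) p := by
  obtain ⟨hx, rfl⟩ := hx
  have e : q ^ n • x = (LaurentPolynomial.T (n : ℤ) : ℤ[T;T⁻¹]) • x := by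
    rw [laurent_smul, laurentToK_T, zpow_natCast]
  rw [e]
  refine ⟨Subalgebra.smul_mem _ hx _, ?_⟩
  exact (map_smul special (LaurentPolynomial.T (n : ℤ)) ⟨x, hx⟩).trans (T_smul_pol _ _)

/-- The reversal of the variables. -/
def revPol : Pol →ₐ[ℚ] Pol := MvPolynomial.rename Fin.rev

/-- The order reversal is invisible after specialization, because the target is commutative; only
the permutation of the variables remains. -/
theorem SpecTo.rev {x : Uw} {p : Pol} (hx : SpecTo x p) : SpecTo (rev x) (revPol p) := by
  obtain ⟨hx, rfl⟩ := hx
  change x ∈ Algebra.adjoin ℤ[T;T⁻¹] (Set.range u) at hx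
  induction hx using Algebra.adjoin_induction with
  | mem x hx =>
    obtain ⟨i, rfl⟩ := hx
    have h : SpecTo (KroneckerQuantum.rev (u i)) (MvPolynomial.X (Fin.rev i)) := by
      rw [rev_u]; exact specTo_u _
    convert h
    exact (congrArg revPol (special_uZ i)).trans (MvPolynomial.rename_X _ _)
  | algebraMap r =>
    have e1 : KroneckerQuantum.rev (algebraMap ℤ[T;T⁻¹] Uw r) = algebraMap ℤ[T;T⁻¹] Uw r := by
      rw [Algebra.algebraMap_eq_smul_one, laurent_smul, map_smul, rev_one]
    rw [e1]
    refine ⟨Subalgebra.algebraMap_mem _ r, ?_⟩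
    have e2 : special ⟨algebraMap ℤ[T;T⁻¹] Uw r, Subalgebra.algebraMap_mem _ r⟩
      = algebraMap ℤ[T;T⁻¹] Pol r := special.commutes r
    rw [e2]
    exact (revPol.commutes _).symm
  | add x y hx hy h1 h2 =>
    rw [map_add]
    convert h1.add h2 using 1
    rw [← map_add]
    exact congrArg revPol (map_add special ⟨x, hx⟩ ⟨y, hy⟩)
  | mul x y hx hy h1 h2 =>
    rw [rev_mul]
    convert h2.mul h1 using 1
    rw [← map_mul, mul_comm]
    exact congrArg revPol (map_mul special ⟨x, hx⟩ ⟨y, hy⟩)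

/-! ### The commutative sequences -/

section
variable {R S : Type*} [CommRing R] [CommRing S] (a : Fin 4 → R)

/-- The first frozen element. -/
def comP₀ : R := a 2 * a 0 - a 1 ^ 2

/-- The second frozen element. -/
def comP₁ : R := a 3 * a 1 - a 2 ^ 2

/-- The trace of the linear recursion. -/
def comZ : R := a 3 * a 0 - a 2 * a 1

/-- The classical limits of the elements with indices `(n,0,0,n)`. -/
def clS : ℕ → R
  | 0 => 1
  | 1 => comZ a
  | n + 2 => comZ a * clS (n + 1) - comP₁ a * comP₀ a * clS n

/-- The classical limits of the elements with indices `(n+1,0,0,n)`. -/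
def clX : ℕ → R
  | 0 => a 3
  | 1 => a 3 * comZ a - comP₁ a * a 2
  | n + 2 => comZ a * clX (n + 1) - comP₁ a * comP₀ a * clX n

theorem map_clX (φ : R →+* S) (n : ℕ) : φ (clX a n) = clX (fun i => φ (a i)) n := by
  have key : φ (clX a n) = clX (fun i => φ (a i)) n ∧
      φ (clX a (n + 1)) = clX (fun i => φ (a i)) (n + 1) := by
    induction n with
    | zero => simp [clX, comZ, comP₁]
    | succ n ih =>
      refine ⟨ih.2, ?_⟩
      rw [clX, clX, map_sub, map_mul, map_mul, map_mul, ih.1, ih.2]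
      simp [comZ, comP₁, comP₀]
  exact key.1

/-- The three-term recursion suits the exchange relation, whereas the noncommutative elements
satisfy the alternating one. This lemma and `clS_succ_succ` connect the two; pairs of consecutive
indices are carried along because the recursion has order two. -/
theorem clX_succ (n : ℕ) : clX a (n + 1) = a 3 * clS a (n + 1) - comP₁ a * a 2 * clS a n := by
  have key : clX a (n + 1) = a 3 * clS a (n + 1) - comP₁ a * a 2 * clS a n ∧
      clX a (n + 2) = a 3 * clS a (n + 2) - comP₁ a * a 2 * clS a (n + 1) := by
    induction n with
    | zero => simp only [clX, clS, comZ, comP₁, comP₀]; constructor <;> ring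
    | succ n ih =>
      refine ⟨ih.2, ?_⟩
      rw [clX, ih.1, ih.2, clS.eq_3 a (n + 1), clS.eq_3 a n]
      ring
  exact key.1

theorem clS_succ_succ (n : ℕ) :
    clS a (n + 2) = clX a (n + 1) * a 0 - clX a n * a 1 * comP₀ a := by
  have key : clS a (n + 2) = clX a (n + 1) * a 0 - clX a n * a 1 * comP₀ a ∧
      clS a (n + 3) = clX a (n + 2) * a 0 - clX a (n + 1) * a 1 * comP₀ a := by
    induction n with
    | zero => simp only [clX, clS, comZ, comP₁, comP₀]; constructor <;> ring
    | succ n ih =>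
      refine ⟨ih.2, ?_⟩
      rw [clS, ih.1, ih.2, clX.eq_3 a (n + 1), clX.eq_3 a n]
      ring
  exact key.1

/-- For a linear recursion of order two the expression `X n * X (n+2) - X (n+1) ^ 2` is multiplied
at each step by the determinant `comP₁ * comP₀`; its initial value is `comP₁ ^ 3`. -/
theorem clX_exchange (n : ℕ) :
    clX a n * clX a (n + 2) = clX a (n + 1) ^ 2 + comP₁ a ^ (n + 3) * comP₀ a ^ n := by
  induction n with
  | zero => simp only [clX, comZ, comP₁, comP₀]; ring
  | succ n ih =>
    rw [clX.eq_3 a (n + 1)]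
    rw [clX.eq_3 a n] at ih ⊢
    linear_combination comP₁ a * comP₀ a * ih

theorem clX_one_exchange : a 2 * clX a 1 = a 3 ^ 2 * comP₀ a + comP₁ a ^ 2 := by
  simp only [clX, comZ, comP₁, comP₀]; ring

/-- The bi-infinite sequence of cluster variables. -/
def clY (t : ℤ) : R :=
  if t ≤ 0 then clX (fun i => a (Fin.rev i)) (-t).toNat
  else if t = 1 then a 1 else if t = 2 then a 2 else clX a (t - 3).toNat

theorem clY_rev (t : ℤ) : clY (fun i => a (Fin.rev i)) t = clY a (3 - t) := by
  simp only [clY, Fin.rev_rev]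
  by_cases h0 : t ≤ 0
  · rw [if_pos h0, if_neg (by omega), if_neg (by omega), if_neg (by omega),
      show 3 - t - 3 = -t by ring]
  · by_cases h1 : t = 1
    · subst h1; simp
    · by_cases h2 : t = 2
      · subst h2; simp
      · rw [if_neg h0, if_neg h1, if_neg h2, if_pos (by omega), neg_sub]

/-- The exponent of the second frozen element in the exchange relations. -/
def expP₁ (t : ℤ) : ℤ := |t + 1| - 1

/-- The exponent of the first frozen element in the exchange relations. -/
def expP₀ (t : ℤ) : ℤ := |t - 2| - 1

/-- The exponents are nonnegative except for a single value `-1` each, `expP₁` at `t = -1` and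
`expP₀` at `t = 2`; there the frozen element multiplies the squared term. The cases `t = 1, 2` are
the passage through the two middle generators. -/
theorem clY_exchange_pos {t : ℤ} (ht : 1 ≤ t) : clY a t * clY a (t + 2)
    = clY a (t + 1) ^ 2 * comP₁ a ^ (-expP₁ t).toNat * comP₀ a ^ (-expP₀ t).toNat
      + comP₁ a ^ (expP₁ t).toNat * comP₀ a ^ (expP₀ t).toNat := by
  by_cases h1 : t = 1
  · subst h1
    simp [clY, expP₁, expP₀, clX, comP₁]
    ring
  · by_cases h2 : t = 2
    · subst h2
      have := clX_one_exchange a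
      simp [clY, expP₁, expP₀] at this ⊢
      simpa [clX] using this
    · obtain ⟨n, rfl⟩ : ∃ n : ℕ, t = n + 3 := ⟨(t - 3).toNat, by omega⟩
      have e1 : ((n : ℤ) + 3 - 3).toNat = n := by omega
      have e2 : ((n : ℤ) + 3 + 1 - 3).toNat = n + 1 := by omega
      have e3 : ((n : ℤ) + 3 + 2 - 3).toNat = n + 2 := by omega
      have e4 : expP₁ (n + 3) = n + 3 := by rw [expP₁, abs_of_nonneg (by omega)]; ring
      have e5 : expP₀ (n + 3) = n := by rw [expP₀, abs_of_nonneg (by omega)]; ring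
      have e6 : ((n : ℤ) + 3).toNat = n + 3 := by omega
      have e7 : (-((n : ℤ) + 3)).toNat = 0 := by omega
      simp only [clY]
      rw [if_neg (by omega), if_neg h1, if_neg h2, if_neg (by omega), if_neg (by omega),
        if_neg (by omega), if_neg (by omega), if_neg (by omega), if_neg (by omega), e1, e2, e3, e4, e5,
        e6, e7, clX_exchange]
      simp

theorem comP₀_rev : comP₀ (fun i => a (Fin.rev i)) = comP₁ a := by
  change a 1 * a 3 - a 2 ^ 2 = a 3 * a 1 - a 2 ^ 2; ring

theorem comP₁_rev : comP₁ (fun i => a (Fin.rev i)) = comP₀ a := by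
  change a 0 * a 2 - a 1 ^ 2 = a 2 * a 0 - a 1 ^ 2; ring

/-- The reversal of the variables exchanges the two frozen elements and maps the relation at `t` to
the one at `1 - t`. -/
theorem clY_exchange (t : ℤ) : clY a t * clY a (t + 2)
    = clY a (t + 1) ^ 2 * comP₁ a ^ (-expP₁ t).toNat * comP₀ a ^ (-expP₀ t).toNat
      + comP₁ a ^ (expP₁ t).toNat * comP₀ a ^ (expP₀ t).toNat := by
  by_cases ht : 1 ≤ t
  · exact clY_exchange_pos a ht
  · have h := clY_exchange_pos (fun i => a (Fin.rev i)) (t := 1 - t) (by omega)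
    have e1 : expP₁ (1 - t) = expP₀ t := by
      rw [expP₁, expP₀, ← abs_neg]; congr 2; ring
    have e2 : expP₀ (1 - t) = expP₁ t := by
      rw [expP₁, expP₀, ← abs_neg]; congr 2; ring
    rw [clY_rev, clY_rev, clY_rev, comP₀_rev, comP₁_rev, e1, e2, show 3 - (1 - t) = t + 2 by ring,
      show 3 - (1 - t + 2) = t by ring, show 3 - (1 - t + 1) = t + 1 by ring] at h
    rw [mul_comm, h]
    ring

end

theorem specTo_p₁ : SpecTo p₁ (comP₁ MvPolynomial.X) :=
  ((specTo_u 3).mul (specTo_u 1)).sub (((specTo_u 2).pow 2).q_smul 2)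

theorem specTo_p₀ : SpecTo p₀ (comP₀ MvPolynomial.X) :=
  ((specTo_u 2).mul (specTo_u 0)).sub (((specTo_u 1).pow 2).q_smul 2)

theorem specTo_dc (n : ℕ) : SpecTo (dcS n) (clS MvPolynomial.X n) ∧
    SpecTo (dcX n) (clX MvPolynomial.X n) := by
  refine dc_induction (P := fun n x => SpecTo x (clS MvPolynomial.X n))
    (Q := fun n x => SpecTo x (clX MvPolynomial.X n)) specTo_one (specTo_u 3) ?_ ?_ ?_ n
  · exact ((specTo_u 3).mul (specTo_u 0)).sub (((specTo_u 2).mul (specTo_u 1)).q_smul 2)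
  · intro n h0 h1
    rw [clX_succ]
    exact (((specTo_u 3).mul h1).q_smul _).sub (((specTo_p₁.mul (specTo_u 2)).mul h0).q_smul _)
  · intro n h0 h1
    rw [clS_succ_succ]
    exact ((h1.mul (specTo_u 0)).q_smul _).sub (((h0.mul (specTo_u 1)).mul specTo_p₀).q_smul _)

/-- The elements of `Pol` that are specializations of dual canonical basis elements. -/
def IsLimitB (p : Pol) : Prop := ∃ a₃ a₂ a₁ a₀ : ℕ, SpecTo (B a₃ a₂ a₁ a₀) p

theorem isLimitB_clY (t : ℤ) : IsLimitB (clY MvPolynomial.X t) := by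
  rw [clY]
  split_ifs with h0 h1 h2
  · refine ⟨(-t).toNat, 0, 0, (-t).toNat + 1, ?_⟩
    rw [B_rev]
    have h := (specTo_dc (-t).toNat).2.rev
    have e : revPol (clX MvPolynomial.X (-t).toNat)
        = clX (fun i => MvPolynomial.X (Fin.rev i)) (-t).toNat := by
      refine (map_clX _ revPol.toRingHom _).trans ?_
      congr 1
      funext i
      exact MvPolynomial.rename_X _ _
    rwa [e] at h
  · exact ⟨0, 0, 1, 0, by rw [B_u₁]; exact specTo_u 1⟩
  · exact ⟨0, 1, 0, 0, by rw [B_u₂]; exact specTo_u 2⟩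
  · refine ⟨(t - 3).toNat + 1, 0, 0, (t - 3).toNat, ?_⟩
    rw [B_succ]
    exact (specTo_dc _).2

theorem isLimitB_p₀ : IsLimitB (comP₀ MvPolynomial.X) := ⟨0, 1, 0, 1, by rw [B_p₀]; exact specTo_p₀⟩
theorem isLimitB_p₁ : IsLimitB (comP₁ MvPolynomial.X) := ⟨1, 0, 1, 0, by rw [B_p₁]; exact specTo_p₁⟩

/-! ### The cluster variables -/

/-- The exchange relations are free of subtraction, so positivity propagates along the sequence. -/
theorem clX_pos (a : Fin 4 → ℚ) (ha : ∀ i, 0 < a i) (h0 : 0 < comP₀ a) (h1 : 0 < comP₁ a) (n : ℕ) :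
    0 < clX a n := by
  have key : 0 < clX a n ∧ 0 < clX a (n + 1) := by
    induction n with
    | zero =>
      refine ⟨ha 3, pos_of_mul_pos_right ?_ (ha 2).le⟩
      rw [clX_one_exchange]
      have := ha 3
      positivity
    | succ n ih =>
      refine ⟨ih.2, pos_of_mul_pos_right ?_ ih.1.le⟩
      rw [clX_exchange]
      have := ih.2
      positivity
  exact key.1

theorem clY_ne_zero (t : ℤ) : clY U t ≠ 0 := by
  -- At this point all variables are positive and both frozen elements equal `1`, so no term of the
  -- sequence vanishes.
  let φ : Pol →+* ℚ := (MvPolynomial.aeval (![2, 1, 1, 2] : Fin 4 → ℚ)).toRingHom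
  have hφ : ∀ i, φ (MvPolynomial.X i) = (![2, 1, 1, 2] : Fin 4 → ℚ) i := fun i =>
    MvPolynomial.aeval_X _ i
  have hX : ∀ n, clX (fun i => (MvPolynomial.X i : Pol)) n ≠ 0 := by
    intro n hn
    have h := congrArg φ hn
    rw [map_clX, map_zero] at h
    refine (clX_pos _ ?_ ?_ ?_ n).ne' h
    · intro i; rw [hφ]; fin_cases i <;> simp
    · simp [comP₀, hφ]
    · simp [comP₁, hφ]
  have hX' : ∀ n, clX (fun i => (MvPolynomial.X (Fin.rev i) : Pol)) n ≠ 0 := by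
    intro n hn
    have h := congrArg φ hn
    rw [map_clX, map_zero] at h
    refine (clX_pos _ ?_ ?_ ?_ n).ne' h
    · intro i; rw [hφ]; fin_cases i <;> simp
    · rw [comP₀_rev (fun i => φ (MvPolynomial.X i))]; simp [comP₁, hφ]
    · rw [comP₁_rev (fun i => φ (MvPolynomial.X i))]; simp [comP₀, hφ]
  have hinj := IsFractionRing.injective Pol Frac
  have hU : ∀ i, U i ≠ 0 := fun i => by
    rw [U, map_ne_zero_iff _ hinj]; exact MvPolynomial.X_ne_zero i
  rw [clY]
  split_ifs
  · have := map_clX (fun i => (MvPolynomial.X (Fin.rev i) : Pol)) (algebraMap Pol Frac) (-t).toNat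
    change clX (fun i => algebraMap Pol Frac (MvPolynomial.X (Fin.rev i))) _ ≠ 0
    rw [← this, map_ne_zero_iff _ hinj]
    exact hX' _
  · exact hU 1
  · exact hU 2
  · have := map_clX (fun i => (MvPolynomial.X i : Pol)) (algebraMap Pol Frac) (t - 3).toNat
    change clX (fun i => algebraMap Pol Frac (MvPolynomial.X i)) _ ≠ 0
    rw [← this, map_ne_zero_iff _ hinj]
    exact hX _

theorem clY_U (t : ℤ) : clY U t = algebraMap Pol Frac (clY MvPolynomial.X t) := by
  simp only [clY]
  split_ifs
  · exact (map_clX _ (algebraMap Pol Frac) _).symm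
  · rfl
  · rfl
  · exact (map_clX _ (algebraMap Pol Frac) _).symm

/-- The matrix mutation rule for a frozen row; the factor `2` comes from the double arrow between
the mutable vertices. -/
theorem expP₁_add (t : ℤ) : expP₁ (t - 1) + expP₁ (t + 1) = 2 * max (expP₁ t) 0 := by
  simp only [expP₁]
  rcases abs_cases (t - 1 + 1) with h | h <;> rcases abs_cases (t + 1 + 1) with h' | h' <;>
    rcases abs_cases (t + 1) with h'' | h'' <;> omega

theorem expP₀_add (t : ℤ) : expP₀ (t - 1) + expP₀ (t + 1) = 2 * max (expP₀ t) 0 := by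
  simp only [expP₀]
  rcases abs_cases (t - 1 - 2) with h | h <;> rcases abs_cases (t + 1 - 2) with h' | h' <;>
    rcases abs_cases (t - 2) with h'' | h'' <;> omega

/-- The seeds with the two mutable variables `clY U t` and `clY U (t+1)`. -/
structure IsSeedAt (s : Seed (Fin 4) Frac) (t : ℤ) (i j : Fin 4) : Prop where
  xi : s.x i = clY U t
  xj : s.x j = clY U (t + 1)
  x2 : s.x 2 = comP₀ U
  x3 : s.x 3 = comP₁ U
  bii : s.b i i = 0
  bji : s.b j i = 2
  b2i : s.b 2 i = -expP₀ t
  b3i : s.b 3 i = -expP₁ t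
  bjj : s.b j j = 0
  bij : s.b i j = -2
  b2j : s.b 2 j = expP₀ (t - 1)
  b3j : s.b 3 j = expP₁ (t - 1)

theorem prod_fin_four {i j : Fin 4} (hij : i = 0 ∧ j = 1 ∨ i = 1 ∧ j = 0) (φ : Fin 4 → Frac) :
    ∏ l, φ l = φ i * φ j * φ 2 * φ 3 := by
  rw [Fin.prod_univ_four]
  rcases hij with ⟨rfl, rfl⟩ | ⟨rfl, rfl⟩
  · rfl
  · rw [mul_comm (φ 0)]

/-- The variable changes by `clY_exchange` at `t`, and the frozen rows change by `expP₀_add` and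
`expP₁_add`. The slots trade roles because slot `i` now carries the later variable `clY U (t + 2)`.
-/
theorem IsSeedAt.mutate_fst {s : Seed (Fin 4) Frac} {t : ℤ} {i j : Fin 4}
    (hij : i = 0 ∧ j = 1 ∨ i = 1 ∧ j = 0) (h : IsSeedAt s t i j) :
    IsSeedAt (s.mutate i) (t + 1) j i := by
  have hji : j ≠ i := by rcases hij with ⟨rfl, rfl⟩ | ⟨rfl, rfl⟩ <;> decide
  have h2i : (2 : Fin 4) ≠ i := by rcases hij with ⟨rfl, rfl⟩ | ⟨rfl, rfl⟩ <;> decide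
  have h3i : (3 : Fin 4) ≠ i := by rcases hij with ⟨rfl, rfl⟩ | ⟨rfl, rfl⟩ <;> decide
  have e0 := expP₀_add t
  have e1 := expP₁_add t
  refine ⟨?_, ?_, ?_, ?_, ?_, ?_, ?_, ?_, ?_, ?_, ?_, ?_⟩
  · simp [Seed.mutate, hji, h.xj]
  · simp only [Seed.mutate, if_true]
    rw [div_eq_iff (by rw [h.xi]; exact clY_ne_zero t), prod_fin_four hij, prod_fin_four hij, h.xi, h.xj,
      h.x2, h.x3, h.bii, h.bji, h.b2i, h.b3i, mul_comm _ (clY U t), add_assoc t 1 1]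
    refine Eq.trans ?_ (clY_exchange U t).symm
    simp
    ring
  · simp [Seed.mutate, h2i, h.x2]
  · simp [Seed.mutate, h3i, h.x3]
  · simp [Seed.mutate, hji, h.bjj, h.bij, h.bji]
  · simp [Seed.mutate, h.bij]
  · simp [Seed.mutate, hji, h2i, h.b2j, h.b2i, h.bij]; omega
  · simp [Seed.mutate, hji, h3i, h.b3j, h.b3i, h.bij]; omega
  · simp [Seed.mutate, h.bii]
  · simp [Seed.mutate, h.bji]
  · simp [Seed.mutate, h.b2i]
  · simp [Seed.mutate, h.b3i]

theorem IsSeedAt.mutate_snd {s : Seed (Fin 4) Frac} {t : ℤ} {i j : Fin 4}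
    (hij : i = 0 ∧ j = 1 ∨ i = 1 ∧ j = 0) (h : IsSeedAt s t i j) :
    IsSeedAt (s.mutate j) (t - 1) j i := by
  have hji : i ≠ j := by rcases hij with ⟨rfl, rfl⟩ | ⟨rfl, rfl⟩ <;> decide
  have h2i : (2 : Fin 4) ≠ j := by rcases hij with ⟨rfl, rfl⟩ | ⟨rfl, rfl⟩ <;> decide
  have h3i : (3 : Fin 4) ≠ j := by rcases hij with ⟨rfl, rfl⟩ | ⟨rfl, rfl⟩ <;> decide
  have e0 := expP₀_add (t - 1)
  have e1 := expP₁_add (t - 1)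
  rw [sub_add_cancel] at e0 e1
  refine ⟨?_, ?_, ?_, ?_, ?_, ?_, ?_, ?_, ?_, ?_, ?_, ?_⟩
  · simp only [Seed.mutate, if_true]
    rw [div_eq_iff (by rw [h.xj]; exact clY_ne_zero _), prod_fin_four hij, prod_fin_four hij, h.xi, h.xj,
      h.x2, h.x3, h.bjj, h.bij, h.b2j, h.b3j]
    have := clY_exchange U (t - 1)
    rw [sub_add_cancel, show t - 1 + 2 = t + 1 by ring] at this
    refine Eq.trans ?_ this.symm
    simp
    ring
  · simp [Seed.mutate, hji, h.xi]
  · simp [Seed.mutate, h2i, h.x2]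
  · simp [Seed.mutate, h3i, h.x3]
  · simp [Seed.mutate, h.bjj]
  · simp [Seed.mutate, h.bij]
  · simp [Seed.mutate, h.b2j]
  · simp [Seed.mutate, h.b3j]
  · simp [Seed.mutate, hji, h.bii, h.bij, h.bji]
  · simp [Seed.mutate, h.bji]
  · simp [Seed.mutate, hji, h2i, h.b2j, h.b2i, h.bji]; omega
  · simp [Seed.mutate, hji, h3i, h.b3j, h.b3i, h.bji]; omega

theorem isSeedAt_initial : IsSeedAt initialSeed 0 0 1 := by
  refine ⟨?_, ?_, ?_, ?_, ?_, ?_, ?_, ?_, ?_, ?_, ?_, ?_⟩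
  all_goals simp [initialSeed, clY, clX, comP₀, comP₁, expP₀, expP₁]

theorem Reachable.isSeedAt {s : Seed (Fin 4) Frac} (h : Reachable s) :
    ∃ (t : ℤ) (i j : Fin 4), (i = 0 ∧ j = 1 ∨ i = 1 ∧ j = 0) ∧ IsSeedAt s t i j := by
  induction h with
  | init => exact ⟨0, 0, 1, Or.inl ⟨rfl, rfl⟩, isSeedAt_initial⟩
  | mutate s k hk _ ih =>
    obtain ⟨t, i, j, hij, h⟩ := ih
    have hk' : k = i ∨ k = j := by
      rcases hij with ⟨rfl, rfl⟩ | ⟨rfl, rfl⟩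
      · exact hk
      · exact hk.symm
    have hji : j = 0 ∧ i = 1 ∨ j = 1 ∧ i = 0 := by tauto
    rcases hk' with rfl | rfl
    · exact ⟨t + 1, j, _, hji, h.mutate_fst hij⟩
    · exact ⟨t - 1, _, i, hji, h.mutate_snd hij⟩

theorem IsClusterVariable.isLimitB {y : Frac} (hy : IsClusterVariable y) :
    ∃ p : Pol, IsLimitB p ∧ y = algebraMap Pol Frac p := by
  obtain ⟨s, hs, l, rfl⟩ := hy
  obtain ⟨t, i, j, hij, h⟩ := hs.isSeedAt
  have hl : l = i ∨ l = j ∨ l = 2 ∨ l = 3 := by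
    rcases hij with ⟨rfl, rfl⟩ | ⟨rfl, rfl⟩ <;> fin_cases l <;> simp
  rcases hl with rfl | rfl | rfl | rfl
  · exact ⟨_, isLimitB_clY t, h.xi.trans (clY_U t)⟩
  · exact ⟨_, isLimitB_clY (t + 1), h.xj.trans (clY_U (t + 1))⟩
  · exact ⟨_, isLimitB_p₀, h.x2.trans (by simp [comP₀, U])⟩
  · exact ⟨_, isLimitB_p₁, h.x3.trans (by simp [comP₁, U])⟩

end KroneckerQuantum

end

theorem theorem5p3 :
    (∀ n : ℕ,
      KroneckerQuantum.u 2 ^ n * KroneckerQuantum.B (n + 1) 0 0 n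
          * KroneckerQuantum.u 1 ^ (n + 1) =
        ∑ p ∈ KroneckerQuantum.pairs' n,
          (KroneckerQuantum.q ^ KroneckerQuantum.f n p.1 p.2
              * KroneckerQuantum.qBinom ((n : ℤ) - p.1) p.2
              * KroneckerQuantum.qBinom ((n : ℤ) + 1 - p.2) p.1) •
            (KroneckerQuantum.p₁ ^ (n + 1 - p.1) * KroneckerQuantum.u 2 ^ (2 * p.1)
              * KroneckerQuantum.u 1 ^ (2 * p.2) * KroneckerQuantum.p₀ ^ (n - p.2))) ∧
    (∀ n : ℕ,
      KroneckerQuantum.u 2 ^ n * KroneckerQuantum.B n 0 0 n * KroneckerQuantum.u 1 ^ n =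
        ∑ p ∈ KroneckerQuantum.pairs n,
          (KroneckerQuantum.q ^ KroneckerQuantum.g n p.1 p.2
              * KroneckerQuantum.qBinom ((n : ℤ) - p.1) p.2
              * KroneckerQuantum.qBinom ((n : ℤ) - p.2) p.1) •
            (KroneckerQuantum.p₁ ^ (n - p.1) * KroneckerQuantum.u 2 ^ (2 * p.1)
              * KroneckerQuantum.u 1 ^ (2 * p.2) * KroneckerQuantum.p₀ ^ (n - p.2))) ∧
    (∃ Φ : KroneckerQuantum.A₁ ≃ₐ[ℚ] MvPolynomial (Fin 4) ℚ,
      (∀ i : Fin 4, Φ (1 ⊗ₜ KroneckerQuantum.uZ i) = MvPolynomial.X i) ∧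
      ∀ y : KroneckerQuantum.Frac, KroneckerQuantum.IsClusterVariable y →
        ∃ (a₃ a₂ a₁ a₀ : ℕ)
          (h : KroneckerQuantum.B a₃ a₂ a₁ a₀ ∈ KroneckerQuantum.AZ),
          y = algebraMap (MvPolynomial (Fin 4) ℚ) KroneckerQuantum.Frac
            (Φ (1 ⊗ₜ ⟨KroneckerQuantum.B a₃ a₂ a₁ a₀, h⟩))) := by
  refine ⟨fun n => ?_, fun n => ?_, KroneckerQuantum.limitEquiv, fun i => ?_, fun y hy => ?_⟩
  · rw [KroneckerQuantum.B_succ]; exact KroneckerQuantum.dcX_expansion n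
  · rw [KroneckerQuantum.B_diag]; exact KroneckerQuantum.dcS_expansion n
  · rw [KroneckerQuantum.limitEquiv_tmul, KroneckerQuantum.special_uZ]
  · obtain ⟨p, ⟨a₃, a₂, a₁, a₀, h, hp⟩, rfl⟩ := hy.isLimitB
    exact ⟨a₃, a₂, a₁, a₀, h, by rw [KroneckerQuantum.limitEquiv_tmul, hp]⟩
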